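/- Let $\Omega\subset\mathbb R^2\simeq\mathbb C$ be a bounded, simply connected domain with $C^2$ boundary $\Gamma=\partial\Omega$, let $g:\Gamma\to\mathbb S^1\subset\mathbb C$ be a $C^1$ map with degree $\mathcal D=\deg(g;\Gamma)>0$ ($\Gamma$ positively oriented), and let $\alpha\in(0,\frac{\pi}{2})$. For $s\in(0,1]$, $\varepsilon>0$ and $u\in H^1(\Omega;\mathbb C)$ put $$E_\varepsilon^{g,\alpha}(u)=\frac12\int_\Omega\Big(|\nabla u|^2+\frac{1}{2\varepsilon^2}\big(|u|^2-1\big)^2\Big)\,dx+\frac{\varepsilon^{-s}}{2}\int_\Gamma\Big(\tfrac12\big(|u|^2-1\big)^2+\big[(u,g)-\cos\alpha\big]^2\Big)\,ds,$$ where $(u,g)=\Re(u\bar g)$ and $u$ is understood in the sense of traces on $\Gamma$. Let $E_\varepsilon^{g,\alpha}:=\inf_{u\in H^1(\Omega;\mathbb C)}E_\varepsilon^{g,\alpha}(u)$ be the minimal energy, and let $C_\alpha=\left(\frac{\alpha}{\pi}\right)^2+\left(1-\frac{\alpha}{\pi}\right)^2$. Then there is a constant $C_1$, depending only on $\Omega$,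 $g$ and $\alpha$, such that for all $s\in(0,1]$ and all $\varepsilon>0$: (i) if $sC_\alpha\ge\frac12$, then $E_\varepsilon^{g,\alpha}\le\pi\mathcal D\,|\ln\varepsilon|+C_1$; (ii) if $sC_\alpha<\frac12$, then $E_\varepsilon^{g,\alpha}\le 2\pi\mathcal D\,s\,C_\alpha\,|\ln\varepsilon|+C_1$. -/

import Mathlib

open MeasureTheory Filter Topology
open scoped ENNReal ContDiff

namespace Boojum

/-- The boundary of the planar set `Ω` is of class `C²`: near each boundary point, `Ω` is the
sublevel set `{ρ < 0}` of a `C²` function with non-vanishing differential. -/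
def HasC2Boundary (Ω : Set ℂ) : Prop :=
  ∀ p ∈ frontier Ω, ∃ ρ : ℂ → ℝ, ContDiffAt ℝ 2 ρ p ∧ fderiv ℝ ρ p ≠ 0 ∧
    ∀ᶠ x in 𝓝 p, (x ∈ Ω ↔ ρ x < 0)

/-- A bounded, simply connected planar domain with `C²` boundary. -/
structure IsC2Domain (Ω : Set ℂ) : Prop where
  isOpen : IsOpen Ω
  isBounded : Bornology.IsBounded Ω
  simplyConnected : IsSimplyConnected Ω
  boundary : HasC2Boundary Ω

/-- `c` is a regular `C²` closed parametrization (of period `2π`) of the simple closed curve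
`frontier Ω`, traversed once in the positive sense: `Ω` lies to the left of `c`. -/
structure IsPositiveParam (Ω : Set ℂ) (c : ℝ → ℂ) : Prop where
  contDiff : ContDiff ℝ 2 c
  periodic : Function.Periodic c (2 * Real.pi)
  deriv_ne_zero : ∀ t, deriv c t ≠ 0
  injOn : Set.InjOn c (Set.Ico 0 (2 * Real.pi))
  range_eq : Set.range c = frontier Ω
  left : ∀ t, ∀ᶠ r : ℝ in 𝓝[>] 0, c t + (r : ℂ) * (Complex.I * deriv c t) ∈ Ω

/-- `deg (g; ∂Ω) = D`: along a positive parametrization of the boundary curve, a continuous phase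
of `g` increases by `2πD`. -/
def HasBoundaryDegree (Ω : Set ℂ) (g : ℂ → ℂ) (D : ℤ) : Prop :=
  ∃ c : ℝ → ℂ, IsPositiveParam Ω c ∧ ∃ φ : ℝ → ℝ, Continuous φ ∧
    (∀ t, g (c t) = Complex.exp ((φ t : ℂ) * Complex.I)) ∧
    φ (2 * Real.pi) - φ 0 = 2 * Real.pi * (D : ℝ)

/-- Lebesgue measure on `Ω`. -/
noncomputable def areaOn (Ω : Set ℂ) : Measure ℂ := (volume : Measure ℂ).restrict Ω

/-- Arc length (one-dimensional Hausdorff measure) on the boundary of `Ω`. -/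
noncomputable def arcOn (Ω : Set ℂ) : Measure ℂ := (μH[1] : Measure ℂ).restrict (frontier Ω)

/-- `G` is the weak derivative of `u` on `Ω` in the direction `v`. -/
def IsWeakDeriv (Ω : Set ℂ) (v : ℂ) (u G : ℂ → ℂ) : Prop :=
  ∀ φ : ℂ → ℝ, ContDiff ℝ ∞ φ → HasCompactSupport φ → tsupport φ ⊆ Ω →
    ∫ x, fderiv ℝ φ x v • u x ∂(areaOn Ω) = - ∫ x, φ x • G x ∂(areaOn Ω)

/-- `u ∈ H¹(Ω; ℂ)`, with weak partial derivatives `G₁ = ∂u/∂x₁` and `G₂ = ∂u/∂x₂`. -/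
structure IsH1 (Ω : Set ℂ) (u G₁ G₂ : ℂ → ℂ) : Prop where
  memLp : MemLp u 2 (areaOn Ω)
  memLp₁ : MemLp G₁ 2 (areaOn Ω)
  memLp₂ : MemLp G₂ 2 (areaOn Ω)
  weak₁ : IsWeakDeriv Ω 1 u G₁
  weak₂ : IsWeakDeriv Ω Complex.I u G₂

/-- `t ∈ L²(∂Ω)` is the boundary trace of the `H¹(Ω)` function `u` with weak partial derivatives
`G₁`, `G₂`: there are functions `w n` of class `C¹` up to the boundary which converge to `u` in
`H¹(Ω)` and whose restrictions to the boundary converge to `t` in `L²(∂Ω)`. -/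
def IsTrace (Ω : Set ℂ) (u G₁ G₂ t : ℂ → ℂ) : Prop :=
  MemLp t 2 (arcOn Ω) ∧ ∃ w : ℕ → ℂ → ℂ, (∀ n, ContDiff ℝ 1 (w n)) ∧
    Tendsto (fun n => eLpNorm (fun x => w n x - u x) 2 (areaOn Ω)) atTop (𝓝 0) ∧
    Tendsto (fun n => eLpNorm (fun x => fderiv ℝ (w n) x 1 - G₁ x) 2 (areaOn Ω))
      atTop (𝓝 0) ∧
    Tendsto (fun n => eLpNorm (fun x => fderiv ℝ (w n) x Complex.I - G₂ x) 2 (areaOn Ω))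
      atTop (𝓝 0) ∧
    Tendsto (fun n => eLpNorm (fun x => w n x - t x) 2 (arcOn Ω)) atTop (𝓝 0)

/-- The anchoring density `W(u, g) = ½ (|u|² - 1)² + ((u, g) - cos α)²`, with
`(u, g) = Re (u * conj g)`. -/
noncomputable def anchoring (α : ℝ) (u g : ℂ) : ℝ :=
  (1 / 2) * (‖u‖ ^ 2 - 1) ^ 2 + ((u * (starRingEnd ℂ) g).re - Real.cos α) ^ 2

/-- The energy
`½ ∫_Ω (|∇u|² + (|u|² - 1)² / (2ε²)) dx + (ε^(-s) / 2) ∫_∂Ω W(u, g) ds`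
of an `H¹(Ω)` function `u` with weak partial derivatives `G₁`, `G₂` and trace `t`,
as an element of `[0, ∞]`. -/
noncomputable def energy (Ω : Set ℂ) (g : ℂ → ℂ) (α s ε : ℝ) (u G₁ G₂ t : ℂ → ℂ) : ℝ≥0∞ :=
  (∫⁻ x, ENNReal.ofReal ((1 / 2) * (‖G₁ x‖ ^ 2 + ‖G₂ x‖ ^ 2
      + 1 / (2 * ε ^ 2) * (‖u x‖ ^ 2 - 1) ^ 2)) ∂(areaOn Ω))
    + ∫⁻ x, ENNReal.ofReal (ε ^ (-s) / 2 * anchoring α (t x) (g x)) ∂(arcOn Ω)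

/-- The minimal energy over `H¹(Ω; ℂ)` (weak derivatives and trace are determined by `u`). -/
noncomputable def minEnergy (Ω : Set ℂ) (g : ℂ → ℂ) (α s ε : ℝ) : ℝ≥0∞ :=
  ⨅ (u : ℂ → ℂ) (G₁ : ℂ → ℂ) (G₂ : ℂ → ℂ) (t : ℂ → ℂ)
    (_ : IsH1 Ω u G₁ G₂) (_ : IsTrace Ω u G₁ G₂ t), energy Ω g α s ε u G₁ G₂ t

/-- `C_α = (α/π)² + (1 - α/π)²`. -/
noncomputable def Cα (α : ℝ) : ℝ := (α / Real.pi) ^ 2 + (1 - α / Real.pi) ^ 2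

end Boojum

/-! Two families of competitors give the two bounds, both of the form `u = exp (i H) ∏ V_j` with `H`
real, `C¹` and independent of `ε`, and each `V_j` a regularized vortex with `‖V_j‖ ≤ 1`.

Interior vortices. Take `D` copies of `z / √(|z|² + ε²)` at distinct points of the domain. In polar
coordinates each has Dirichlet integral `2π |ln ε| + O(1)`, hence energy `π |ln ε| + O(1)`, while
its potential term stays bounded. The boundary curve winds once around each centre, so the degree of
`g` is used up by the `D` windings and the missing phase `H` is a periodic, single-valued function
on the boundary. It is chosen so that the unimodular limit of `u` there is `g exp (iα)`, for which
the anchoring term vanishes.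

Boundary vortices. Take `2D` boundary points and put `V_j = exp (i a θ)`, where `θ` is a cut-off
argument about a point at distance of order `δ = ε^s` outside the domain. The domain is locally a
half-disc up to a cusp of quadratic width, so `∫ |∇θ|²` is at most `π s |ln ε| + O(1)`. In the limit
`δ → 0` the phase drops by `π a` at the vortex. The anchoring only asks the phase relative to `g` to
be `±α` modulo `2π`, so drops `2α` (from `α` to `-α`) and `2π - 2α` (from `-α` to `α - 2π`) may
alternate. With `a = 2α/π` and `a = 2 - 2α/π`, a pair has `∑ a² = 4 C_α` and energy `2π s C_α |ln ε|
+ O(1)`; the `D` pairs together absorb the degree. The smoothing at scale `δ` makes a squared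
boundary error of size `δ² / (t² + δ²)` at arc distance `t`, whose integral is of order `δ = ε^s`
and is balanced by the weight `ε^(-s)`. The two leading terms coincide at `s C_α = 1/2`.

In either family the vortices interact only at order one: each gradient is `O(1/|x - q_j|)`, and for
distinct centres the product of two such bounds is integrable. `VortexFactor` records what a single
vortex must satisfy, `exists_minEnergy_le_of_vortexFactor` adds up the energies, and
`exists_vortexFactor_interior` and `IsPositiveParam.exists_vortexFactor_boundary` supply the two
kinds of vortex. -/

namespace Boojum

/-! ### Gluing of `C¹` functions and admissible competitors -/

open scoped Manifold in
theorem exists_contDiff_forall_mem_convex {F : Type*} [NormedAddCommGroup F] [NormedSpace ℝ F]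
    {t : ℂ → Set F} (ht : ∀ x, Convex ℝ (t x))
    (hloc : ∀ x, ∃ h : ℂ → F, ContDiffAt ℝ 1 h x ∧ ∀ᶠ y in 𝓝 x, h y ∈ t y) :
    ∃ w : ℂ → F, ContDiff ℝ 1 w ∧ ∀ x, w x ∈ t x := by
  obtain ⟨w, hw⟩ := exists_contMDiffMap_forall_mem_convex_of_local (n := 1) (M := ℂ)
    𝓘(ℝ, ℂ) ht (fun x => by
      obtain ⟨h, hh, hx⟩ := hloc x
      have hh' := (hh.eventually (by simp)).and hx
      refine ⟨_, hh', h, ?_, fun y hy => hy.2⟩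
      rw [contMDiffOn_iff_contDiffOn]
      exact fun y hy => hy.1.contDiffWithinAt)
  exact ⟨w, w.contMDiff.contDiff, hw⟩

/-- A partition of unity preserves convex pointwise constraints. The constraint is a single value on
`K` and void elsewhere, and `u` itself is a local solution near points of `K`. -/
theorem exists_contDiff_eqOn {F : Type*} [NormedAddCommGroup F] [NormedSpace ℝ F]
    {K : Set ℂ} (hK : IsClosed K) {u : ℂ → F} (hu : ∀ x ∈ K, ContDiffAt ℝ 1 u x) :
    ∃ w : ℂ → F, ContDiff ℝ 1 w ∧ Set.EqOn w u K := by
  classical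
  obtain ⟨w, hw, h⟩ := exists_contDiff_forall_mem_convex
    (t := fun x => {y | x ∈ K → y = u x}) (fun x => by
      by_cases hx : x ∈ K
      · simp [hx, convex_singleton (u x)]
      · simp [hx, convex_univ]) (fun x => by
      by_cases hx : x ∈ K
      · exact ⟨u, hu x hx, Eventually.of_forall fun y _ => rfl⟩
      · refine ⟨fun _ => 0, contDiffAt_const, ?_⟩
        filter_upwards [hK.isOpen_compl.mem_nhds hx] with y hy h
        exact absurd h hy)
  exact ⟨w, hw, fun x hx => h x hx⟩

theorem isWeakDeriv_of_contDiff {Ω : Set ℂ} {w : ℂ → ℂ}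
    (hw : ContDiff ℝ 1 w) (v : ℂ) : IsWeakDeriv Ω v w (fun x => fderiv ℝ w x v) := by
  intro φ hφ hc hs
  have hφ' : Continuous fun x => fderiv ℝ φ x v := (hφ.continuous_fderiv (by simp)).clm_apply
    continuous_const
  have hw' : Continuous fun x => fderiv ℝ w x v := (hw.continuous_fderiv (by simp)).clm_apply
    continuous_const
  have hc' : HasCompactSupport fun x => fderiv ℝ φ x v := by
    refine hc.fderiv (𝕜 := ℝ) |>.mono' ?_
    intro x hx
    apply subset_tsupport
    intro h
    simp [h] at hx
  have z1 : ∀ x, x ∉ Ω → fderiv ℝ φ x v • w x = 0 := by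
    intro x hx
    have : fderiv ℝ φ x = 0 := by
      by_contra h
      exact hx (hs (tsupport_fderiv_subset ℝ (subset_tsupport _ h)))
    simp [this]
  have z2 : ∀ x, x ∉ Ω → φ x • fderiv ℝ w x v = 0 := by
    intro x hx
    rw [image_eq_zero_of_notMem_tsupport (fun h => hx (hs h)), zero_smul]
  rw [areaOn, setIntegral_eq_integral_of_forall_compl_eq_zero z1,
    setIntegral_eq_integral_of_forall_compl_eq_zero z2]
  have := integral_smul_fderiv_eq_neg_fderiv_smul_of_integrable (μ := (volume : Measure ℂ)) (𝕜 := ℝ)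
    (f := φ) (g := w) (v := v)
    ((hφ'.smul hw.continuous).integrable_of_hasCompactSupport hc'.smul_right)
    ((hφ.continuous.smul hw').integrable_of_hasCompactSupport hc.smul_right)
    ((hφ.continuous.smul hw.continuous).integrable_of_hasCompactSupport hc.smul_right)
    (fun x _ => hφ.differentiable (by simp) x) (fun x _ => hw.differentiable (by simp) x)
  rw [this, neg_neg]

theorem memLp_areaOn_of_continuous {Ω : Set ℂ} (ho : IsOpen Ω) (hb : Bornology.IsBounded Ω)
    {w : ℂ → ℂ} (hw : Continuous w) : MemLp w 2 (areaOn Ω) := by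
  have : IsFiniteMeasure (areaOn Ω) := ⟨by
    rw [areaOn, Measure.restrict_apply_univ]; exact hb.measure_lt_top⟩
  obtain ⟨M, hM⟩ := hb.isCompact_closure.exists_bound_of_continuousOn hw.continuousOn
  refine MemLp.of_bound hw.aestronglyMeasurable M ?_
  rw [areaOn, ae_restrict_iff' ho.measurableSet]
  exact Eventually.of_forall fun x hx => hM x (subset_closure hx)

theorem memLp_arcOn_of_continuous {Ω : Set ℂ} (hb : Bornology.IsBounded Ω)
    (hf : IsFiniteMeasure (arcOn Ω))
    {w : ℂ → ℂ} (hw : Continuous w) : MemLp w 2 (arcOn Ω) := by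
  obtain ⟨M, hM⟩ := hb.isCompact_closure.exists_bound_of_continuousOn hw.continuousOn
  refine MemLp.of_bound hw.aestronglyMeasurable M ?_
  rw [arcOn, ae_restrict_iff' isClosed_frontier.measurableSet]
  exact Eventually.of_forall fun x hx => hM x (frontier_subset_closure hx)

/-- Functions that are `C¹` near the closure of the domain are admissible. -/
theorem minEnergy_le_energy {Ω : Set ℂ} (ho : IsOpen Ω) (hb : Bornology.IsBounded Ω)
    (hf : IsFiniteMeasure (arcOn Ω)) (g : ℂ → ℂ) (α s ε : ℝ) {u : ℂ → ℂ}
    (hu : ∀ x ∈ closure Ω, ContDiffAt ℝ 1 u x) :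
    minEnergy Ω g α s ε ≤ energy Ω g α s ε u (fun x => fderiv ℝ u x 1)
      (fun x => fderiv ℝ u x Complex.I) u := by
  -- The energy sees only values on the closure and derivatives on the open set, so `u` may be
  -- replaced by a globally `C¹` function. That function is its own trace, with a constant
  -- approximating sequence.
  obtain ⟨w, hw, hwu⟩ := exists_contDiff_eqOn isClosed_closure hu
  have hw' (v : ℂ) : Continuous fun x => fderiv ℝ w x v :=
    (hw.continuous_fderiv (by simp)).clm_apply continuous_const
  have h1 : IsH1 Ω w (fun x => fderiv ℝ w x 1) (fun x => fderiv ℝ w x Complex.I) :=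
    ⟨memLp_areaOn_of_continuous ho hb hw.continuous, memLp_areaOn_of_continuous ho hb (hw' _),
      memLp_areaOn_of_continuous ho hb (hw' _), isWeakDeriv_of_contDiff hw _,
      isWeakDeriv_of_contDiff hw _⟩
  have h2 : IsTrace Ω w (fun x => fderiv ℝ w x 1) (fun x => fderiv ℝ w x Complex.I) w :=
    ⟨memLp_arcOn_of_continuous hb hf hw.continuous, fun _ => w, fun _ => hw, by simp, by simp,
      by simp, by simp⟩
  have h3 : minEnergy Ω g α s ε ≤ energy Ω g α s ε w (fun x => fderiv ℝ w x 1)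
      (fun x => fderiv ℝ w x Complex.I) w :=
    iInf_le_of_le w <| iInf_le_of_le _ <| iInf_le_of_le _ <| iInf_le_of_le w <|
      iInf_le_of_le h1 <| iInf_le_of_le h2 le_rfl
  refine h3.trans_eq ?_
  unfold energy
  congr 1
  · refine setLIntegral_congr_fun ho.measurableSet fun x hx => ?_
    have hx' : w =ᶠ[𝓝 x] u := by
      filter_upwards [ho.mem_nhds hx] with y hy using hwu (subset_closure hy)
    simp only [hx'.fderiv_eq, hx'.eq_of_nhds]
  · refine setLIntegral_congr_fun isClosed_frontier.measurableSet fun x hx => ?_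
    simp only [hwu (frontier_subset_closure hx)]

/-! ### Arc length compared with the parameter -/

section Arc

variable {Ω : Set ℂ} {c : ℝ → ℂ}

theorem IsPositiveParam.exists_lipschitzWith (hc : IsPositiveParam Ω c) :
    ∃ K : NNReal, LipschitzWith K c := by
  have hd : Continuous (deriv c) := hc.contDiff.continuous_deriv (by simp)
  have hp : Function.Periodic (deriv c) (2 * Real.pi) := by
    intro t
    have : (fun x => c (x + 2 * Real.pi)) = c := funext hc.periodic
    rw [← deriv_comp_add_const, this]
  obtain ⟨M, hM⟩ := isCompact_Icc.exists_bound_of_continuousOn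
    (s := Set.Icc (0 : ℝ) (0 + 2 * Real.pi)) hd.continuousOn
  refine ⟨M.toNNReal, lipschitzWith_of_nnnorm_deriv_le (hc.contDiff.differentiable (by simp)) ?_⟩
  intro t
  rw [← NNReal.coe_le_coe, coe_nnnorm]
  have : deriv c t ∈ deriv c '' Set.Icc (0 : ℝ) (0 + 2 * Real.pi) := by
    rw [hp.image_Icc Real.two_pi_pos]; exact ⟨t, rfl⟩
  obtain ⟨x, hx, h⟩ := this
  rw [← h]
  exact (hM x hx).trans (Real.le_coe_toNNReal M)

/-- A Lipschitz image increases one-dimensional Hausdorff measure by at most the Lipschitz constant.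
Only upper bounds are sought, so no area formula is needed. The interval may start anywhere, which
later allows centring it at a vortex. -/
theorem IsPositiveParam.exists_arcOn_le (hc : IsPositiveParam Ω c) :
    ∃ K : NNReal, ∀ a : ℝ, arcOn Ω ≤
      (K : ℝ≥0∞) • (volume.restrict (Set.Ioc a (a + 2 * Real.pi))).map c := by
  obtain ⟨K, hK⟩ := hc.exists_lipschitzWith
  refine ⟨K, fun a => Measure.le_iff.2 fun S hS => ?_⟩
  have hm : Measurable c := hK.continuous.measurable
  rw [Measure.smul_apply, Measure.map_apply hm hS, Measure.restrict_apply (hm hS), arcOn,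
    Measure.restrict_apply hS]
  have hsub : S ∩ frontier Ω ⊆ c '' (c ⁻¹' S ∩ Set.Ioc a (a + 2 * Real.pi)) := by
    rintro x ⟨hxS, hx⟩
    rw [← hc.range_eq, ← hc.periodic.image_Ioc Real.two_pi_pos a] at hx
    obtain ⟨t, ht, rfl⟩ := hx
    exact ⟨t, ⟨hxS, ht⟩, rfl⟩
  calc μH[1] (S ∩ frontier Ω) ≤ μH[1] (c '' (c ⁻¹' S ∩ Set.Ioc a (a + 2 * Real.pi))) :=
        measure_mono hsub
    _ ≤ (K : ℝ≥0∞) ^ (1 : ℝ) * μH[1] (c ⁻¹' S ∩ Set.Ioc a (a + 2 * Real.pi)) :=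
        hK.hausdorffMeasure_image_le zero_le_one _
    _ = _ := by rw [ENNReal.rpow_one, hausdorffMeasure_real, smul_eq_mul]

theorem IsPositiveParam.exists_lintegral_arcOn_le (hc : IsPositiveParam Ω c) :
    ∃ K : NNReal, ∀ (a : ℝ) (f : ℂ → ℝ≥0∞), Measurable f → ∫⁻ x, f x ∂(arcOn Ω) ≤
      K * ∫⁻ t in Set.Ioc a (a + 2 * Real.pi), f (c t) := by
  obtain ⟨K, hK⟩ := hc.exists_arcOn_le
  refine ⟨K, fun a f hf => (lintegral_mono' (hK a) le_rfl).trans_eq ?_⟩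
  rw [lintegral_smul_measure, lintegral_map hf hc.contDiff.continuous.measurable, smul_eq_mul]

theorem IsPositiveParam.isFiniteMeasure_arcOn (hc : IsPositiveParam Ω c) :
    IsFiniteMeasure (arcOn Ω) := by
  obtain ⟨K, hK⟩ := hc.exists_lintegral_arcOn_le
  refine ⟨?_⟩
  have := hK 0 1 measurable_const
  rw [Pi.one_def, lintegral_one, lintegral_one] at this
  refine this.trans_lt ?_
  rw [Measure.restrict_apply_univ, Real.volume_Ioc]
  exact ENNReal.mul_lt_top ENNReal.coe_lt_top ENNReal.ofReal_lt_top

/-- Allows the boundary condition to fail at the finitely many boundary vortices. -/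
instance : NullSingletonClass (arcOn Ω) := by
  have := Measure.nullSingletonClass_hausdorff ℂ (d := 1) one_pos
  unfold arcOn
  infer_instance

end Arc

/-! ### The difference quotient and functions of the boundary parameter -/

/-- Hadamard's lemma: the quotient is the mean of `c'` over the segment from `a` to `t`, and this
integral may be differentiated in `t`. It gives the direction of the chord from a boundary point as
a `C¹` function, including at the point itself. -/
theorem contDiff_one_dslope {E : Type*} [NormedAddCommGroup E] [NormedSpace ℝ E] [CompleteSpace E]
    {c : ℝ → E} (hc : ContDiff ℝ 2 c) (a : ℝ) : ContDiff ℝ 1 (dslope c a) := by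
  have hc1 : ContDiff ℝ 1 (deriv c) := ((contDiff_succ_iff_deriv (n := 1)).1 hc).2.2
  have hc2 : Continuous (deriv (deriv c)) := hc1.continuous_deriv (by simp)
  have hd : Differentiable ℝ c := hc.differentiable (by simp)
  have hd1 : Differentiable ℝ (deriv c) := hc1.differentiable (by simp)
  have key : dslope c a = fun t => ∫ s in (0 : ℝ)..1, deriv c (a + s * (t - a)) := by
    ext t
    rcases eq_or_ne t a with rfl | ht
    · simp [dslope_same]
    · have h1 := sub_smul_dslope c a t
      have h2 : ∫ s in (0 : ℝ)..1, (t - a) • deriv c (a + s * (t - a)) = c t - c a := by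
        rw [intervalIntegral.integral_eq_sub_of_hasDerivAt
          (f := fun s => c (a + s * (t - a)))]
        · simp
        · intro s _
          have := (hd (a + s * (t - a))).hasDerivAt.scomp s
            (((hasDerivAt_id s).mul_const (t - a)).const_add a)
          simpa using! this
        · apply Continuous.intervalIntegrable
          have := hc1.continuous
          fun_prop
      rw [intervalIntegral.integral_smul, ← h1] at h2
      exact (smul_right_injective E (sub_ne_zero.2 ht) h2).symm
  rw [key]
  have hder : ∀ t, HasDerivAt (fun t => ∫ s in (0 : ℝ)..1, deriv c (a + s * (t - a)))
      (∫ s in (0 : ℝ)..1, s • deriv (deriv c) (a + s * (t - a))) t := by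
    intro t
    have hF' : Continuous fun p : ℝ × ℝ => p.2 • deriv (deriv c) (a + p.2 * (p.1 - a)) := by
      fun_prop
    obtain ⟨M, hM⟩ := ((isCompact_closedBall t 1).prod (isCompact_Icc (a := (0 : ℝ)) (b := 1)))
      |>.exists_bound_of_continuousOn hF'.continuousOn
    refine (intervalIntegral.hasDerivAt_integral_of_dominated_loc_of_deriv_le
      (F' := fun t s => s • deriv (deriv c) (a + s * (t - a))) (bound := fun _ => M)
      (Metric.closedBall_mem_nhds t one_pos) ?_ ?_ ?_ ?_ ?_ ?_).2
    · have := hc1.continuous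
      exact Eventually.of_forall fun t => (Continuous.aestronglyMeasurable (by fun_prop))
    · have := hc1.continuous
      exact Continuous.intervalIntegrable (by fun_prop) _ _
    · exact Continuous.aestronglyMeasurable (by fun_prop)
    · refine Eventually.of_forall fun s hs x hx => hM (x, s) ⟨hx, ?_⟩
      rw [Set.uIoc_of_le zero_le_one] at hs
      exact Set.Ioc_subset_Icc_self hs
    · simp
    · refine Eventually.of_forall fun s _ x _ => ?_
      have := (hd1 (a + s * (x - a))).hasDerivAt.scomp x
        ((((hasDerivAt_id x).sub_const a).const_mul s).const_add a)
      simpa using! this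
  refine contDiff_one_iff_deriv.2 ⟨fun t => (hder t).differentiableAt, ?_⟩
  rw [show deriv (fun t => ∫ s in (0 : ℝ)..1, deriv c (a + s * (t - a))) = _ from
    funext fun t => (hder t).deriv]
  apply intervalIntegral.continuous_parametric_intervalIntegral_of_continuous'
  fun_prop

section Curve

variable {Ω : Set ℂ} {c : ℝ → ℂ}

theorem exists_add_int_mul_mem_Ico (a t : ℝ) :
    ∃ k : ℤ, t + k * (2 * Real.pi) ∈ Set.Ico a (a + 2 * Real.pi) := by
  obtain ⟨m, hm, -⟩ := existsUnique_add_zsmul_mem_Ico Real.two_pi_pos t a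
  exact ⟨m, by simpa using hm⟩

theorem IsPositiveParam.add_int_mul (hc : IsPositiveParam Ω c) (t : ℝ) (k : ℤ) :
    c (t + k * (2 * Real.pi)) = c t :=
  hc.periodic.int_mul k t

theorem IsPositiveParam.exists_eq_add_int_mul (hc : IsPositiveParam Ω c) {t t' : ℝ}
    (h : c t = c t') : ∃ k : ℤ, t' = t + k * (2 * Real.pi) := by
  obtain ⟨m, hm⟩ := exists_add_int_mul_mem_Ico 0 t
  obtain ⟨n, hn⟩ := exists_add_int_mul_mem_Ico 0 t'
  rw [zero_add] at hm hn
  have := hc.injOn hm hn (by rw [hc.add_int_mul, hc.add_int_mul, h])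
  refine ⟨m - n, ?_⟩
  push_cast
  linarith

theorem IsPositiveParam.eq_of_abs_sub_lt (hc : IsPositiveParam Ω c) {t t' : ℝ}
    (h : c t = c t') (ht : |t' - t| < 2 * Real.pi) : t' = t := by
  obtain ⟨k, rfl⟩ := hc.exists_eq_add_int_mul h
  have h2 : |(k : ℝ)| * (2 * Real.pi) < 1 * (2 * Real.pi) := by
    rwa [add_sub_cancel_left, abs_mul, abs_of_pos Real.two_pi_pos, ← one_mul (2 * Real.pi),
      ← mul_assoc, mul_one] at ht
  have h3 : |(k : ℝ)| < 1 := lt_of_mul_lt_mul_right h2 Real.two_pi_pos.le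
  have h4 : |k| < 1 := by exact_mod_cast h3
  rw [Int.abs_lt_one_iff.1 h4]
  simp

/-- The difference quotient at `a` is continuous. It vanishes nowhere within half a period: off `a`
by injectivity, at `a` by regularity. Compactness gives a positive minimum. -/
theorem IsPositiveParam.exists_chordArc (hc : IsPositiveParam Ω c) (a : ℝ) :
    ∃ k > 0, ∀ t ∈ Set.Icc (a - Real.pi) (a + Real.pi), k * |t - a| ≤ ‖c t - c a‖ := by
  have hm := contDiff_one_dslope hc.contDiff a
  obtain ⟨t₀, ht₀, hmin⟩ := (isCompact_Icc (a := a - Real.pi) (b := a + Real.pi)).exists_isMinOn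
    ⟨a, by constructor <;> linarith [Real.pi_pos]⟩ hm.continuous.norm.continuousOn
  refine ⟨‖dslope c a t₀‖, norm_pos_iff.2 fun h0 => ?_, fun t ht => ?_⟩
  · have h1 := sub_smul_dslope c a t₀
    rw [h0, smul_zero] at h1
    have h2 : t₀ = a := hc.eq_of_abs_sub_lt (sub_eq_zero.1 h1.symm).symm (by
      rw [abs_lt]; constructor <;> linarith [Real.pi_pos, ht₀.1, ht₀.2])
    rw [h2, dslope_same] at h0
    exact hc.deriv_ne_zero a h0
  · rw [← sub_smul_dslope, norm_smul, Real.norm_eq_abs, mul_comm]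
    exact mul_le_mul_of_nonneg_left (hmin ht) (abs_nonneg _)

/-- The part of the curve with parameters at least `η` away from `t₀`, within half a period, is
compact and misses `c t₀`. Hence boundary points near `c t₀` come only from parameters near `t₀`
modulo the period. -/
theorem IsPositiveParam.eventually_exists_abs_lt (hc : IsPositiveParam Ω c) (t₀ : ℝ) {η : ℝ}
    (hη : 0 < η) :
    ∀ᶠ y in 𝓝 (c t₀), ∀ t, c t = y → ∃ k : ℤ, |t + k * (2 * Real.pi) - t₀| < η := by
  have hK : IsCompact (c '' (Set.Icc (t₀ - Real.pi) (t₀ + Real.pi) \ Metric.ball t₀ η)) :=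
    (isCompact_Icc.diff Metric.isOpen_ball).image hc.contDiff.continuous
  have hn : c t₀ ∉ c '' (Set.Icc (t₀ - Real.pi) (t₀ + Real.pi) \ Metric.ball t₀ η) := by
    rintro ⟨t, ⟨ht, htη⟩, h⟩
    refine htη ?_
    rw [hc.eq_of_abs_sub_lt h.symm]
    · exact Metric.mem_ball_self hη
    · rw [abs_lt]; constructor <;> linarith [Real.pi_pos, ht.1, ht.2]
  filter_upwards [hK.isClosed.isOpen_compl.mem_nhds hn] with y hy t hty
  obtain ⟨k, hk⟩ := exists_add_int_mul_mem_Ico (t₀ - Real.pi) t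
  refine ⟨k, ?_⟩
  by_contra hcon
  refine hy ⟨_, ⟨⟨hk.1, by linarith [hk.2]⟩, ?_⟩, (hc.add_int_mul t k).trans hty⟩
  rwa [Metric.mem_ball, Real.dist_eq]

/-- A periodic `C¹` function of the parameter is the restriction of a `C¹` function of the plane. -/
theorem IsPositiveParam.exists_contDiff_comp_eq (hc : IsPositiveParam Ω c) {f : ℝ → ℝ}
    (hf : ContDiff ℝ 1 f) (hp : Function.Periodic f (2 * Real.pi)) :
    ∃ H : ℂ → ℝ, ContDiff ℝ 1 H ∧ ∀ t, H (c t) = f t := by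
  obtain ⟨H, hH, h⟩ := exists_contDiff_forall_mem_convex
    (t := fun x => {y : ℝ | ∀ t, c t = x → y = f t}) (fun x => by
      intro y hy z hz a b ha hb hab t ht
      rw [hy t ht, hz t ht, ← add_smul, hab, one_smul]) (fun x => by
      by_cases hx : x ∈ frontier Ω
      · rw [← hc.range_eq] at hx
        obtain ⟨t₀, rfl⟩ := hx
        -- Projection to the tangent line at `c t₀`. Its composition with `c` has derivative `1` at
        -- `t₀`, so it has a local inverse `σ`, and `f ∘ σ ∘ L` is a local extension of `f`. The
        -- local extensions are then glued.
        set L : ℂ → ℝ := fun x => (x / deriv c t₀).re with hL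
        have hLs : ContDiff ℝ 2 L := by
          have : L = fun x => Complex.reCLM (x * (deriv c t₀)⁻¹) := by
            ext; simp [hL, div_eq_mul_inv]
          rw [this]
          fun_prop
        set τ : ℝ → ℝ := fun t => L (c t) with hτ
        have hτs : ContDiff ℝ 2 τ := hLs.comp hc.contDiff
        have hτd : HasDerivAt τ 1 t₀ := by
          have h1 := ((hc.contDiff.differentiable (by simp) t₀).hasDerivAt).div_const (deriv c t₀)
          rw [div_self (hc.deriv_ne_zero t₀)] at h1
          exact (Complex.reCLM.hasFDerivAt.comp_hasDerivAt t₀ h1)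
        have hτd' : HasFDerivAt τ
            ((ContinuousLinearEquiv.unitsEquivAut ℝ (Units.mk0 (1 : ℝ) one_ne_zero) : ℝ ≃L[ℝ] ℝ) :
              ℝ →L[ℝ] ℝ) t₀ := by
          convert! hτd.hasFDerivAt using 1
        have h2 : (2 : ℕ∞ω) ≠ 0 := by simp
        have hs := hτs.contDiffAt.to_localInverse (a := t₀) hτd' h2
        set σ := hτs.contDiffAt.localInverse hτd' h2 with hσ
        have hleft : ∀ᶠ t in 𝓝 t₀, σ (τ t) = t :=
          (hτs.contDiffAt.hasStrictFDerivAt' hτd' h2).eventually_left_inverse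
        obtain ⟨η, hη, hball⟩ := Metric.eventually_nhds_iff.1 hleft
        refine ⟨fun x => f (σ (L x)), ?_, ?_⟩
        · have h3 : ContDiffAt ℝ 1 σ (L (c t₀)) := hs.of_le (by norm_num)
          exact hf.contDiffAt.comp _ (h3.comp _ (hLs.of_le (by norm_num)).contDiffAt)
        · filter_upwards [hc.eventually_exists_abs_lt t₀ hη] with y hy t ht
          obtain ⟨k, hk⟩ := hy t ht
          have h4 := hball hk
          simp only [hτ, hc.add_int_mul, ht] at h4
          rw [h4]
          exact hp.int_mul k t
      · refine ⟨fun _ => 0, contDiffAt_const, ?_⟩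
        filter_upwards [isClosed_frontier.isOpen_compl.mem_nhds hx] with y hy t ht
        exact absurd (by rw [← hc.range_eq, ← ht]; exact ⟨t, rfl⟩) hy)
  exact ⟨H, hH, fun t => h (c t) t rfl⟩

end Curve

/-- By continuity `φ` stays within `π` of `φ t₀` near `t₀`, so there it equals `φ t₀` plus the
imaginary part of the principal logarithm of `γ / γ t₀`. -/
theorem contDiff_one_of_exp_mul_I {γ : ℝ → ℂ} (hγ : ContDiff ℝ 1 γ) {φ : ℝ → ℝ}
    (hφ : Continuous φ) (h : ∀ t, γ t = Complex.exp ((φ t : ℂ) * Complex.I)) :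
    ContDiff ℝ 1 φ := by
  rw [contDiff_iff_contDiffAt]
  intro t₀
  have hne : γ t₀ ≠ 0 := by rw [h]; exact Complex.exp_ne_zero _
  have h1 : ContDiffAt ℝ 1 (fun t => (Complex.log (γ t / γ t₀)).im + φ t₀) t₀ := by
    have h2 : ContDiffAt ℝ 1 (fun t => γ t / γ t₀) t₀ := hγ.contDiffAt.div_const _
    have h3 : ContDiffAt ℝ 1 (fun t => Complex.log (γ t / γ t₀)) t₀ :=
      ((Complex.contDiffAt_log (by rw [div_self hne]; exact Complex.one_mem_slitPlane)).restrict_scalars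
        ℝ).comp t₀ h2
    exact (Complex.imCLM.contDiff.contDiffAt.comp t₀ h3).add contDiffAt_const
  refine h1.congr_of_eventuallyEq ?_
  have h4 : ∀ᶠ t in 𝓝 t₀, |φ t - φ t₀| < Real.pi := by
    have : Tendsto (fun t => |φ t - φ t₀|) (𝓝 t₀) (𝓝 |φ t₀ - φ t₀|) :=
      ((hφ.sub continuous_const).abs).continuousAt
    rw [sub_self, abs_zero] at this
    exact this.eventually_lt_const Real.pi_pos
  filter_upwards [h4] with t ht
  rw [abs_lt] at ht
  have : γ t / γ t₀ = Complex.exp (((φ t - φ t₀ : ℝ) : ℂ) * Complex.I) := by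
    rw [h, h, ← Complex.exp_sub]; congr 1; push_cast; ring
  rw [this, Complex.log_im, Complex.arg_exp_mul_I, (toIocMod_eq_self _).2]
  · ring
  · constructor <;> linarith

/-! ### Explicit planar integrals -/

theorem lintegral_comp_norm {f : ℝ → ℝ≥0∞} (hf : Measurable f) :
    ∫⁻ z : ℂ, f ‖z‖ = ENNReal.ofReal (2 * Real.pi) *
      ∫⁻ r in Set.Ioi (0 : ℝ), ENNReal.ofReal r * f r := by
  rw [← Complex.lintegral_comp_polarCoord_symm, polarCoord_target,
    Measure.volume_eq_prod, ← Measure.prod_restrict]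
  have h1 : ∀ p : ℝ × ℝ, p ∈ Set.Ioi (0 : ℝ) ×ˢ Set.Ioo (-Real.pi) Real.pi →
      ENNReal.ofReal p.1 • f ‖Complex.polarCoord.symm p‖ = ENNReal.ofReal p.1 * f p.1 := by
    intro p hp
    rw [Complex.norm_polarCoord_symm, abs_of_pos hp.1, smul_eq_mul]
  rw [Measure.prod_restrict, setLIntegral_congr_fun (measurableSet_Ioi.prod measurableSet_Ioo) h1,
    ← Measure.prod_restrict, lintegral_prod _ (by fun_prop)]
  simp only [lintegral_const, Measure.restrict_apply_univ, Real.volume_Ioo]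
  rw [lintegral_mul_const _ (by fun_prop), mul_comm]
  congr 2
  ring

theorem lintegral_ball_radial {F G : ℝ → ℝ} {M : ℝ} (hM : 0 < M) (hF : Measurable F)
    (h0 : ∀ r ∈ Set.Ioo 0 M, 0 ≤ F r) (hG : ContinuousOn G (Set.Icc 0 M))
    (hd : ∀ r ∈ Set.Ioo 0 M, HasDerivAt G (r * F r) r) (q : ℂ) :
    ∫⁻ z in Metric.ball q M, ENNReal.ofReal (F ‖z - q‖)
      = ENNReal.ofReal (2 * Real.pi * (G M - G 0)) := by
  have hnn : ∀ r ∈ Set.Ioo 0 M, 0 ≤ r * F r := fun r hr => mul_nonneg hr.1.le (h0 r hr)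
  have h1 : ∫⁻ z in Metric.ball q M, ENNReal.ofReal (F ‖z - q‖) =
      ∫⁻ z : ℂ, (Set.Iio M).indicator (fun r => ENNReal.ofReal (F r)) ‖z - q‖ := by
    rw [← lintegral_indicator Metric.isOpen_ball.measurableSet]
    refine lintegral_congr fun z => ?_
    simp only [Set.indicator, Metric.mem_ball, dist_eq_norm, Set.mem_Iio]
  have hm : Measurable ((Set.Iio M).indicator (fun r => ENNReal.ofReal (F r))) :=
    Measurable.indicator (by fun_prop) measurableSet_Iio
  rw [h1, lintegral_sub_right_eq_self
    (fun z : ℂ => (Set.Iio M).indicator (fun r => ENNReal.ofReal (F r)) ‖z‖),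
    lintegral_comp_norm hm, ENNReal.ofReal_mul (p := 2 * Real.pi) (by positivity)]
  congr 1
  have hint : IntegrableOn (fun r => r * F r) (Set.Ioo 0 M) := by
    have := intervalIntegral.integrableOn_deriv_of_nonneg (g := G) (g' := fun r => r * F r) hG
      (fun x hx => hd x hx) (fun x hx => hnn x hx)
    exact this.mono_set Set.Ioo_subset_Ioc_self
  have h2 : ∫ r in Set.Ioo 0 M, r * F r = G M - G 0 := by
    rw [← integral_Ioc_eq_integral_Ioo, ← intervalIntegral.integral_of_le hM.le]
    refine intervalIntegral.integral_eq_sub_of_hasDerivAt_of_le hM.le hG hd ?_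
    rw [intervalIntegrable_iff_integrableOn_Ioo_of_le hM.le]
    exact hint
  rw [← h2, ofReal_integral_eq_lintegral_ofReal hint
    ((ae_restrict_iff' measurableSet_Ioo).2 (Eventually.of_forall hnn))]
  rw [← lintegral_indicator measurableSet_Ioi, ← lintegral_indicator measurableSet_Ioo]
  refine lintegral_congr fun r => ?_
  by_cases hr : r ∈ Set.Ioi (0 : ℝ)
  · by_cases hr2 : r < M
    · have hr1 : 0 < r := hr
      simp [Set.indicator, hr2, hr1, ENNReal.ofReal_mul hr1.le]
    · simp [Set.indicator, hr2]
  · simp [Set.indicator, show ¬ (0 < r) from hr]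

theorem lintegral_ball_inv_sq_add_sq {M ε : ℝ} (hM : 0 < M) (hε : 0 < ε) (q : ℂ) :
    ∫⁻ z in Metric.ball q M, ENNReal.ofReal (1 / (‖z - q‖ ^ 2 + ε ^ 2))
      = ENNReal.ofReal (Real.pi * Real.log (M ^ 2 + ε ^ 2) - 2 * Real.pi * Real.log ε) := by
  have hpos : ∀ r : ℝ, 0 < r ^ 2 + ε ^ 2 := fun r => by positivity
  have hd : ∀ r, HasDerivAt (fun r => Real.log (r ^ 2 + ε ^ 2) / 2)
      (r * (1 / (r ^ 2 + ε ^ 2))) r := by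
    intro r
    have := (((hasDerivAt_pow 2 r).add_const (ε ^ 2)).log (hpos r).ne').div_const 2
    convert! this using 1
    have := (hpos r).ne'
    field_simp
    norm_num [mul_comm]
  rw [lintegral_ball_radial (F := fun r => 1 / (r ^ 2 + ε ^ 2)) hM (by fun_prop)
    (fun r _ => (one_div_pos.2 (hpos r)).le)
    (fun r _ => (hd r).continuousAt.continuousWithinAt) (fun r _ => hd r)]
  congr 1
  rw [zero_pow two_ne_zero, zero_add, Real.log_pow]
  push_cast
  ring

/-- The integrand serves twice: as the radial part of the squared gradient and as the potential
density of a vortex with core of size `ε`. -/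
theorem lintegral_ball_core_le {M ε : ℝ} (hM : 0 < M) (hε : 0 < ε) (q : ℂ) :
    ∫⁻ z in Metric.ball q M, ENNReal.ofReal (ε ^ 2 / (‖z - q‖ ^ 2 + ε ^ 2) ^ 2)
      ≤ ENNReal.ofReal Real.pi := by
  have hpos : ∀ r : ℝ, 0 < r ^ 2 + ε ^ 2 := fun r => by positivity
  have hd : ∀ r, HasDerivAt (fun r => -(ε ^ 2 / 2) * (r ^ 2 + ε ^ 2)⁻¹)
      (r * (ε ^ 2 / (r ^ 2 + ε ^ 2) ^ 2)) r := by
    intro r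
    have := ((((hasDerivAt_pow 2 r).add_const (ε ^ 2)).inv (hpos r).ne')).const_mul (-(ε ^ 2 / 2))
    convert! this using 1
    have := (hpos r).ne'
    field_simp
    norm_num [mul_comm]
  rw [lintegral_ball_radial (F := fun r => ε ^ 2 / (r ^ 2 + ε ^ 2) ^ 2) hM (by fun_prop)
    (fun r _ => by positivity)
    (fun r _ => (hd r).continuousAt.continuousWithinAt) (fun r _ => hd r)]
  refine ENNReal.ofReal_le_ofReal ?_
  have h1 : -(ε ^ 2 / 2) * (0 ^ 2 + ε ^ 2)⁻¹ = -(1 / 2) := by field_simp; ring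
  have h2 : 0 ≤ (ε ^ 2 / 2) * (M ^ 2 + ε ^ 2)⁻¹ := by positivity
  rw [h1]
  nlinarith [Real.pi_pos]

theorem lintegral_ball_inv_norm {M : ℝ} (hM : 0 < M) (q : ℂ) :
    ∫⁻ z in Metric.ball q M, ENNReal.ofReal (1 / ‖z - q‖) = ENNReal.ofReal (2 * Real.pi * M) := by
  rw [lintegral_ball_radial (F := fun r => 1 / r) (G := id) hM (by fun_prop)
    (fun r hr => (one_div_pos.2 hr.1).le) continuousOn_id
    (fun r hr => by simpa [hr.1.ne'] using hasDerivAt_id r)]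
  simp

/-- The reflection `z ↦ -z` exchanges the two halves of the disc and preserves radial functions.
This is why a boundary vortex costs half of an interior one. -/
theorem lintegral_half_ball_le (f : ℝ → ℝ≥0∞) (M : ℝ) :
    2 * ∫⁻ z in Metric.ball (0 : ℂ) M ∩ {z | 0 < z.re}, f ‖z‖ ≤
      ∫⁻ z in Metric.ball (0 : ℂ) M, f ‖z‖ := by
  have hms : MeasurableSet {z : ℂ | 0 < z.re} := measurableSet_lt measurable_const (by fun_prop)
  have hms' : MeasurableSet {z : ℂ | z.re < 0} := measurableSet_lt (by fun_prop) measurable_const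
  have hb : MeasurableSet (Metric.ball (0 : ℂ) M) := Metric.isOpen_ball.measurableSet
  have h1 : ∫⁻ z in Metric.ball (0 : ℂ) M ∩ {z | z.re < 0}, f ‖z‖ =
      ∫⁻ z in Metric.ball (0 : ℂ) M ∩ {z | 0 < z.re}, f ‖z‖ := by
    rw [← lintegral_indicator (hb.inter hms), ← lintegral_indicator (hb.inter hms'),
      ← lintegral_neg_eq_self]
    refine lintegral_congr fun z => ?_
    simp [Set.indicator]
  have hd : Disjoint (Metric.ball (0 : ℂ) M ∩ {z | z.re < 0})
      (Metric.ball (0 : ℂ) M ∩ {z | 0 < z.re}) := by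
    rw [Set.disjoint_left]
    rintro z ⟨-, h⟩ ⟨-, h'⟩
    exact lt_asymm (show z.re < 0 from h) (show 0 < z.re from h')
  rw [two_mul]
  nth_rewrite 1 [← h1]
  rw [← lintegral_union (hb.inter hms) hd]
  exact lintegral_mono_set (by rintro z (h | h) <;> exact h.1)

theorem isClosed_and_le {X : Type*} [TopologicalSpace X] {f₁ f₂ f₃ f₄ : X → ℝ}
    (h₁ : Continuous f₁) (h₂ : Continuous f₂) (h₃ : Continuous f₃) (h₄ : Continuous f₄) :
    IsClosed {x | f₁ x ≤ f₂ x ∧ f₃ x ≤ f₄ x} :=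
  (isClosed_le h₁ h₂).and (isClosed_le h₃ h₄)

/-- At height `y` the region has width `2 K y²`, which cancels the singularity `1 / y²` exactly. It
bounds the error made by replacing the domain by its tangent half-plane. -/
theorem lintegral_cusp_le {K R : ℝ} (hK : 0 ≤ K) :
    ∫⁻ z in {z : ℂ | |z.re| ≤ K * z.im ^ 2 ∧ |z.im| ≤ R}, ENNReal.ofReal (1 / z.im ^ 2) ≤
      ENNReal.ofReal (4 * K * R) := by
  have hms : MeasurableSet {z : ℂ | |z.re| ≤ K * z.im ^ 2 ∧ |z.im| ≤ R} :=
    IsClosed.measurableSet (isClosed_and_le (by fun_prop) (by fun_prop) (by fun_prop) (by fun_prop))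
  have hms2 : MeasurableSet {p : ℝ × ℝ | |p.1| ≤ K * p.2 ^ 2 ∧ |p.2| ≤ R} :=
    IsClosed.measurableSet (isClosed_and_le (by fun_prop) (by fun_prop) (by fun_prop) (by fun_prop))
  have h1 : ∫⁻ z in {z : ℂ | |z.re| ≤ K * z.im ^ 2 ∧ |z.im| ≤ R}, ENNReal.ofReal (1 / z.im ^ 2) =
      ∫⁻ p : ℝ × ℝ, {p : ℝ × ℝ | |p.1| ≤ K * p.2 ^ 2 ∧ |p.2| ≤ R}.indicator
        (fun p => ENNReal.ofReal (1 / p.2 ^ 2)) p := by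
    rw [← lintegral_indicator hms,
      ← Complex.volume_preserving_equiv_real_prod.lintegral_comp
        (Measurable.indicator (by fun_prop) hms2)]
    refine lintegral_congr fun z => ?_
    simp [Set.indicator, Complex.measurableEquivRealProd_apply]
  rw [h1, Measure.volume_eq_prod, lintegral_prod_symm _
    (Measurable.indicator (by fun_prop) hms2).aemeasurable]
  have h2 : ∀ y : ℝ, ∫⁻ x : ℝ, {p : ℝ × ℝ | |p.1| ≤ K * p.2 ^ 2 ∧ |p.2| ≤ R}.indicator
        (fun p => ENNReal.ofReal (1 / p.2 ^ 2)) (x, y) ≤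
      (Set.Icc (-R) R).indicator (fun _ => ENNReal.ofReal (2 * K)) y := by
    intro y
    by_cases hy : |y| ≤ R
    · have hy' : y ∈ Set.Icc (-R) R := abs_le.1 hy
      have h3 : ∀ x : ℝ, {p : ℝ × ℝ | |p.1| ≤ K * p.2 ^ 2 ∧ |p.2| ≤ R}.indicator
          (fun p => ENNReal.ofReal (1 / p.2 ^ 2)) (x, y) =
          (Set.Icc (-(K * y ^ 2)) (K * y ^ 2)).indicator
            (fun _ => ENNReal.ofReal (1 / y ^ 2)) x := by
        intro x
        by_cases hx : |x| ≤ K * y ^ 2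
        · rw [Set.indicator_of_mem (show (x, y) ∈ {p : ℝ × ℝ | |p.1| ≤ K * p.2 ^ 2 ∧ |p.2| ≤ R} from
            ⟨hx, hy⟩), Set.indicator_of_mem (Set.mem_Icc.2 (abs_le.1 hx))]
        · rw [Set.indicator_of_notMem (fun h => hx h.1),
            Set.indicator_of_notMem (fun h => hx (abs_le.2 (Set.mem_Icc.1 h)))]
      simp_rw [h3]
      rw [lintegral_indicator_const measurableSet_Icc, Real.volume_Icc,
        Set.indicator_of_mem hy', ← ENNReal.ofReal_mul (by positivity)]
      refine ENNReal.ofReal_le_ofReal ?_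
      rcases eq_or_ne y 0 with rfl | h
      · simp; positivity
      · field_simp
        linarith
    · have : ∀ x : ℝ, {p : ℝ × ℝ | |p.1| ≤ K * p.2 ^ 2 ∧ |p.2| ≤ R}.indicator
          (fun p => ENNReal.ofReal (1 / p.2 ^ 2)) (x, y) = 0 := by
        intro x
        exact Set.indicator_of_notMem (fun h => hy h.2) _
      rw [lintegral_congr this, lintegral_zero]
      exact zero_le
  refine (lintegral_mono h2).trans_eq ?_
  rw [lintegral_indicator_const measurableSet_Icc, Real.volume_Icc,
    ← ENNReal.ofReal_mul (by positivity)]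
  congr 1
  ring

theorem norm_add_ofReal_sq (z : ℂ) (δ : ℝ) :
    ‖z + δ‖ ^ 2 = ‖z‖ ^ 2 + 2 * δ * z.re + δ ^ 2 := by
  simp only [Complex.sq_norm, Complex.normSq_apply, Complex.add_re, Complex.ofReal_re,
    Complex.add_im, Complex.ofReal_im]
  ring

/-- The Dirichlet energy of the argument about a point at distance `δ` outside of a domain which is
a half-disc up to a quadratic error. -/
theorem lintegral_half_disc_le {K R δ : ℝ} (hK : 0 ≤ K) (hR : 0 < R) (hKR : K * R ≤ 1 / 8)
    (hδ : 0 < δ) (hδ1 : δ ≤ 1) :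
    ∫⁻ z in {z : ℂ | ‖z‖ < R ∧ -(K * ‖z‖ ^ 2) ≤ z.re}, ENNReal.ofReal (1 / ‖z + δ‖ ^ 2) ≤
      ENNReal.ofReal (Real.pi * |Real.log δ| + (Real.pi / 2 * Real.log (R ^ 2 + 1) + 8 * K * R)) := by
  set f : ℂ → ℝ≥0∞ := fun z => ENNReal.ofReal (1 / ‖z + δ‖ ^ 2)
  set A := Metric.ball (0 : ℂ) R ∩ {z | 0 < z.re} with hA
  set T := {z : ℂ | |z.re| ≤ (2 * K) * z.im ^ 2 ∧ |z.im| ≤ R} with hT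
  have hms : MeasurableSet A :=
    Metric.isOpen_ball.measurableSet.inter (measurableSet_lt measurable_const (by fun_prop))
  have hmT : MeasurableSet T :=
    IsClosed.measurableSet (isClosed_and_le (by fun_prop) (by fun_prop) (by fun_prop) (by fun_prop))
  have hTe : ∀ᵐ z : ℂ, z ≠ 0 := by
    simp [ae_iff]
  have hsub : {z : ℂ | ‖z‖ < R ∧ -(K * ‖z‖ ^ 2) ≤ z.re} ⊆ A ∪ T := by
    rintro z ⟨h1, h2⟩
    by_cases hre : 0 < z.re
    · exact Or.inl ⟨by simpa using h1, hre⟩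
    · right
      push Not at hre
      refine ⟨?_, (Complex.abs_im_le_norm z).trans h1.le⟩
      have h3 : |z.re| < R := (Complex.abs_re_le_norm z).trans_lt h1
      rw [abs_of_nonpos hre] at h3 ⊢
      rw [Complex.sq_norm, Complex.normSq_apply] at h2
      -- With `r = -Re z`, the parabola gives `r ≤ K r² + K (Im z)²`. Since `K r² ≤ K R r ≤ r / 8`,
      -- this term is absorbed on the left, and `r ≤ 2 K (Im z)²`.
      nlinarith [mul_nonneg hK (mul_nonneg (neg_nonneg.2 hre) (sub_nonneg.2 h3.le)),
        mul_nonneg (neg_nonneg.2 hre) (sub_nonneg.2 hKR), mul_nonneg hK (sq_nonneg z.im)]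
  have hTi : ∫⁻ z in T, f z ≤ ENNReal.ofReal (8 * K * R) := by
    calc ∫⁻ z in T, f z ≤ ∫⁻ z in T, ENNReal.ofReal (1 / z.im ^ 2) := by
          refine lintegral_mono_ae ?_
          filter_upwards [ae_restrict_of_ae hTe, ae_restrict_mem hmT] with z hz hzT
          refine ENNReal.ofReal_le_ofReal ?_
          have him : z.im ≠ 0 := by
            intro h
            apply hz
            have := hzT.1
            rw [h] at this
            apply Complex.ext
            · simpa using this
            · exact h
          have : z.im ^ 2 ≤ ‖z + δ‖ ^ 2 := by
            rw [Complex.sq_norm, Complex.normSq_apply]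
            simp
            nlinarith [mul_self_nonneg (z.re + δ)]
          exact one_div_le_one_div_of_le (by positivity) this
      _ ≤ ENNReal.ofReal (4 * (2 * K) * R) := lintegral_cusp_le (by positivity)
      _ = _ := by ring_nf
  have hAi : ∫⁻ z in A, f z ≤
      ENNReal.ofReal (Real.pi * |Real.log δ| + Real.pi / 2 * Real.log (R ^ 2 + 1)) := by
    -- On the right half-disc the cross term `2 δ Re z` is positive, so `|z + δ|² ≥ |z|² + δ²`. The
    -- bound becomes radial and is half of the integral over the disc.
    have h1 : ∫⁻ z in A, f z ≤ ∫⁻ z in A, ENNReal.ofReal (1 / (‖z‖ ^ 2 + δ ^ 2)) := by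
      refine setLIntegral_mono (by fun_prop) fun z hz => ENNReal.ofReal_le_ofReal ?_
      refine one_div_le_one_div_of_le (by positivity) ?_
      rw [norm_add_ofReal_sq]
      nlinarith [mul_pos hδ (show 0 < z.re from hz.2)]
    refine h1.trans ?_
    have h2 := lintegral_half_ball_le (fun r => ENNReal.ofReal (1 / (r ^ 2 + δ ^ 2))) R
    have h3 := lintegral_ball_inv_sq_add_sq hR hδ 0
    simp only [sub_zero] at h3
    rw [h3] at h2
    have h4 : ENNReal.ofReal (Real.pi * Real.log (R ^ 2 + δ ^ 2) - 2 * Real.pi * Real.log δ) ≤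
        2 * ENNReal.ofReal (Real.pi * |Real.log δ| + Real.pi / 2 * Real.log (R ^ 2 + 1)) := by
      rw [← ENNReal.ofReal_ofNat 2, ← ENNReal.ofReal_mul (by norm_num)]
      refine ENNReal.ofReal_le_ofReal ?_
      rw [abs_of_nonpos (Real.log_nonpos hδ.le hδ1)]
      have : Real.log (R ^ 2 + δ ^ 2) ≤ Real.log (R ^ 2 + 1) :=
        Real.log_le_log (by positivity) (by nlinarith)
      nlinarith [Real.pi_pos, mul_le_mul_of_nonneg_left this Real.pi_pos.le]
    exact (ENNReal.mul_le_mul_iff_right two_ne_zero ENNReal.ofNat_ne_top).1 (h2.trans h4)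
  calc _ ≤ ∫⁻ z in A ∪ T, f z := lintegral_mono_set hsub
    _ ≤ (∫⁻ z in A, f z) + ∫⁻ z in T, f z := lintegral_union_le _ _ _
    _ ≤ ENNReal.ofReal (Real.pi * |Real.log δ| + Real.pi / 2 * Real.log (R ^ 2 + 1)) +
        ENNReal.ofReal (8 * K * R) := add_le_add hAi hTi
    _ = _ := by
      have : 0 ≤ Real.log (R ^ 2 + 1) := Real.log_nonneg (by nlinarith)
      rw [← ENNReal.ofReal_add (by positivity) (by positivity), add_assoc]

theorem lintegral_lorentzian_le {k δ : ℝ} (hk : 0 < k) (hδ : 0 < δ) (a : ℝ) (S : Set ℝ) :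
    ∫⁻ t in S, ENNReal.ofReal (δ ^ 2 / ((k * |t - a|) ^ 2 + δ ^ 2)) ≤
      ENNReal.ofReal (Real.pi / k * δ) := by
  refine (setLIntegral_le_lintegral _ _).trans_eq ?_
  have h1 : ∀ t : ℝ, δ ^ 2 / ((k * |t - a|) ^ 2 + δ ^ 2) = (1 + (k / δ * (t - a)) ^ 2)⁻¹ := by
    intro t
    rw [mul_pow k, sq_abs]
    field_simp
    ring
  simp_rw [h1]
  rw [lintegral_sub_right_eq_self (fun t : ℝ => ENNReal.ofReal (1 + (k / δ * t) ^ 2)⁻¹),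
    ← ofReal_integral_eq_lintegral_ofReal]
  · rw [Measure.integral_comp_mul_left (fun x : ℝ => (1 + x ^ 2)⁻¹), integral_univ_inv_one_add_sq]
    congr 1
    rw [abs_of_pos (by positivity), inv_div, smul_eq_mul]
    ring
  · exact (integrable_comp_mul_left_iff (fun x : ℝ => (1 + x ^ 2)⁻¹) (by positivity)).2
      integrable_inv_one_add_sq
  · exact Eventually.of_forall fun t => by positivity

/-! ### Products of vortices and the energy of the ansatz -/

section Products

variable {ι : Type*}

theorem norm_prod_le_one {s : Finset ι} {V : ι → ℂ} (h : ∀ j ∈ s, ‖V j‖ ≤ 1) :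
    ‖∏ j ∈ s, V j‖ ≤ 1 := by
  rw [norm_prod]
  exact Finset.prod_le_one (fun _ _ => norm_nonneg _) h

theorem norm_prod_sub_prod_le_sum {s : Finset ι} {V W : ι → ℂ} (hV : ∀ j ∈ s, ‖V j‖ ≤ 1)
    (hW : ∀ j ∈ s, ‖W j‖ ≤ 1) : ‖∏ j ∈ s, V j - ∏ j ∈ s, W j‖ ≤ ∑ j ∈ s, ‖V j - W j‖ := by
  classical
  induction s using Finset.induction_on with
  | empty => simp
  | insert a s ha ih =>
    rw [Finset.prod_insert ha, Finset.prod_insert ha, Finset.sum_insert ha]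
    have hV' : ∀ j ∈ s, ‖V j‖ ≤ 1 := fun j hj => hV j (Finset.mem_insert_of_mem hj)
    have hW' : ∀ j ∈ s, ‖W j‖ ≤ 1 := fun j hj => hW j (Finset.mem_insert_of_mem hj)
    have h1 : V a * ∏ j ∈ s, V j - W a * ∏ j ∈ s, W j =
        (V a - W a) * ∏ j ∈ s, V j + W a * (∏ j ∈ s, V j - ∏ j ∈ s, W j) := by ring
    rw [h1]
    refine (norm_add_le _ _).trans (add_le_add ?_ ?_)
    · rw [norm_mul]
      exact mul_le_of_le_one_right (norm_nonneg _) (norm_prod_le_one hV')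
    · rw [norm_mul]
      exact (mul_le_of_le_one_left (norm_nonneg _) (hW a (Finset.mem_insert_self _ _))).trans
        (ih hV' hW')

theorem one_sub_prod_le_sum {s : Finset ι} {a : ι → ℝ} (h0 : ∀ j ∈ s, 0 ≤ a j)
    (h1 : ∀ j ∈ s, a j ≤ 1) : 1 - ∏ j ∈ s, a j ≤ ∑ j ∈ s, (1 - a j) := by
  classical
  induction s using Finset.induction_on with
  | empty => simp
  | insert b s hb ih =>
    rw [Finset.prod_insert hb, Finset.sum_insert hb]
    have h0' : ∀ j ∈ s, 0 ≤ a j := fun j hj => h0 j (Finset.mem_insert_of_mem hj)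
    have h1' : ∀ j ∈ s, a j ≤ 1 := fun j hj => h1 j (Finset.mem_insert_of_mem hj)
    have h2 := ih h0' h1'
    have h3 : ∏ j ∈ s, a j ≤ 1 := Finset.prod_le_one h0' h1'
    nlinarith [h0 b (Finset.mem_insert_self _ _), h1 b (Finset.mem_insert_self _ _),
      Finset.prod_nonneg h0']

theorem differentiableAt_fun_prod {s : Finset ι} {V : ι → ℂ → ℂ} {x : ℂ}
    (hd : ∀ j ∈ s, DifferentiableAt ℝ (V j) x) :
    DifferentiableAt ℝ (fun y => ∏ j ∈ s, V j y) x := by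
  classical
  exact (HasFDerivAt.finsetProd fun i hi => (hd i hi).hasFDerivAt).differentiableAt

theorem norm_fderiv_prod_le {s : Finset ι} {V : ι → ℂ → ℂ} {x : ℂ}
    (hd : ∀ j ∈ s, DifferentiableAt ℝ (V j) x) (h1 : ∀ j ∈ s, ‖V j x‖ ≤ 1) (v : ℂ) :
    ‖fderiv ℝ (fun y => ∏ j ∈ s, V j y) x v‖ ≤ ∑ j ∈ s, ‖fderiv ℝ (V j) x v‖ := by
  classical
  induction s using Finset.induction_on with
  | empty => simp
  | insert a s ha ih =>
    have hd' : ∀ j ∈ s, DifferentiableAt ℝ (V j) x := fun j hj => hd j (Finset.mem_insert_of_mem hj)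
    have h1' : ∀ j ∈ s, ‖V j x‖ ≤ 1 := fun j hj => h1 j (Finset.mem_insert_of_mem hj)
    simp only [Finset.prod_insert ha, Finset.sum_insert ha]
    rw [fderiv_fun_mul (hd a (Finset.mem_insert_self _ _)) (differentiableAt_fun_prod hd')]
    simp only [_root_.add_apply, _root_.smul_apply, smul_eq_mul]
    rw [add_comm]
    refine (norm_add_le _ _).trans (add_le_add ?_ ?_)
    · rw [norm_mul]
      exact mul_le_of_le_one_left (norm_nonneg _) (norm_prod_le_one h1')
    · rw [norm_mul]
      exact (mul_le_of_le_one_left (norm_nonneg _) (h1 a (Finset.mem_insert_self _ _))).trans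
        (ih hd' h1')

end Products

/-- Both terms of the density vanish at `u₀` and their roots are Lipschitz on the unit disc: `|‖u‖²
- 1| ≤ 2 ‖u - u₀‖` and `|(u - u₀, g)| ≤ ‖u - u₀‖`, whence `4/2 + 1 = 3`. -/
theorem anchoring_le {α : ℝ} {u u₀ g : ℂ} (hu : ‖u‖ ≤ 1) (hu₀ : ‖u₀‖ = 1) (hg : ‖g‖ = 1)
    (h : (u₀ * (starRingEnd ℂ) g).re = Real.cos α) : anchoring α u g ≤ 3 * ‖u - u₀‖ ^ 2 := by
  have h1 : |‖u‖ - 1| ≤ ‖u - u₀‖ := by rw [← hu₀]; exact abs_norm_sub_norm_le _ _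
  have h2 : |(u * (starRingEnd ℂ) g).re - Real.cos α| ≤ ‖u - u₀‖ := by
    rw [← h, ← Complex.sub_re, ← sub_mul]
    refine (Complex.abs_re_le_norm _).trans ?_
    rw [norm_mul, RCLike.norm_conj, hg, mul_one]
  have h3 := sq_le_sq' (neg_le_of_abs_le h2) (le_of_abs_le h2)
  have h4 := sq_le_sq' (neg_le_of_abs_le h1) (le_of_abs_le h1)
  have h5 : (‖u‖ ^ 2 - 1) ^ 2 ≤ 4 * (‖u‖ - 1) ^ 2 := by
    have : (‖u‖ ^ 2 - 1) ^ 2 = (‖u‖ + 1) ^ 2 * (‖u‖ - 1) ^ 2 := by ring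
    rw [this]
    refine mul_le_mul_of_nonneg_right ?_ (sq_nonneg _)
    nlinarith [norm_nonneg u]
  unfold anchoring
  linarith

/-- A regularized vortex centred at `q`: `V` approximates the unimodular function `V₀` on the
boundary, has Dirichlet energy `E`, and all other contributions to the energy are bounded
by `M`. -/
structure VortexFactor (Ω : Set ℂ) (q : ℂ) (M E s ε : ℝ) (V V₀ : ℂ → ℂ) : Prop where
  contDiffAt : ∀ x ∈ closure Ω, ContDiffAt ℝ 1 V x
  norm_le : ∀ x ∈ closure Ω, ‖V x‖ ≤ 1
  norm_eq : ∀ x ∈ frontier Ω, ‖V₀ x‖ = 1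
  exists_gradient : ∃ b : ℂ → ℂ → ℝ, (∀ v, Measurable (b v)) ∧ (∀ v x, 0 ≤ b v x) ∧
    (∀ v, ‖v‖ = 1 → ∀ x ∈ Ω, x ≠ q →
      ‖fderiv ℝ V x v‖ ≤ b v x + M ∧ b v x ≤ M * (1 / ‖x - q‖)) ∧
    ∫⁻ x in Ω, ENNReal.ofReal (b 1 x ^ 2 + b Complex.I x ^ 2) ≤ ENNReal.ofReal E
  exists_potential : ∃ p : ℂ → ℝ, Measurable p ∧
    (∀ x ∈ Ω, (1 - ‖V x‖ ^ 2) ^ 2 / ε ^ 2 ≤ p x) ∧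
    ∫⁻ x in Ω, ENNReal.ofReal (p x) ≤ ENNReal.ofReal M
  exists_error : ∃ e : ℂ → ℝ, Measurable e ∧ (∀ x ∈ frontier Ω, ‖V x - V₀ x‖ ^ 2 ≤ e x) ∧
    ∫⁻ x, ENNReal.ofReal (e x) ∂(arcOn Ω) ≤ ENNReal.ofReal (M * ε ^ s)

/-- The triangle inequality `‖p - q‖ ≤ ‖x - p‖ + ‖x - q‖`, divided by the product of the three
distances, splits the doubly singular product into two integrable poles. -/
theorem mul_le_of_le_inv_dist {M : ℝ} {x p q : ℂ} (hpq : p ≠ q) (hp : x ≠ p) (hq : x ≠ q)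
    {a b : ℝ} (hb : 0 ≤ b) (ha' : a ≤ M * (1 / ‖x - p‖)) (hb' : b ≤ M * (1 / ‖x - q‖))
    (hM : 0 ≤ M) :
    a * b ≤ M ^ 2 * (1 / ‖p - q‖) * (1 / ‖x - p‖ + 1 / ‖x - q‖) := by
  have h1 : 0 < ‖x - p‖ := norm_pos_iff.2 (sub_ne_zero.2 hp)
  have h2 : 0 < ‖x - q‖ := norm_pos_iff.2 (sub_ne_zero.2 hq)
  have h3 : 0 < ‖p - q‖ := norm_pos_iff.2 (sub_ne_zero.2 hpq)
  have h4 : ‖p - q‖ ≤ ‖x - p‖ + ‖x - q‖ := by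
    rw [norm_sub_rev x p]
    simpa using norm_add_le (p - x) (x - q)
  calc a * b ≤ (M * (1 / ‖x - p‖)) * (M * (1 / ‖x - q‖)) :=
        mul_le_mul ha' hb' hb (by positivity)
    _ = M ^ 2 * (1 / ‖p - q‖) * (‖p - q‖ / (‖x - p‖ * ‖x - q‖)) := by field_simp
    _ ≤ M ^ 2 * (1 / ‖p - q‖) * ((‖x - p‖ + ‖x - q‖) / (‖x - p‖ * ‖x - q‖)) := by gcongr
    _ = _ := by field_simp; ring

/-- Only the diagonal terms `b j ^ 2` can carry a logarithm, and they keep coefficient one. Mixed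
products and the bounded remainder `M'` go into an integrable weight. -/
theorem sq_sum_add_le {ι : Type*} [Fintype ι] {q : ι → ℂ} (hq : Function.Injective q) {M : ℝ}
    (hM : 0 ≤ M) {M' : ℝ} (hM' : 0 ≤ M') {x : ℂ} (hx : ∀ j, x ≠ q j) {b : ι → ℝ}
    (hb : ∀ j, 0 ≤ b j) (hb' : ∀ j, b j ≤ M * (1 / ‖x - q j‖)) :
    (∑ j, b j + M') ^ 2 ≤ ∑ j, b j ^ 2 +
      (2 * M ^ 2 * (∑ i, ∑ j, 1 / ‖q i - q j‖) + 2 * M' * M + M' ^ 2) *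
        (1 + ∑ j, 1 / ‖x - q j‖) := by
  classical
  set ρ : ι → ℝ := fun j => 1 / ‖x - q j‖ with hρ
  -- On the diagonal this is `1 / 0 = 0`, so the double sum only involves pairs of distinct centres.
  set w : ι → ι → ℝ := fun i j => 1 / ‖q i - q j‖ with hw
  have hρ0 : ∀ j, 0 ≤ ρ j := fun j => by positivity
  have hw0 : ∀ i j, 0 ≤ w i j := fun i j => by positivity
  have hS : 0 ≤ ∑ j, ρ j := Finset.sum_nonneg fun j _ => hρ0 j
  have hW : 0 ≤ ∑ i, ∑ j, w i j := Finset.sum_nonneg fun i _ => Finset.sum_nonneg fun j _ => hw0 i j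
  have hle : ∀ j, ρ j ≤ ∑ j, ρ j := fun j =>
    Finset.single_le_sum (f := ρ) (fun j _ => hρ0 j) (Finset.mem_univ j)
  have h1 : (∑ j, b j) ^ 2 ≤ ∑ j, b j ^ 2 + 2 * M ^ 2 * (∑ i, ∑ j, w i j) * ∑ j, ρ j := by
    have h2 : ∀ i j, b i * b j ≤ (if i = j then b i ^ 2 else 0) +
        w i j * (2 * M ^ 2 * ∑ j, ρ j) := by
      intro i j
      split_ifs with hij
      · subst hij
        have := mul_nonneg (hw0 i i) (mul_nonneg (by positivity : 0 ≤ 2 * M ^ 2) hS)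
        nlinarith
      · have h3 := mul_le_of_le_inv_dist (fun h => hij (hq h)) (hx i) (hx j) (hb j) (hb' i)
          (hb' j) hM
        rw [zero_add]
        refine h3.trans ?_
        have h4 := mul_le_mul_of_nonneg_left (add_le_add (hle i) (hle j))
          (mul_nonneg (sq_nonneg M) (hw0 i j))
        simp only [hρ, hw] at h4 ⊢
        linarith
    rw [sq, Finset.sum_mul_sum]
    calc ∑ i, ∑ j, b i * b j ≤ ∑ i, ∑ j, ((if i = j then b i ^ 2 else 0) +
          w i j * (2 * M ^ 2 * ∑ j, ρ j)) :=
          Finset.sum_le_sum fun i _ => Finset.sum_le_sum fun j _ => h2 i j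
      _ = _ := by
        simp only [Finset.sum_add_distrib, Finset.sum_ite_eq, Finset.mem_univ, if_true,
          ← Finset.sum_mul]
        ring
  have h5 : ∑ j, b j ≤ M * ∑ j, ρ j := by
    rw [Finset.mul_sum]
    exact Finset.sum_le_sum fun j _ => hb' j
  have h6 : 0 ≤ 2 * M ^ 2 * ∑ i, ∑ j, w i j := by positivity
  have h7 := mul_le_mul_of_nonneg_left h5 hM'
  nlinarith [mul_nonneg (sq_nonneg M') hS, mul_nonneg hM' hM]

theorem exists_lintegral_inv_dist_le {Ω : Set ℂ} (hb : Bornology.IsBounded Ω) (q : ℂ) :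
    ∃ C : ℝ, 0 ≤ C ∧ ∫⁻ x in Ω, ENNReal.ofReal (1 / ‖x - q‖) ≤ ENNReal.ofReal C := by
  obtain ⟨R, hR⟩ := hb.subset_ball q
  refine ⟨2 * Real.pi * max R 1, by positivity, ?_⟩
  rw [← lintegral_ball_inv_norm (by positivity) q]
  exact lintegral_mono_set (hR.trans (Metric.ball_subset_ball (le_max_left _ _)))

theorem norm_fderiv_ansatz_le {ι : Type*} [Fintype ι] {H : ℂ → ℝ} {V : ι → ℂ → ℂ} {x : ℂ}
    (hH : DifferentiableAt ℝ H x) (hV : ∀ j, DifferentiableAt ℝ (V j) x)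
    (h1 : ∀ j, ‖V j x‖ ≤ 1) (v : ℂ) :
    ‖fderiv ℝ (fun y => Complex.exp (H y * Complex.I) * ∏ j, V j y) x v‖ ≤
      ∑ j, ‖fderiv ℝ (V j) x v‖ + ‖fderiv ℝ H x v‖ := by
  have hE : HasFDerivAt (fun y => Complex.exp (H y * Complex.I))
      (Complex.exp (H x * Complex.I) • (Complex.ofRealCLM.comp (fderiv ℝ H x)).smulRight Complex.I)
      x := by
    have h2 : HasFDerivAt (fun y => (H y : ℂ) * Complex.I)
        ((Complex.ofRealCLM.comp (fderiv ℝ H x)).smulRight Complex.I) x := by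
      have h3 : HasFDerivAt (fun y => (H y : ℂ)) (Complex.ofRealCLM.comp (fderiv ℝ H x)) x :=
        Complex.ofRealCLM.hasFDerivAt.comp x hH.hasFDerivAt
      convert! h3.mul_const Complex.I using 1
      ext v
      simp [mul_comm]
    exact h2.cexp
  have hp : DifferentiableAt ℝ (fun y => ∏ j, V j y) x :=
    differentiableAt_fun_prod fun j _ => hV j
  rw [fderiv_fun_mul hE.differentiableAt hp, hE.fderiv]
  have hnE : ‖Complex.exp (H x * Complex.I)‖ = 1 := Complex.norm_exp_ofReal_mul_I _
  simp only [_root_.add_apply, _root_.smul_apply, smul_eq_mul,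
    ContinuousLinearMap.smulRight_apply, ContinuousLinearMap.comp_apply, Complex.ofRealCLM_apply]
  refine (norm_add_le _ _).trans (add_le_add ?_ ?_)
  · rw [norm_mul, hnE, one_mul]
    exact norm_fderiv_prod_le (fun j _ => hV j) (fun j _ => h1 j) v
  · rw [norm_mul, norm_mul, hnE, one_mul, norm_mul, Complex.norm_I, mul_one, Complex.norm_real]
    exact mul_le_of_le_one_left (norm_nonneg _) (norm_prod_le_one fun j _ => h1 j)

set_option maxHeartbeats 1000000 in
/-- The energy of a product of regularized vortices with a smooth phase. -/
theorem exists_minEnergy_le_of_vortexFactor {Ω : Set ℂ} (ho : IsOpen Ω)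
    (hb : Bornology.IsBounded Ω) (hf : IsFiniteMeasure (arcOn Ω)) {g : ℂ → ℂ}
    (hg : ∀ x ∈ frontier Ω, ‖g x‖ = 1) (α : ℝ) {ι : Type*} [Fintype ι] {q : ι → ℂ}
    (hq : Function.Injective q) {H : ℂ → ℝ} (hH : ContDiff ℝ 1 H) {M : ℝ} (hM : 0 ≤ M) :
    ∃ C : ℝ, ∀ (s ε : ℝ), 0 < ε → ∀ (E : ι → ℝ) (V V₀ : ι → ℂ → ℂ), (∀ j, 0 ≤ E j) →
      (∀ j, VortexFactor Ω (q j) M (E j) s ε (V j) (V₀ j)) →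
      (∀ᵐ x ∂(arcOn Ω), ((Complex.exp (H x * Complex.I) * ∏ j, V₀ j x) *
        (starRingEnd ℂ) (g x)).re = Real.cos α) →
      minEnergy Ω g α s ε ≤ ENNReal.ofReal (1 / 2 * ∑ j, E j + C) := by
  obtain ⟨MH, hMH⟩ := hb.isCompact_closure.exists_bound_of_continuousOn
    (hH.continuous_fderiv (by simp)).continuousOn
  choose R hR0 hR using fun j => exists_lintegral_inv_dist_le hb (q j)
  set n : ℝ := (Fintype.card ι : ℝ) with hn
  have hn0 : 0 ≤ n := Nat.cast_nonneg _
  set M' : ℝ := |MH| + n * M with hM'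
  have hM'0 : 0 ≤ M' := by positivity
  set K : ℝ := 2 * M ^ 2 * (∑ i, ∑ j, 1 / ‖q i - q j‖) + 2 * M' * M + M' ^ 2 with hK
  have hK0 : 0 ≤ K := by positivity
  set vol : ℝ := (volume Ω).toReal with hvol
  have hvolE : volume Ω = ENNReal.ofReal vol := (ENNReal.ofReal_toReal hb.measure_lt_top.ne).symm
  have hRs : 0 ≤ ∑ j, R j := Finset.sum_nonneg fun j _ => hR0 j
  -- The three summands bound, in this order, the interaction terms of the gradient, the potential
  -- term and the anchoring term.
  refine ⟨K * (vol + ∑ j, R j) + n * (n * M) + 2 * n * (n * M), ?_⟩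
  intro s ε hε E V V₀ hE hV hbd
  choose b hbm hb0 hbx hbE using fun j => (hV j).exists_gradient
  choose p hpm hpx hpM using fun j => (hV j).exists_potential
  choose e hem hex heM using fun j => (hV j).exists_error
  set u : ℂ → ℂ := fun y => Complex.exp (H y * Complex.I) * ∏ j, V j y with hu
  have hcd : ∀ x ∈ closure Ω, ContDiffAt ℝ 1 u x := by
    intro x hx
    refine ContDiffAt.mul ?_ (contDiffAt_prod fun j _ => (hV j).contDiffAt x hx)
    exact ContDiffAt.cexp ((Complex.ofRealCLM.contDiff.contDiffAt.comp x hH.contDiffAt).mul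
      contDiffAt_const)
  refine (minEnergy_le_energy ho hb hf g α s ε hcd).trans ?_
  have hprod : ∀ x, ‖u x‖ = ‖∏ j, V j x‖ := by
    intro x
    rw [hu, norm_mul, Complex.norm_exp_ofReal_mul_I, one_mul]
  have hpt : ∀ x ∈ Ω, (∀ j, x ≠ q j) → ∀ v : ℂ, ‖v‖ = 1 →
      ‖fderiv ℝ u x v‖ ^ 2 ≤ ∑ j, b j v x ^ 2 + K * (1 + ∑ j, 1 / ‖x - q j‖) := by
    intro x hx hxq v hv
    have h1 := norm_fderiv_ansatz_le (H := H) (V := V) (hH.differentiable (by simp) x)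
      (fun j => ((hV j).contDiffAt x (subset_closure hx)).differentiableAt (by simp))
      (fun j => (hV j).norm_le x (subset_closure hx)) v
    have h2 : ∑ j, ‖fderiv ℝ (V j) x v‖ ≤ ∑ j, b j v x + n * M := by
      calc _ ≤ ∑ j, (b j v x + M) := Finset.sum_le_sum fun j _ => (hbx j v hv x hx (hxq j)).1
        _ = _ := by rw [Finset.sum_add_distrib, Finset.sum_const, Finset.card_univ, nsmul_eq_mul]
    have h3 : ‖fderiv ℝ H x v‖ ≤ |MH| := by
      have := (fderiv ℝ H x).le_opNorm v
      rw [hv, mul_one] at this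
      exact this.trans ((hMH x (subset_closure hx)).trans (le_abs_self _))
    have h4 : ‖fderiv ℝ u x v‖ ≤ ∑ j, b j v x + M' := by
      rw [hM']; exact h1.trans (by linarith)
    exact (pow_le_pow_left₀ (norm_nonneg _) h4 2).trans
      (sq_sum_add_le hq hM hM'0 hxq (fun j => hb0 j v x) fun j => (hbx j v hv x hx (hxq j)).2)
  have hpot : ∀ x ∈ Ω, 1 / (2 * ε ^ 2) * (‖u x‖ ^ 2 - 1) ^ 2 ≤ n / 2 * ∑ j, p j x := by
    intro x hx
    have h1 : ∀ j, ‖V j x‖ ^ 2 ≤ 1 := fun j =>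
      pow_le_one₀ (norm_nonneg _) ((hV j).norm_le x (subset_closure hx))
    have h2 : ‖u x‖ ^ 2 = ∏ j, ‖V j x‖ ^ 2 := by rw [hprod, norm_prod, Finset.prod_pow]
    have h3 := one_sub_prod_le_sum (s := Finset.univ) (a := fun j => ‖V j x‖ ^ 2)
      (fun j _ => sq_nonneg _) fun j _ => h1 j
    have h4 : ∏ j, ‖V j x‖ ^ 2 ≤ 1 := Finset.prod_le_one (fun j _ => sq_nonneg _) fun j _ => h1 j
    -- The defect of a product of factors in `[0, 1]` is at most the sum of the defects;
    -- Cauchy–Schwarz then costs the factor `n`.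
    have h5 : (‖u x‖ ^ 2 - 1) ^ 2 ≤ n * ∑ j, (1 - ‖V j x‖ ^ 2) ^ 2 := by
      rw [h2]
      calc (∏ j, ‖V j x‖ ^ 2 - 1) ^ 2 = (1 - ∏ j, ‖V j x‖ ^ 2) ^ 2 := by ring
        _ ≤ (∑ j, (1 - ‖V j x‖ ^ 2)) ^ 2 := pow_le_pow_left₀ (by linarith) h3 2
        _ ≤ _ := by
          rw [hn, ← Finset.card_univ]
          exact sq_sum_le_card_mul_sum_sq
    have h6 : ∑ j, (1 - ‖V j x‖ ^ 2) ^ 2 / ε ^ 2 ≤ ∑ j, p j x :=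
      Finset.sum_le_sum fun j _ => hpx j x hx
    rw [← Finset.sum_div] at h6
    calc 1 / (2 * ε ^ 2) * (‖u x‖ ^ 2 - 1) ^ 2 ≤
          1 / (2 * ε ^ 2) * (n * ∑ j, (1 - ‖V j x‖ ^ 2) ^ 2) := by gcongr
      _ = n / 2 * ((∑ j, (1 - ‖V j x‖ ^ 2) ^ 2) / ε ^ 2) := by field_simp
      _ ≤ _ := by gcongr
  have hbulk : ∫⁻ x, ENNReal.ofReal ((1 / 2) * (‖fderiv ℝ u x 1‖ ^ 2 +
      ‖fderiv ℝ u x Complex.I‖ ^ 2 + 1 / (2 * ε ^ 2) * (‖u x‖ ^ 2 - 1) ^ 2)) ∂(areaOn Ω) ≤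
      ENNReal.ofReal (1 / 2 * ∑ j, E j + K * (vol + ∑ j, R j) + n * (n * M)) := by
    have hae : ∀ᵐ x : ℂ, ∀ j, x ≠ q j := by
      rw [ae_all_iff]
      intro j
      simp [ae_iff]
    have hpos1 : ∀ j x, 0 ≤ (1 / 2) * (b j 1 x ^ 2 + b j Complex.I x ^ 2) := fun j x => by positivity
    calc _ ≤ ∫⁻ x in Ω, (∑ j, ENNReal.ofReal (1 / 2) *
          ENNReal.ofReal (b j 1 x ^ 2 + b j Complex.I x ^ 2) +
          ENNReal.ofReal K * (1 + ∑ j, ENNReal.ofReal (1 / ‖x - q j‖)) +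
          ENNReal.ofReal n * ∑ j, ENNReal.ofReal (p j x)) := by
          refine lintegral_mono_ae ?_
          filter_upwards [ae_restrict_of_ae hae, ae_restrict_mem ho.measurableSet] with x hxq hx
          have h1 := hpt x hx hxq 1 (by simp)
          have h2 := hpt x hx hxq Complex.I (by simp)
          have h3 := hpot x hx
          have hp0 : ∀ j, 0 ≤ p j x := fun j => (by positivity : (0 : ℝ) ≤ _).trans (hpx j x hx)
          have hps : 0 ≤ ∑ j, p j x := Finset.sum_nonneg fun j _ => hp0 j
          have hrs : 0 ≤ ∑ j, 1 / ‖x - q j‖ := Finset.sum_nonneg fun j _ => by positivity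
          rw [← ENNReal.ofReal_sum_of_nonneg fun j _ => hp0 j,
            ← ENNReal.ofReal_sum_of_nonneg fun j _ => by positivity,
            ← ENNReal.ofReal_mul hn0, ← ENNReal.ofReal_one, ← ENNReal.ofReal_add zero_le_one hrs,
            ← ENNReal.ofReal_mul hK0, ← Finset.mul_sum,
            ← ENNReal.ofReal_sum_of_nonneg fun j _ => by positivity,
            ← ENNReal.ofReal_mul (by norm_num),
            ← ENNReal.ofReal_add (by positivity) (by positivity),
            ← ENNReal.ofReal_add (by positivity) (by positivity)]
          refine ENNReal.ofReal_le_ofReal ?_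
          rw [Finset.sum_add_distrib]
          nlinarith [mul_nonneg hn0 hps]
      _ = ∑ j, ENNReal.ofReal (1 / 2) *
          (∫⁻ x in Ω, ENNReal.ofReal (b j 1 x ^ 2 + b j Complex.I x ^ 2)) +
          ENNReal.ofReal K * (volume Ω + ∑ j, ∫⁻ x in Ω, ENNReal.ofReal (1 / ‖x - q j‖)) +
          ENNReal.ofReal n * ∑ j, ∫⁻ x in Ω, ENNReal.ofReal (p j x) := by
          have m1 := fun j => hbm j 1
          have m2 := fun j => hbm j Complex.I
          rw [lintegral_add_left (by fun_prop), lintegral_add_left (by fun_prop),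
            lintegral_finsetSum _ (by fun_prop), lintegral_const_mul _ (by fun_prop),
            lintegral_const_mul _ (by fun_prop), lintegral_add_left (by fun_prop),
            lintegral_finsetSum _ (by fun_prop), lintegral_finsetSum _ (by fun_prop)]
          simp only [lintegral_one, Measure.restrict_apply_univ]
          congr 2
          exact Finset.sum_congr rfl fun j _ => lintegral_const_mul _ (by fun_prop)
      _ ≤ ∑ j, ENNReal.ofReal (1 / 2) * ENNReal.ofReal (E j) +
          ENNReal.ofReal K * (ENNReal.ofReal vol + ∑ j, ENNReal.ofReal (R j)) +
          ENNReal.ofReal n * ∑ _j : ι, ENNReal.ofReal M := by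
          rw [hvolE]
          gcongr with j _ j _ j _
          · exact hbE j
          · exact hR j
          · exact hpM j
      _ = _ := by
          have hEs : 0 ≤ ∑ j, E j := Finset.sum_nonneg fun j _ => hE j
          have hvol0 : 0 ≤ vol := ENNReal.toReal_nonneg
          rw [← ENNReal.ofReal_sum_of_nonneg fun j _ => hM,
            ← ENNReal.ofReal_sum_of_nonneg fun j _ => hR0 j, ← Finset.mul_sum,
            ← ENNReal.ofReal_sum_of_nonneg fun j _ => hE j,
            ← ENNReal.ofReal_mul hn0, ← ENNReal.ofReal_add hvol0 hRs,
            ← ENNReal.ofReal_mul hK0, ← ENNReal.ofReal_mul (by norm_num), Finset.sum_const,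
            Finset.card_univ, nsmul_eq_mul, ← hn,
            ← ENNReal.ofReal_add (by positivity) (by positivity),
            ← ENNReal.ofReal_add (by positivity) (by positivity)]
  have hbdry : ∫⁻ x, ENNReal.ofReal (ε ^ (-s) / 2 * anchoring α (u x) (g x)) ∂(arcOn Ω) ≤
      ENNReal.ofReal (2 * n * (n * M)) := by
    have hεs : 0 < ε ^ (-s) := Real.rpow_pos_of_pos hε _
    have hc : 0 ≤ 2 * n * ε ^ (-s) := by positivity
    calc _ ≤ ∫⁻ x, ENNReal.ofReal (2 * n * ε ^ (-s)) * ∑ j, ENNReal.ofReal (e j x) ∂(arcOn Ω) := by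
          refine lintegral_mono_ae ?_
          filter_upwards [hbd, show ∀ᵐ x ∂(arcOn Ω), x ∈ frontier Ω from
            ae_restrict_mem isClosed_frontier.measurableSet] with x hx hxf
          have hxc := frontier_subset_closure hxf
          have he0 : ∀ j, 0 ≤ e j x := fun j => (sq_nonneg _).trans (hex j x hxf)
          rw [← ENNReal.ofReal_sum_of_nonneg fun j _ => he0 j, ← ENNReal.ofReal_mul hc]
          refine ENNReal.ofReal_le_ofReal ?_
          have h1 : ‖u x‖ ≤ 1 := by
            rw [hprod]; exact norm_prod_le_one fun j _ => (hV j).norm_le x hxc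
          have h2 : ‖Complex.exp (H x * Complex.I) * ∏ j, V₀ j x‖ = 1 := by
            rw [norm_mul, Complex.norm_exp_ofReal_mul_I, one_mul, norm_prod]
            exact Finset.prod_eq_one fun j _ => (hV j).norm_eq x hxf
          have h3 := anchoring_le h1 h2 (hg x hxf) hx
          have h4 : ‖u x - Complex.exp (H x * Complex.I) * ∏ j, V₀ j x‖ ≤
              ∑ j, ‖V j x - V₀ j x‖ := by
            rw [hu, ← mul_sub, norm_mul, Complex.norm_exp_ofReal_mul_I, one_mul]
            exact norm_prod_sub_prod_le_sum (fun j _ => (hV j).norm_le x hxc)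
              fun j _ => ((hV j).norm_eq x hxf).le
          have h5 : ‖u x - Complex.exp (H x * Complex.I) * ∏ j, V₀ j x‖ ^ 2 ≤ n * ∑ j, e j x := by
            calc _ ≤ (∑ j, ‖V j x - V₀ j x‖) ^ 2 := pow_le_pow_left₀ (norm_nonneg _) h4 2
              _ ≤ n * ∑ j, ‖V j x - V₀ j x‖ ^ 2 := by
                rw [hn, ← Finset.card_univ]
                exact sq_sum_le_card_mul_sum_sq
              _ ≤ _ := mul_le_mul_of_nonneg_left
                (Finset.sum_le_sum fun j _ => hex j x hxf) hn0
          have hes : 0 ≤ n * ∑ j, e j x := mul_nonneg hn0 (Finset.sum_nonneg fun j _ => he0 j)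
          calc ε ^ (-s) / 2 * anchoring α (u x) (g x) ≤ ε ^ (-s) / 2 * (3 * (n * ∑ j, e j x)) := by
                gcongr
                exact h3.trans (by gcongr)
            _ ≤ _ := by nlinarith [mul_nonneg hεs.le hes]
      _ = ENNReal.ofReal (2 * n * ε ^ (-s)) * ∑ j, ∫⁻ x, ENNReal.ofReal (e j x) ∂(arcOn Ω) := by
          rw [lintegral_const_mul _ (by fun_prop), lintegral_finsetSum _ (by fun_prop)]
      _ ≤ ENNReal.ofReal (2 * n * ε ^ (-s)) * ∑ _j : ι, ENNReal.ofReal (M * ε ^ s) := by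
          gcongr with j _
          exact heM j
      _ = _ := by
          have : 0 ≤ M * ε ^ s := mul_nonneg hM (Real.rpow_nonneg hε.le _)
          rw [← ENNReal.ofReal_sum_of_nonneg fun j _ => this, ← ENNReal.ofReal_mul hc,
            Finset.sum_const, Finset.card_univ, nsmul_eq_mul, ← hn]
          congr 1
          -- The weight of the boundary term cancels the size `ε ^ s` allowed for the errors of the
          -- factors.
          have h1 : ε ^ (-s) * ε ^ s = 1 := by rw [← Real.rpow_add hε, neg_add_cancel, Real.rpow_zero]
          linear_combination (2 * n * n * M) * h1
  have hEs : 0 ≤ ∑ j, E j := Finset.sum_nonneg fun j _ => hE j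
  have hvol0 : 0 ≤ vol := ENNReal.toReal_nonneg
  refine (add_le_add hbulk hbdry).trans ?_
  rw [← ENNReal.ofReal_add (by positivity) (by positivity)]
  exact ENNReal.ofReal_le_ofReal (by linarith)

theorem VortexFactor.mono {Ω : Set ℂ} {q : ℂ} {M M' E s ε : ℝ} {V V₀ : ℂ → ℂ}
    (h : VortexFactor Ω q M E s ε V V₀) (hM : M ≤ M') (hε : 0 < ε) :
    VortexFactor Ω q M' E s ε V V₀ := by
  refine ⟨h.contDiffAt, h.norm_le, h.norm_eq, ?_, ?_, ?_⟩
  · obtain ⟨b, hb1, hb2, hb3, hb4⟩ := h.exists_gradient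
    refine ⟨b, hb1, hb2, fun v hv x hx hxq => ?_, hb4⟩
    obtain ⟨h1, h2⟩ := hb3 v hv x hx hxq
    exact ⟨h1.trans (by linarith), h2.trans (by gcongr)⟩
  · obtain ⟨p, hp1, hp2, hp3⟩ := h.exists_potential
    exact ⟨p, hp1, hp2, hp3.trans (ENNReal.ofReal_le_ofReal hM)⟩
  · obtain ⟨e, he1, he2, he3⟩ := h.exists_error
    exact ⟨e, he1, he2, he3.trans (ENNReal.ofReal_le_ofReal (by gcongr))⟩

/-! ### Interior vortices -/

/-- The regularized degree one vortex `z / √(|z|² + ε²)`. -/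
noncomputable def softVortex (ε : ℝ) (z : ℂ) : ℂ := (Real.sqrt (‖z‖ ^ 2 + ε ^ 2))⁻¹ • z

section SoftVortex

variable {ε : ℝ}

theorem contDiff_softVortex (hε : 0 < ε) : ContDiff ℝ 1 (softVortex ε) := by
  unfold softVortex
  have h1 : ContDiff ℝ 1 fun z : ℂ => ‖z‖ ^ 2 + ε ^ 2 := (contDiff_norm_sq ℝ).add contDiff_const
  refine ContDiff.smul (ContDiff.inv (h1.sqrt fun z => by positivity) fun z => ?_) contDiff_id
  positivity

theorem fderiv_softVortex (hε : 0 < ε) (z v : ℂ) :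
    fderiv ℝ (softVortex ε) z v = (Real.sqrt (‖z‖ ^ 2 + ε ^ 2))⁻¹ • v -
      ((Real.sqrt (‖z‖ ^ 2 + ε ^ 2))⁻¹ ^ 3 * inner ℝ z v) • z := by
  have hpos : 0 < ‖z‖ ^ 2 + ε ^ 2 := by positivity
  have h1 : HasFDerivAt (fun z : ℂ => ‖z‖ ^ 2 + ε ^ 2) (2 • innerSL ℝ z) z :=
    (hasStrictFDerivAt_norm_sq z).hasFDerivAt.add_const _
  have h2 := h1.sqrt hpos.ne'
  have h3 := ((hasDerivAt_inv (Real.sqrt_pos.2 hpos).ne').comp_hasFDerivAt z h2).smul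
    (hasFDerivAt_id z)
  have h4 : HasFDerivAt (softVortex ε) _ z := h3
  rw [h4.fderiv]
  simp only [_root_.add_apply, _root_.smul_apply, ContinuousLinearMap.smulRight_apply,
    innerSL_apply_apply, Function.comp, id, ContinuousLinearMap.id_apply]
  rw [sub_eq_add_neg, ← neg_smul]
  congr 2
  have := (Real.sqrt_pos.2 hpos).ne'
  simp only [smul_eq_mul, nsmul_eq_mul]
  field_simp
  norm_num

theorem inv_sqrt_sq (hε : 0 < ε) (z : ℂ) :
    (Real.sqrt (‖z‖ ^ 2 + ε ^ 2))⁻¹ ^ 2 = 1 / (‖z‖ ^ 2 + ε ^ 2) := by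
  rw [inv_pow, Real.sq_sqrt (by positivity), one_div]

theorem norm_softVortex_sq (hε : 0 < ε) (z : ℂ) :
    ‖softVortex ε z‖ ^ 2 = 1 - ε ^ 2 / (‖z‖ ^ 2 + ε ^ 2) := by
  rw [softVortex, norm_smul, mul_pow, Real.norm_eq_abs, sq_abs, inv_sqrt_sq hε]
  have : ‖z‖ ^ 2 + ε ^ 2 ≠ 0 := by positivity
  field_simp
  ring

theorem norm_softVortex_le (hε : 0 < ε) (z : ℂ) : ‖softVortex ε z‖ ≤ 1 := by
  have h := norm_softVortex_sq hε z
  have : 0 ≤ ε ^ 2 / (‖z‖ ^ 2 + ε ^ 2) := by positivity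
  exact le_of_sq_le_sq (by linarith) zero_le_one |>.trans_eq rfl

theorem norm_fderiv_softVortex_le (hε : 0 < ε) {z v : ℂ} (hv : ‖v‖ = 1) (hz : z ≠ 0) :
    ‖fderiv ℝ (softVortex ε) z v‖ ≤ 2 * (1 / ‖z‖) := by
  rw [fderiv_softVortex hε]
  set w := (Real.sqrt (‖z‖ ^ 2 + ε ^ 2))⁻¹ with hw
  have hz' : 0 < ‖z‖ := norm_pos_iff.2 hz
  have hw0 : 0 ≤ w := by positivity
  have h1 : w ≤ 1 / ‖z‖ := by
    rw [hw, ← one_div]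
    exact one_div_le_one_div_of_le hz' (Real.le_sqrt_of_sq_le (by nlinarith))
  have h2 : w * ‖z‖ ≤ 1 := by rwa [le_div_iff₀ hz'] at h1
  have h3 : |inner ℝ z v| ≤ ‖z‖ := by simpa [hv] using abs_real_inner_le_norm z v
  refine (norm_sub_le _ _).trans ?_
  rw [norm_smul, norm_smul, hv, mul_one, Real.norm_of_nonneg hw0, norm_mul, norm_pow,
    Real.norm_of_nonneg hw0, Real.norm_eq_abs]
  have h4 : w ^ 3 * |inner ℝ z v| * ‖z‖ ≤ w := by
    calc w ^ 3 * |inner ℝ z v| * ‖z‖ ≤ w ^ 3 * ‖z‖ * ‖z‖ := by gcongr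
      _ = w * (w * ‖z‖) ^ 2 := by ring
      _ ≤ w * 1 := by gcongr; exact pow_le_one₀ (by positivity) h2
      _ = w := mul_one w
  linarith

theorem norm_smul_sub_smul_sq {E : Type*} [NormedAddCommGroup E] [InnerProductSpace ℝ E]
    (a b : ℝ) (v z : E) :
    ‖a • v - b • z‖ ^ 2 = a ^ 2 * ‖v‖ ^ 2 - 2 * (a * b * inner ℝ z v) + b ^ 2 * ‖z‖ ^ 2 := by
  rw [norm_sub_sq_real, norm_smul, norm_smul, real_inner_smul_left, real_inner_smul_right,
    real_inner_comm, mul_pow, mul_pow, Real.norm_eq_abs, Real.norm_eq_abs, sq_abs, sq_abs]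
  ring

theorem sq_norm_fderiv_softVortex_le (hε : 0 < ε) (z : ℂ) :
    ‖fderiv ℝ (softVortex ε) z 1‖ ^ 2 + ‖fderiv ℝ (softVortex ε) z Complex.I‖ ^ 2 ≤
      1 / (‖z‖ ^ 2 + ε ^ 2) + ε ^ 2 / (‖z‖ ^ 2 + ε ^ 2) ^ 2 := by
  rw [fderiv_softVortex hε, fderiv_softVortex hε]
  have hw2 := inv_sqrt_sq hε z
  set w := (Real.sqrt (‖z‖ ^ 2 + ε ^ 2))⁻¹ with hw
  have hpos : 0 < ‖z‖ ^ 2 + ε ^ 2 := by positivity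
  have hW : w ^ 2 * (‖z‖ ^ 2 + ε ^ 2) = 1 := by rw [hw2]; field_simp
  have h5 : ε ^ 2 / (‖z‖ ^ 2 + ε ^ 2) ^ 2 = ε ^ 2 * (w ^ 2) ^ 2 := by rw [hw2]; field_simp
  rw [h5, ← hw2]
  have hn : ‖z‖ ^ 2 = z.re ^ 2 + z.im ^ 2 := by
    rw [Complex.sq_norm, Complex.normSq_apply]; ring
  -- The sum over an orthonormal frame is rotation invariant: the angular derivative contributes
  -- `w²` and the radial one `w² (1 - w² |z|²)²`, where `1 - w² |z|² = w² ε²`.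
  have h6 : ‖w • (1 : ℂ) - (w ^ 3 * inner ℝ z 1) • z‖ ^ 2 +
      ‖w • Complex.I - (w ^ 3 * inner ℝ z Complex.I) • z‖ ^ 2 =
      w ^ 2 * (1 + (1 - w ^ 2 * ‖z‖ ^ 2) ^ 2) := by
    rw [hn, norm_smul_sub_smul_sq, norm_smul_sub_smul_sq, hn, norm_one, Complex.norm_I]
    simp only [Complex.inner, Complex.mul_re, Complex.conj_re, Complex.conj_im, Complex.one_re,
      Complex.one_im, Complex.I_re, Complex.I_im]
    ring
  rw [h6]
  have h7 : 1 - w ^ 2 * ‖z‖ ^ 2 = w ^ 2 * ε ^ 2 := by linarith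
  have h8 : w ^ 2 * ε ^ 2 ≤ 1 := by nlinarith [mul_nonneg (sq_nonneg w) (sq_nonneg ‖z‖)]
  rw [h7]
  have h9 : 0 ≤ w ^ 2 * (w ^ 2 * ε ^ 2) := by positivity
  nlinarith

/-- The vortex is a positive multiple of `z / ‖z‖`, so the distance is the defect `1 - ‖V‖ ≤ 1 -
‖V‖²`. -/
theorem norm_softVortex_sub_le (hε : 0 < ε) {z : ℂ} (hz : z ≠ 0) :
    ‖softVortex ε z - z / ‖z‖‖ ≤ ε ^ 2 / ‖z‖ ^ 2 := by
  have hz' : 0 < ‖z‖ := norm_pos_iff.2 hz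
  have hn := norm_softVortex_sq hε z
  have h1 := norm_softVortex_le hε z
  have h2 : softVortex ε z - z / ‖z‖ = ((‖softVortex ε z‖ - 1 : ℝ) : ℂ) * (z / ‖z‖) := by
    have : (‖z‖ : ℂ) ≠ 0 := by exact_mod_cast hz'.ne'
    rw [softVortex, norm_smul, Real.norm_of_nonneg (by positivity), Complex.real_smul]
    push_cast
    field_simp
  have h3 : ‖z / (‖z‖ : ℂ)‖ = 1 := by
    rw [norm_div, Complex.norm_real, norm_norm, div_self hz'.ne']
  rw [h2, norm_mul, h3, mul_one, Complex.norm_real, Real.norm_eq_abs, abs_sub_comm,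
    abs_of_nonneg (by linarith)]
  have h4 : ε ^ 2 / (‖z‖ ^ 2 + ε ^ 2) ≤ ε ^ 2 / ‖z‖ ^ 2 := by
    gcongr
    nlinarith
  nlinarith [norm_nonneg (softVortex ε z)]

end SoftVortex

theorem exists_vortexFactor_interior {Ω : Set ℂ} (ho : IsOpen Ω) (hb : Bornology.IsBounded Ω)
    (hf : IsFiniteMeasure (arcOn Ω)) {q : ℂ} (hq : q ∈ Ω) :
    ∃ M C : ℝ, 0 ≤ M ∧ 0 ≤ C ∧ ∀ s ε : ℝ, 0 < s → s ≤ 1 → 0 < ε → ε < 1 →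
      VortexFactor Ω q M (2 * Real.pi * |Real.log ε| + C) s ε (fun x => softVortex ε (x - q))
        (fun x => (x - q) / ‖x - q‖) := by
  obtain ⟨d, hd, hball⟩ := Metric.isOpen_iff.1 ho q hq
  obtain ⟨R, hR1, hR⟩ := hb.subset_ball_lt 1 q
  have hR0 : 0 < R := one_pos.trans hR1
  have hfr : ∀ x ∈ frontier Ω, d ≤ ‖x - q‖ := by
    intro x hx
    by_contra! h
    exact (ho.frontier_eq ▸ hx).2 (hball (by rwa [Metric.mem_ball, dist_eq_norm]))
  set A : ℝ := ((arcOn Ω) Set.univ).toReal with hA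
  have hA0 : 0 ≤ A := ENNReal.toReal_nonneg
  -- The constants `2`, `π` and `A / d ^ 4` cover the pointwise gradient bound, the potential, and
  -- the boundary error at distance at least `d` from the centre.
  refine ⟨2 + Real.pi + A / d ^ 4, Real.pi * Real.log (R ^ 2 + 1) + Real.pi, by positivity, ?_, ?_⟩
  · have : 0 ≤ Real.log (R ^ 2 + 1) := Real.log_nonneg (by nlinarith)
    positivity
  intro s ε hs hs1 hε hε1
  have hAd : 0 ≤ A / d ^ 4 := by positivity
  have hfd : ∀ x v, fderiv ℝ (fun x => softVortex ε (x - q)) x v =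
      fderiv ℝ (softVortex ε) (x - q) v := by
    intro x v
    rw [fderiv_comp_sub]
  refine ⟨?_, fun x _ => norm_softVortex_le hε _, fun x hx => ?_, ?_, ?_, ?_⟩
  · exact fun x _ => ((contDiff_softVortex hε).comp (contDiff_id.sub contDiff_const)).contDiffAt
  · have : 0 < ‖x - q‖ := hd.trans_le (hfr x hx)
    rw [norm_div, Complex.norm_real, norm_norm, div_self this.ne']
  · refine ⟨fun v x => ‖fderiv ℝ (softVortex ε) (x - q) v‖, fun v => ?_, fun v x => norm_nonneg _,
      fun v hv x hx hxq => ⟨?_, ?_⟩, ?_⟩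
    · have h1 := ((contDiff_softVortex hε).continuous_fderiv (by simp))
      have h2 : Continuous fun x => fderiv ℝ (softVortex ε) (x - q) v :=
        (h1.comp (continuous_id.sub continuous_const)).clm_apply continuous_const
      exact h2.norm.measurable
    · rw [hfd]
      have := Real.pi_pos
      linarith
    · refine (norm_fderiv_softVortex_le hε hv (sub_ne_zero.2 hxq)).trans ?_
      gcongr
      linarith [Real.pi_pos]
    · calc _ ≤ ∫⁻ x in Metric.ball q R, (ENNReal.ofReal (1 / (‖x - q‖ ^ 2 + ε ^ 2)) +
            ENNReal.ofReal (ε ^ 2 / (‖x - q‖ ^ 2 + ε ^ 2) ^ 2)) := by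
            refine (lintegral_mono_set hR).trans (lintegral_mono fun x => ?_)
            rw [← ENNReal.ofReal_add (by positivity) (by positivity)]
            exact ENNReal.ofReal_le_ofReal (sq_norm_fderiv_softVortex_le hε _)
        _ ≤ ENNReal.ofReal (2 * Real.pi * |Real.log ε| + Real.pi * Real.log (R ^ 2 + 1)) +
            ENNReal.ofReal Real.pi := by
            rw [lintegral_add_left (by fun_prop), lintegral_ball_inv_sq_add_sq hR0 hε]
            refine add_le_add (ENNReal.ofReal_le_ofReal ?_) (lintegral_ball_core_le hR0 hε q)
            rw [abs_of_nonpos (Real.log_nonpos hε.le hε1.le)]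
            have : Real.log (R ^ 2 + ε ^ 2) ≤ Real.log (R ^ 2 + 1) :=
              Real.log_le_log (by positivity) (by nlinarith)
            nlinarith [Real.pi_pos]
        _ = _ := by
            have : 0 ≤ Real.log (R ^ 2 + 1) := Real.log_nonneg (by nlinarith)
            rw [← ENNReal.ofReal_add (by positivity) (by positivity)]
            congr 1
            ring
  · refine ⟨fun x => ε ^ 2 / (‖x - q‖ ^ 2 + ε ^ 2) ^ 2, by fun_prop, fun x _ => le_of_eq ?_, ?_⟩
    · rw [norm_softVortex_sq hε]
      field_simp
      ring
    · refine (lintegral_mono_set hR).trans ((lintegral_ball_core_le hR0 hε q).trans ?_)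
      exact ENNReal.ofReal_le_ofReal (by linarith)
  · refine ⟨fun _ => ε / d ^ 4, measurable_const, fun x hx => ?_, ?_⟩
    · have h1 : 0 < ‖x - q‖ := hd.trans_le (hfr x hx)
      calc ‖softVortex ε (x - q) - (x - q) / ‖x - q‖‖ ^ 2 ≤ (ε ^ 2 / ‖x - q‖ ^ 2) ^ 2 := by
            gcongr
            exact norm_softVortex_sub_le hε (norm_pos_iff.1 h1)
        _ ≤ (ε ^ 2 / d ^ 2) ^ 2 := by
            gcongr
            exact hfr x hx
        _ = ε ^ 4 / d ^ 4 := by ring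
        _ ≤ ε / d ^ 4 := by
            gcongr
            exact pow_le_of_le_one hε.le hε1.le (by norm_num)
    · rw [lintegral_const, ← ENNReal.ofReal_toReal (measure_lt_top (arcOn Ω) Set.univ).ne, ← hA,
        ← ENNReal.ofReal_mul (by positivity)]
      refine ENNReal.ofReal_le_ofReal ?_
      -- The boundary error is of order `ε`, which is within the allowed `ε ^ s` because `s ≤ 1`.
      have h2 : ε ≤ ε ^ s := by
        simpa using Real.rpow_le_rpow_of_exponent_ge hε hε1.le hs1
      calc ε / d ^ 4 * A = A / d ^ 4 * ε := by ring
        _ ≤ (2 + Real.pi + A / d ^ 4) * ε ^ s := by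
          gcongr
          linarith [Real.pi_pos]

/-! ### Phase and winding along the boundary; the competitor with interior vortices -/

variable {Ω : Set ℂ} {c : ℝ → ℂ}

theorem notMem_of_mem_frontier (ho : IsOpen Ω) {x : ℂ} (hx : x ∈ frontier Ω) : x ∉ Ω :=
  (ho.frontier_eq ▸ hx).2

theorem IsPositiveParam.mem_frontier (hc : IsPositiveParam Ω c) (t : ℝ) : c t ∈ frontier Ω := by
  rw [← hc.range_eq]; exact ⟨t, rfl⟩

/-- The phase of the boundary datum along the boundary curve. -/
theorem IsPositiveParam.exists_phase (hc : IsPositiveParam Ω c) {g : ℂ → ℂ}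
    (hg : ContDiffOn ℝ 1 g (frontier Ω)) {D : ℝ} {φ : ℝ → ℝ} (hφ : Continuous φ)
    (h : ∀ t, g (c t) = Complex.exp ((φ t : ℂ) * Complex.I))
    (hD : φ (2 * Real.pi) - φ 0 = 2 * Real.pi * D) :
    ContDiff ℝ 1 φ ∧ ∀ t, φ (t + 2 * Real.pi) = φ t + 2 * Real.pi * D := by
  have hγ : ContDiff ℝ 1 fun t => g (c t) :=
    hg.comp_contDiff (hc.contDiff.of_le (by norm_num)) hc.mem_frontier
  have h1 := contDiff_one_of_exp_mul_I hγ hφ h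
  have hd : ∀ t, HasDerivAt φ (deriv φ t) t := fun t =>
    (h1.differentiable (by simp) t).hasDerivAt
  refine ⟨h1, fun t => ?_⟩
  have hexp : ∀ t, HasDerivAt (fun t => g (c t)) (g (c t) * (deriv φ t * Complex.I)) t := by
    intro t
    have := ((hd t).ofReal_comp.mul_const Complex.I).cexp
    rw [← h t] at this
    exact this.congr_of_eventuallyEq (Eventually.of_forall h)
  -- Differentiating `g ∘ c = exp (i φ)` shows that `φ'` is periodic. The increment over one period
  -- is then constant and equals its value at `0`.
  have hper : ∀ t, deriv φ (t + 2 * Real.pi) = deriv φ t := by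
    intro t
    have h2 := (hexp (t + 2 * Real.pi)).comp_add_const t (2 * Real.pi)
    simp only [hc.periodic t, hc.periodic _] at h2
    have h3 := h2.unique (hexp t)
    have h4 : g (c t) ≠ 0 := by rw [h]; exact Complex.exp_ne_zero _
    have h5 := mul_right_cancel₀ Complex.I_ne_zero (mul_left_cancel₀ h4 h3)
    exact_mod_cast h5
  have hconst : ∀ x y, φ (x + 2 * Real.pi) - φ x = φ (y + 2 * Real.pi) - φ y := by
    apply is_const_of_deriv_eq_zero (f := fun x => φ (x + 2 * Real.pi) - φ x)
    · exact fun x => (((hd _).comp_add_const x (2 * Real.pi)).sub (hd x)).differentiableAt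
    · intro x
      have h2 : HasDerivAt (fun x => φ (x + 2 * Real.pi) - φ x) _ x :=
        ((hd _).comp_add_const x (2 * Real.pi)).sub (hd x)
      rw [h2.deriv, hper, sub_self]
  have := hconst t 0
  rw [zero_add, hD] at this
  linarith

theorem map_add_int_mul_period {f : ℝ → ℝ} {K : ℝ}
    (h : ∀ t, f (t + 2 * Real.pi) = f t + K) (t : ℝ) (k : ℤ) :
    f (t + k * (2 * Real.pi)) = f t + k * K := by
  induction k using Int.induction_on with
  | zero => simp
  | succ i ih =>
    have : t + ((i : ℤ) + 1 : ℤ) * (2 * Real.pi) = t + (i : ℤ) * (2 * Real.pi) + 2 * Real.pi := by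
      push_cast; ring
    rw [this, h, ih]; push_cast; ring
  | pred i ih =>
    have h1 := h (t + (-(i : ℤ) - 1 : ℤ) * (2 * Real.pi))
    have : t + (-(i : ℤ) - 1 : ℤ) * (2 * Real.pi) + 2 * Real.pi =
        t + (-(i : ℤ) : ℤ) * (2 * Real.pi) := by
      push_cast; ring
    rw [this, ih] at h1
    push_cast at h1 ⊢
    linarith

/-- At a rightmost point the horizontal ray leaving the domain meets the boundary only once, which
makes the winding number computable by hand. -/
theorem exists_isMaxOn_re (ho : IsOpen Ω) (hb : Bornology.IsBounded Ω)
    (hc : IsPositiveParam Ω c) : ∃ t₀, ∀ x ∈ closure Ω, x.re ≤ (c t₀).re := by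
  obtain ⟨p, hp, hmax⟩ := hb.isCompact_closure.exists_isMaxOn
    ⟨c 0, frontier_subset_closure (hc.mem_frontier 0)⟩ Complex.continuous_re.continuousOn
  have hpf : p ∈ frontier Ω := by
    rw [ho.frontier_eq]
    refine ⟨hp, fun hpΩ => ?_⟩
    obtain ⟨d, hd, hball⟩ := Metric.isOpen_iff.1 ho p hpΩ
    have h1 : p + (d / 2 : ℝ) ∈ Ω := hball (by
      rw [Metric.mem_ball, dist_eq_norm, add_sub_cancel_left, Complex.norm_real,
        Real.norm_of_nonneg (by positivity)]
      linarith)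
    have h2 : (p + (d / 2 : ℝ)).re ≤ p.re := hmax (subset_closure h1)
    rw [Complex.add_re, Complex.ofReal_re] at h2
    linarith
  rw [← hc.range_eq] at hpf
  obtain ⟨t₀, rfl⟩ := hpf
  exact ⟨t₀, hmax⟩

/-- The tangent at the rightmost boundary point points upwards, and the points slightly to the left
of it lie in the domain. -/
theorem IsPositiveParam.deriv_of_isMaxOn_re (hc : IsPositiveParam Ω c) {t₀ : ℝ}
    (hmax : ∀ x ∈ closure Ω, x.re ≤ (c t₀).re) :
    0 < (deriv c t₀).im ∧ ∀ᶠ r : ℝ in 𝓝[>] 0, c t₀ - r ∈ Ω := by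
  have hd : HasDerivAt c (deriv c t₀) t₀ :=
    (hc.contDiff.differentiable (by simp) t₀).hasDerivAt
  have hre : (deriv c t₀).re = 0 := by
    have h1 : HasDerivAt (fun t => (c t).re) (deriv c t₀).re t₀ :=
      Complex.reCLM.hasFDerivAt.comp_hasDerivAt t₀ hd
    refine IsLocalMax.hasDerivAt_eq_zero ?_ h1
    exact Eventually.of_forall fun t => hmax _ (frontier_subset_closure (hc.mem_frontier t))
  set y := (deriv c t₀).im with hy
  have hdy : deriv c t₀ = y * Complex.I := by
    apply Complex.ext <;> simp [hre, hy]
  have hl : ∀ᶠ r : ℝ in 𝓝[>] 0, c t₀ - ((r * y : ℝ) : ℂ) ∈ Ω := by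
    filter_upwards [hc.left t₀] with r hr
    convert! hr using 1
    rw [hdy]
    push_cast
    linear_combination -(r * y : ℂ) * Complex.I_mul_I
  have hy0 : y ≠ 0 := by
    intro h
    rw [h] at hdy
    exact hc.deriv_ne_zero t₀ (by simpa using hdy)
  have hypos : 0 < y := by
    obtain ⟨r, hr, hr0⟩ := (hl.and self_mem_nhdsWithin).exists
    have h1 := hmax _ (subset_closure hr)
    rw [Complex.sub_re, Complex.ofReal_re] at h1
    have hr0' : 0 < r := hr0
    have : 0 ≤ r * y := by linarith
    exact lt_of_le_of_ne (nonneg_of_mul_nonneg_right this hr0') hy0.symm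
  refine ⟨hypos, ?_⟩
  have ht : Tendsto (fun r : ℝ => r / y) (𝓝[>] 0) (𝓝[>] 0) := by
    refine tendsto_nhdsWithin_iff.2 ⟨?_, ?_⟩
    · have : Tendsto (fun r : ℝ => r / y) (𝓝 0) (𝓝 (0 / y)) :=
        (continuous_id.div_const y).continuousAt
      rw [zero_div] at this
      exact this.mono_left nhdsWithin_le_nhds
    · filter_upwards [self_mem_nhdsWithin] with r hr
      exact div_pos hr hypos
  filter_upwards [ht.eventually hl] with r hr
  rwa [div_mul_cancel₀ _ hy0] at hr

theorem ceil_eventually_eq_of_notMem_int {x : ℝ} (hx : ∀ k : ℤ, x ≠ k) :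
    ∀ᶠ y in 𝓝 x, ⌈y⌉ = ⌈x⌉ ∧ ⌊y⌋ = ⌊x⌋ := by
  have h1 : (⌊x⌋ : ℝ) < x := lt_of_le_of_ne (Int.floor_le x) (hx _).symm
  have h2 : x < ⌊x⌋ + 1 := Int.lt_floor_add_one x
  have h3 : ∀ y : ℝ, (⌊x⌋ : ℝ) < y → y < ⌊x⌋ + 1 → ⌈y⌉ = ⌊x⌋ + 1 ∧ ⌊y⌋ = ⌊x⌋ := by
    intro y hy1 hy2
    refine ⟨Int.ceil_eq_iff.2 ⟨by push_cast; linarith, by push_cast; linarith⟩,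
      Int.floor_eq_iff.2 ⟨hy1.le, hy2⟩⟩
  filter_upwards [isOpen_Ioo.mem_nhds (⟨h1, h2⟩ : x ∈ Set.Ioo (⌊x⌋ : ℝ) (⌊x⌋ + 1))] with y hy
  rw [(h3 y hy.1 hy.2).1, (h3 x h1 h2).1]
  exact ⟨rfl, (h3 y hy.1 hy.2).2⟩

/-- The boundary curve winds once around the points slightly to the left of its rightmost point. -/
theorem IsPositiveParam.exists_winding (ho : IsOpen Ω) (hc : IsPositiveParam Ω c)
    {t₀ r₀ : ℝ} (hmax : ∀ x ∈ closure Ω, x.re ≤ (c t₀).re)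
    (hr₀ : ∀ r ∈ Set.Ioo 0 r₀, c t₀ - r ∈ Ω) {r : ℝ} (hr : r ∈ Set.Ioo 0 r₀) :
    ∃ θ : ℝ → ℝ, ContDiff ℝ 1 θ ∧ (∀ t, θ (t + 2 * Real.pi) = θ t + 2 * Real.pi) ∧
      ∀ t, (c t - (c t₀ - r)) / (‖c t - (c t₀ - r)‖ : ℂ) = Complex.exp (θ t * Complex.I) := by
  obtain ⟨him, -⟩ := hc.deriv_of_isMaxOn_re hmax
  set q := c t₀ - r with hq
  have hqΩ : q ∈ Ω := hr₀ r hr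
  have hne : ∀ t, c t - q ≠ 0 := fun t h =>
    notMem_of_mem_frontier ho (hc.mem_frontier t) (by rwa [sub_eq_zero.1 h])
  -- The argument of `q - c t` jumps only when `c t` lies on the ray from `q` to the right, that is
  -- at `c t₀`: the points between lie in the domain and nothing lies beyond. There the curve goes
  -- upwards and the argument drops by `2π`, which the ceiling makes up for. At the crossing the
  -- argument is `π`, its limit from the left; this forces the ceiling instead of the floor.
  set θ : ℝ → ℝ := fun t => (q - c t).arg + 2 * Real.pi * ⌈(t - t₀) / (2 * Real.pi)⌉ + Real.pi
    with hθ
  have hper : ∀ t, θ (t + 2 * Real.pi) = θ t + 2 * Real.pi := by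
    intro t
    have : (t + 2 * Real.pi - t₀) / (2 * Real.pi) = (t - t₀) / (2 * Real.pi) + 1 := by
      have := Real.pi_ne_zero
      field_simp
      ring
    simp only [hθ, hc.periodic t, this, Int.ceil_add_one]
    push_cast
    ring
  have hexp : ∀ t, (c t - q) / (‖c t - q‖ : ℂ) = Complex.exp (θ t * Complex.I) := by
    intro t
    have hn : (‖c t - q‖ : ℂ) ≠ 0 := by exact_mod_cast (norm_pos_iff.2 (hne t)).ne'
    have h1 := Complex.norm_mul_exp_arg_mul_I (q - c t)
    have h2 : Complex.exp (θ t * Complex.I) = -Complex.exp ((q - c t).arg * Complex.I) := by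
      have : (θ t : ℂ) * Complex.I = (q - c t).arg * Complex.I +
          ⌈(t - t₀) / (2 * Real.pi)⌉ * (2 * Real.pi * Complex.I) + Real.pi * Complex.I := by
        simp only [hθ]; push_cast; ring
      rw [this, Complex.exp_add, Complex.exp_add, Complex.exp_int_mul_two_pi_mul_I,
        Complex.exp_pi_mul_I]
      ring
    rw [h2, div_eq_iff hn]
    rw [norm_sub_rev] at h1
    linear_combination h1
  have hθ0 : ContinuousAt θ t₀ := by
    have h1 : ContinuousAt (fun t => (c t - q).arg + 2 * Real.pi) t₀ := by
      refine ContinuousAt.add ?_ continuousAt_const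
      refine ContinuousAt.comp (f := fun t => c t - q) (Complex.continuousAt_arg ?_)
        (hc.contDiff.continuous.sub continuous_const).continuousAt
      left
      simp [hq, hr.1]
    refine h1.congr ?_
    have hds : ∀ᶠ t in 𝓝 t₀, 0 < (dslope c t₀ t).im := by
      have : ContinuousAt (fun t => (dslope c t₀ t).im) t₀ :=
        (Complex.continuous_im.comp (contDiff_one_dslope hc.contDiff t₀).continuous).continuousAt
      refine this.eventually_const_lt ?_
      simpa [dslope_same] using him
    have hnear : ∀ᶠ t in 𝓝 t₀, |t - t₀| < 2 * Real.pi := by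
      have := Metric.ball_mem_nhds t₀ Real.two_pi_pos
      filter_upwards [this] with t ht
      rwa [Metric.mem_ball, Real.dist_eq] at ht
    filter_upwards [hds, hnear] with t ht1 ht2
    have hc1 : (c t - q).im = (t - t₀) * (dslope c t₀ t).im := by
      have h2 := congrArg Complex.im (sub_smul_dslope c t₀ t)
      rw [Complex.smul_im, smul_eq_mul] at h2
      rw [h2]
      simp [hq]
    have hneg : q - c t = -(c t - q) := by ring
    rw [abs_lt] at ht2
    simp only [hθ]
    rcases lt_trichotomy t t₀ with h | h | h
    · have h3 : (c t - q).im < 0 := by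
        rw [hc1]; exact mul_neg_of_neg_of_pos (by linarith) ht1
      have h4 : ⌈(t - t₀) / (2 * Real.pi)⌉ = 0 := by
        rw [Int.ceil_eq_zero_iff]
        exact ⟨by rw [lt_div_iff₀ Real.two_pi_pos]; linarith,
          div_nonpos_of_nonpos_of_nonneg (by linarith) Real.two_pi_pos.le⟩
      rw [hneg, Complex.arg_neg_eq_arg_add_pi_of_im_neg h3, h4]
      push_cast; ring
    · subst h
      have h5 : c t - q = (r : ℂ) := by simp [hq]
      have h6 : q - c t = -(r : ℂ) := by rw [hneg, h5]
      rw [h5, h6, Complex.arg_ofReal_of_nonneg hr.1.le, ← Complex.ofReal_neg,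
        Complex.arg_ofReal_of_neg (by linarith [hr.1])]
      simp
      ring
    · have h3 : 0 < (c t - q).im := by
        rw [hc1]; exact mul_pos (by linarith) ht1
      have h4 : ⌈(t - t₀) / (2 * Real.pi)⌉ = 1 := by
        rw [Int.ceil_eq_iff]
        push_cast
        refine ⟨?_, ?_⟩
        · rw [sub_self]; exact div_pos (by linarith) Real.two_pi_pos
        · rw [div_le_one Real.two_pi_pos]; linarith
      rw [hneg, Complex.arg_neg_eq_arg_sub_pi_of_im_pos h3, h4]
      push_cast; ring
  have hcont : Continuous θ := by
    rw [continuous_iff_continuousAt]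
    intro t
    by_cases hct : c t = c t₀
    · obtain ⟨k, hk⟩ := hc.exists_eq_add_int_mul hct
      have h1 : ContinuousAt (fun x => θ (x + k * (2 * Real.pi)) - k * (2 * Real.pi)) t := by
        refine ContinuousAt.sub ?_ continuousAt_const
        have h2 : Continuous fun x : ℝ => x + k * (2 * Real.pi) := by fun_prop
        rw [hk] at hθ0
        exact ContinuousAt.comp (f := fun x => x + k * (2 * Real.pi)) hθ0 h2.continuousAt
      refine h1.congr (Eventually.of_forall fun x => ?_)
      simp only [map_add_int_mul_period hper, add_sub_cancel_right]
    · have h1 : q - c t ∈ Complex.slitPlane := by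
        rw [Complex.mem_slitPlane_iff]
        by_contra! hcon
        obtain ⟨h2, h3⟩ := hcon
        have h4 : (c t).re ≤ (c t₀).re := hmax _ (frontier_subset_closure (hc.mem_frontier t))
        rw [Complex.sub_re] at h2
        rw [Complex.sub_im] at h3
        have hqre : q.re = (c t₀).re - r := by simp [hq]
        have hqim : q.im = (c t₀).im := by simp [hq]
        have h5 : c t = c t₀ - ((c t₀).re - (c t).re : ℝ) := by
          apply Complex.ext
          · simp
          · simp; linarith
        rcases h4.eq_or_lt with h6 | h6
        · apply hct
          rw [h5, h6]; simp
        · refine notMem_of_mem_frontier ho (hc.mem_frontier t) ?_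
          rw [h5]
          exact hr₀ _ ⟨by linarith, by linarith [hr.2]⟩
      have h2 : ∀ k : ℤ, (t - t₀) / (2 * Real.pi) ≠ k := by
        intro k hk
        apply hct
        have : t = t₀ + k * (2 * Real.pi) := by
          rw [div_eq_iff Real.two_pi_pos.ne'] at hk; linarith
        rw [this, hc.add_int_mul]
      have h3 : ContinuousAt (fun x => (q - c x).arg +
          2 * Real.pi * ⌈(t - t₀) / (2 * Real.pi)⌉ + Real.pi) t := by
        refine ContinuousAt.add (ContinuousAt.add ?_ continuousAt_const) continuousAt_const
        exact ContinuousAt.comp (f := fun t => q - c t) (Complex.continuousAt_arg h1)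
          (continuous_const.sub hc.contDiff.continuous).continuousAt
      refine h3.congr ?_
      have h4 : Tendsto (fun x => (x - t₀) / (2 * Real.pi)) (𝓝 t) (𝓝 ((t - t₀) / (2 * Real.pi))) :=
        Continuous.tendsto (by fun_prop) t
      filter_upwards [h4.eventually (ceil_eventually_eq_of_notMem_int h2)] with x hx
      simp only [hθ, hx.1]
  have hγ : ContDiff ℝ 1 fun t => (c t - q) / (‖c t - q‖ : ℂ) := by
    have h1 : ContDiff ℝ 1 fun t => c t - q := (hc.contDiff.of_le (by norm_num)).sub contDiff_const
    have h2 : (fun t => (c t - q) / (‖c t - q‖ : ℂ)) = fun t => ‖c t - q‖⁻¹ • (c t - q) := by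
      ext t
      rw [Complex.real_smul, Complex.ofReal_inv, div_eq_inv_mul]
    rw [h2]
    exact ((h1.norm ℝ hne).inv fun t => (norm_pos_iff.2 (hne t)).ne').smul h1
  exact ⟨θ, contDiff_one_of_exp_mul_I hγ hcont hexp, hper, hexp⟩

/-- Upper bound by a competitor with interior vortices. -/
theorem exists_minEnergy_le_interior (ho : IsOpen Ω) (hb : Bornology.IsBounded Ω)
    (hc : IsPositiveParam Ω c) {g : ℂ → ℂ} (hg1 : ∀ x ∈ frontier Ω, ‖g x‖ = 1) (α : ℝ)
    {n : ℕ} {φ : ℝ → ℝ} (hφ : ContDiff ℝ 1 φ)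
    (hφp : ∀ t, φ (t + 2 * Real.pi) = φ t + 2 * Real.pi * n)
    (h : ∀ t, g (c t) = Complex.exp ((φ t : ℂ) * Complex.I)) :
    ∃ C : ℝ, ∀ s ε : ℝ, 0 < s → s ≤ 1 → 0 < ε → ε < 1 →
      minEnergy Ω g α s ε ≤ ENNReal.ofReal (Real.pi * n * |Real.log ε| + C) := by
  have hf := hc.isFiniteMeasure_arcOn
  obtain ⟨t₀, hmax⟩ := exists_isMaxOn_re ho hb hc
  obtain ⟨r₀, hr₀pos, hr₀⟩ := mem_nhdsGT_iff_exists_Ioo_subset.1 (hc.deriv_of_isMaxOn_re hmax).2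
  have hr₀' : ∀ r ∈ Set.Ioo 0 r₀, c t₀ - r ∈ Ω := fun r hr => hr₀ hr
  replace hr₀pos : 0 < r₀ := hr₀pos
  -- Distinct depths in `(0, r₀)`, so that the `n` centres lie in the domain on one horizontal
  -- segment.
  set ρ : Fin n → ℝ := fun j => r₀ * ((j + 1) / (n + 1)) with hρ
  have hρm : ∀ j, ρ j ∈ Set.Ioo 0 r₀ := by
    intro j
    have h1 : (j : ℝ) < n := by exact_mod_cast j.2
    refine ⟨by positivity, ?_⟩
    have h2 : ((j : ℝ) + 1) / (n + 1) < 1 := by rw [div_lt_one (by positivity)]; linarith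
    nlinarith
  set q : Fin n → ℂ := fun j => c t₀ - ρ j with hq
  have hqinj : Function.Injective q := by
    intro i j hij
    have h1 : ρ i = ρ j := by
      have : (ρ i : ℂ) = ρ j := sub_right_injective hij
      exact_mod_cast this
    have h2 := mul_left_cancel₀ hr₀pos.ne' h1
    rw [div_left_inj' (by positivity)] at h2
    have h3 : (i : ℝ) = j := by linarith
    exact Fin.ext (by exact_mod_cast h3)
  choose θ hθ hθp hθe using fun j => hc.exists_winding ho hmax hr₀' (hρm j)
  -- Each `θ j` gains `2π` per turn and `φ` gains `2π n`, so the difference is periodic. With this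
  -- phase the limiting boundary values are `g exp (iα)`.
  obtain ⟨H, hH, hHc⟩ := hc.exists_contDiff_comp_eq (f := fun t => φ t + α - ∑ j, θ j t)
    ((hφ.add contDiff_const).sub (ContDiff.sum fun j _ => hθ j)) (fun t => by
      simp only [hφp, hθp, Finset.sum_add_distrib, Finset.sum_const, Finset.card_univ,
        Fintype.card_fin, nsmul_eq_mul]
      ring)
  choose M C hM hC hV using fun j => exists_vortexFactor_interior ho hb hf (hr₀' _ (hρm j))
  obtain ⟨C', hC'⟩ := exists_minEnergy_le_of_vortexFactor ho hb hf hg1 α hqinj hH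
    (M := ∑ j, M j) (Finset.sum_nonneg fun j _ => hM j)
  refine ⟨1 / 2 * ∑ j, C j + C', fun s ε hs hs1 hε hε1 => ?_⟩
  refine (hC' s ε hε (fun j => 2 * Real.pi * |Real.log ε| + C j) _ _
    (fun j => add_nonneg (by positivity) (hC j)) (fun j => (hV j s ε hs hs1 hε hε1).mono
      (Finset.single_le_sum (fun j _ => hM j) (Finset.mem_univ j)) hε) ?_).trans_eq ?_
  · refine (ae_restrict_iff' isClosed_frontier.measurableSet).2 (Eventually.of_forall fun x hx => ?_)
    rw [← hc.range_eq] at hx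
    obtain ⟨t, rfl⟩ := hx
    have h1 : Complex.exp (H (c t) * Complex.I) * ∏ j, (c t - (c t₀ - ρ j)) /
        (‖c t - (c t₀ - ρ j)‖ : ℂ) = g (c t) * Complex.exp (α * Complex.I) := by
      rw [Finset.prod_congr rfl fun j _ => hθe j t, ← Complex.exp_sum, ← Complex.exp_add, hHc, h,
        ← Complex.exp_add, ← Finset.sum_mul]
      congr 1
      push_cast
      ring
    rw [h1, mul_right_comm, Complex.mul_conj, Complex.normSq_eq_norm_sq,
      hg1 _ (hc.mem_frontier t), Complex.exp_mul_I]
    simp [← Complex.ofReal_cos, ← Complex.ofReal_sin]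
  · congr 1
    rw [Finset.sum_add_distrib, Finset.sum_const, Finset.card_univ, Fintype.card_fin, nsmul_eq_mul]
    ring

/-! ### The domain near a boundary point and boundary vortices -/

/-- The derivative is Lipschitz near `p`, so on the ball of radius `‖x - p‖` it differs from its
value at `p` by at most `K ‖x - p‖`; the mean value inequality gives one more power. -/
theorem exists_norm_sub_fderiv_le_sq {ρ : ℂ → ℝ} {p : ℂ} (hρ : ContDiffAt ℝ 2 ρ p) :
    ∃ K : ℝ, 0 ≤ K ∧ ∃ r > 0, ∀ x, ‖x - p‖ < r →
      |ρ x - ρ p - fderiv ℝ ρ p (x - p)| ≤ K * ‖x - p‖ ^ 2 := by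
  obtain ⟨K, t, ht, hK⟩ := (hρ.fderiv_right (m := 1) (by norm_num)).exists_lipschitzOnWith
  have hd : ∀ᶠ x in 𝓝 p, DifferentiableAt ℝ ρ x := by
    filter_upwards [hρ.eventually (by simp)] with x hx using hx.differentiableAt (by simp)
  obtain ⟨r, hr, hball⟩ := Metric.mem_nhds_iff.1 (Filter.inter_mem ht hd)
  refine ⟨K, K.2, r, hr, fun x hx => ?_⟩
  have hsub : Metric.closedBall p ‖x - p‖ ⊆ Metric.ball p r := Metric.closedBall_subset_ball hx
  have hp : p ∈ Metric.closedBall p ‖x - p‖ := Metric.mem_closedBall_self (norm_nonneg _)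
  have := (convex_closedBall p ‖x - p‖).norm_image_sub_le_of_norm_fderiv_le' (𝕜 := ℝ) (f := ρ)
    (φ := fderiv ℝ ρ p) (C := K * ‖x - p‖) (fun y hy => (hball (hsub hy)).2) (fun y hy => ?_) hp
    (show x ∈ Metric.closedBall p ‖x - p‖ by rw [Metric.mem_closedBall, dist_eq_norm])
  · rw [Real.norm_eq_abs] at this
    rw [sq, ← mul_assoc]
    exact this
  · have h1 := hK.norm_sub_le (hball (hsub hy)).1 (hball (hsub hp)).1
    refine h1.trans ?_
    rw [Metric.mem_closedBall, dist_eq_norm] at hy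
    gcongr

/-- In coordinates adapted to the inner normal, a `C²` domain lies above a parabola. -/
theorem IsPositiveParam.exists_parabola (ho : IsOpen Ω) (hΩ : HasC2Boundary Ω)
    (hc : IsPositiveParam Ω c) (t₀ : ℝ) :
    ∃ K : ℝ, 0 ≤ K ∧ ∃ R > 0, K * R ≤ 1 / 8 ∧ ∀ x ∈ closure Ω,
      ‖(x - c t₀) / (Complex.I * deriv c t₀)‖ < 2 * R →
      -(K * ‖(x - c t₀) / (Complex.I * deriv c t₀)‖ ^ 2) ≤
        ((x - c t₀) / (Complex.I * deriv c t₀)).re := by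
  set p := c t₀ with hp
  set n := Complex.I * deriv c t₀ with hn
  have hc0 := hc.deriv_ne_zero t₀
  have hn0 : n ≠ 0 := mul_ne_zero Complex.I_ne_zero hc0
  have hpf : p ∈ frontier Ω := hc.mem_frontier t₀
  obtain ⟨ρ, hρ, hdρ, hiff⟩ := hΩ p hpf
  set L := fderiv ℝ ρ p with hL
  have hρd : HasFDerivAt ρ L p := (hρ.differentiableAt (by simp)).hasFDerivAt
  have hnonneg : ∀ᶠ x in 𝓝 p, x ∈ frontier Ω → 0 ≤ ρ x := by
    filter_upwards [hiff] with x hx hxf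
    by_contra! h
    exact notMem_of_mem_frontier ho hxf (hx.2 h)
  have hρp : ρ p = 0 := by
    refine le_antisymm ?_ (hnonneg.self_of_nhds hpf)
    by_contra! h
    have h1 : ∀ᶠ x in 𝓝 p, 0 < ρ x := hρ.continuousAt.eventually_const_lt h
    obtain ⟨x, hxΩ, h2, h3⟩ := ((mem_closure_iff_frequently.1 (frontier_subset_closure hpf)).and_eventually
      (h1.and hiff)).exists
    exact lt_asymm h2 (h3.1 hxΩ)
  have hcd : HasDerivAt c (deriv c t₀) t₀ :=
    (hc.contDiff.differentiable (by simp) t₀).hasDerivAt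
  -- The defining function is nonnegative on the boundary near `p` and zero at `p`, so along the
  -- curve it has a local minimum: its differential annihilates the tangent.
  have hLc : L (deriv c t₀) = 0 := by
    have h1 : HasDerivAt (fun t => ρ (c t)) (L (deriv c t₀)) t₀ := hρd.comp_hasDerivAt t₀ hcd
    refine IsLocalMin.hasDerivAt_eq_zero ?_ h1
    filter_upwards [hcd.continuousAt.eventually hnonneg] with t ht
    rw [← hp, hρp]
    exact ht (hc.mem_frontier t)
  have hLn : L n ≤ 0 := by
    have h1 : HasDerivAt (fun r : ℝ => p + (r : ℂ) * n) n 0 := by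
      have := ((Complex.ofRealCLM.hasDerivAt (x := (0 : ℝ))).mul_const n).const_add p
      simpa using! this
    have h2 : HasDerivAt (fun r : ℝ => ρ (p + (r : ℂ) * n)) (L n) 0 := by
      refine HasFDerivAt.comp_hasDerivAt (0 : ℝ) ?_ h1
      simpa using hρd
    have h3 := (hasDerivAt_iff_tendsto_slope.1 h2).mono_left
      (nhdsWithin_mono (0 : ℝ) (show Set.Ioi (0 : ℝ) ⊆ {0}ᶜ from fun x hx => ne_of_gt hx))
    refine le_of_tendsto h3 ?_
    have h4 : ∀ᶠ r : ℝ in 𝓝[>] 0, (p + (r : ℂ) * n ∈ Ω ↔ ρ (p + (r : ℂ) * n) < 0) := by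
      have : Tendsto (fun r : ℝ => p + (r : ℂ) * n) (𝓝[>] 0) (𝓝 p) := by
        have h5 := h1.continuousAt.tendsto
        simp only [Complex.ofReal_zero, zero_mul, add_zero] at h5
        exact h5.mono_left nhdsWithin_le_nhds
      exact this.eventually hiff
    filter_upwards [hc.left t₀, h4, self_mem_nhdsWithin] with r hr1 hr2 hr3
    have hr0 : 0 < r := hr3
    have h5 := hr2.1 hr1
    rw [slope_def_field]
    simp only [Complex.ofReal_zero, zero_mul, add_zero, hρp, sub_zero]
    exact div_nonpos_of_nonpos_of_nonneg h5.le hr0.le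
  -- Since `n = i c'(t₀)`, one has `w n = (Re w) n - (Im w) c'(t₀)`, and the tangential part is
  -- annihilated. Taylor's formula and `ρ < 0` thus bound the real part of `(x - p) / n` from below.
  have hdec : ∀ w : ℂ, L (w * n) = w.re * L n := by
    intro w
    have : w * n = w.re • n + (-w.im) • deriv c t₀ := by
      rw [Complex.real_smul, Complex.real_smul, hn]
      nth_rewrite 1 [← Complex.re_add_im w]
      push_cast
      linear_combination (w.im * deriv c t₀ : ℂ) * Complex.I_mul_I
    rw [this, map_add, map_smul, map_smul, hLc, smul_zero, add_zero, smul_eq_mul]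
  have hLn0 : L n ≠ 0 := by
    intro h
    apply hdρ
    ext w
    have := hdec (w / n)
    rw [div_mul_cancel₀ _ hn0, h, mul_zero] at this
    simpa using this
  have hLn' : 0 < -L n := by
    rcases hLn.lt_or_eq with h | h
    · linarith
    · exact absurd h hLn0
  obtain ⟨K, hK0, r, hr, hK⟩ := exists_norm_sub_fderiv_le_sq hρ
  obtain ⟨r', hr', hball⟩ := Metric.mem_nhds_iff.1 hiff
  set K' := K * ‖n‖ ^ 2 / (-L n) with hK'
  have hK'0 : 0 ≤ K' := by positivity
  have hnn : 0 < ‖n‖ := norm_pos_iff.2 hn0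
  set m := min r r' with hm
  have hm0 : 0 < m := lt_min hr hr'
  have hgood : ∀ x ∈ Ω, ‖x - p‖ < m → -(K' * ‖(x - p) / n‖ ^ 2) ≤ ((x - p) / n).re := by
    intro x hx hxm
    have h1 := hK x (hxm.trans_le (min_le_left _ _))
    have h2 : ρ x < 0 := (hball (show x ∈ Metric.ball p r' by
      rw [Metric.mem_ball, dist_eq_norm]; exact hxm.trans_le (min_le_right _ _))).1 hx
    have h3 := hdec ((x - p) / n)
    rw [div_mul_cancel₀ _ hn0] at h3
    rw [← hL, hρp, sub_zero, h3] at h1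
    have h4 := neg_le_of_abs_le h1
    rw [norm_div, hK', div_pow]
    have h5 : K * ‖n‖ ^ 2 / (-L n) * (‖x - p‖ ^ 2 / ‖n‖ ^ 2) = K * ‖x - p‖ ^ 2 / (-L n) := by
      field_simp
    rw [h5, neg_le, le_div_iff₀ hLn']
    linarith
  have hgood' : ∀ x ∈ closure Ω, ‖x - p‖ < m → -(K' * ‖(x - p) / n‖ ^ 2) ≤ ((x - p) / n).re := by
    intro x hx hxm
    have h1 : x ∈ closure (Ω ∩ Metric.ball p m) := by
      have : x ∈ closure Ω ∩ Metric.ball p m := ⟨hx, by rwa [Metric.mem_ball, dist_eq_norm]⟩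
      exact Metric.isOpen_ball.closure_inter this
    have h2 : IsClosed {x : ℂ | -(K' * ‖(x - p) / n‖ ^ 2) ≤ ((x - p) / n).re} :=
      isClosed_le (by fun_prop) (Complex.continuous_re.comp (by fun_prop))
    exact closure_minimal (fun y hy => hgood y hy.1 (by
      have := hy.2; rwa [Metric.mem_ball, dist_eq_norm] at this)) h2 h1
  -- The first radius makes `2R` fit in the neighbourhood where the Taylor estimate holds, the
  -- second gives `K' R ≤ 1/8`. The factor `2` leaves room between the support of the cutoff and the
  -- limit of the estimate.
  refine ⟨K', hK'0, min (m / (2 * ‖n‖)) (1 / (8 * (K' + 1))), by positivity, ?_, fun x hx hxR => ?_⟩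
  · calc K' * min (m / (2 * ‖n‖)) (1 / (8 * (K' + 1))) ≤ K' * (1 / (8 * (K' + 1))) := by
          gcongr; exact min_le_right _ _
      _ ≤ 1 / 8 := by
          rw [mul_one_div, div_le_div_iff₀ (by positivity) (by norm_num)]; linarith
  · refine hgood' x hx ?_
    have h1 : ‖(x - p) / n‖ < 2 * (m / (2 * ‖n‖)) :=
      hxR.trans_le (by gcongr; exact min_le_left _ _)
    rw [norm_div, div_lt_iff₀ hnn] at h1
    calc ‖x - p‖ < 2 * (m / (2 * ‖n‖)) * ‖n‖ := h1
      _ = m := by field_simp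

theorem lintegral_comp_sub_div {n : ℂ} (hn : n ≠ 0) (p : ℂ) {F : ℂ → ℝ≥0∞} (hF : Measurable F) :
    ∫⁻ x, F ((x - p) / n) = ENNReal.ofReal (‖n‖ ^ 2) * ∫⁻ z, F z := by
  rw [lintegral_sub_right_eq_self (fun x => F (x / n))]
  have hdet : LinearMap.det (LinearMap.mulLeft ℝ n⁻¹) = (‖n‖ ^ 2)⁻¹ := by
    have h1 := Algebra.norm_apply ℝ (n⁻¹ : ℂ)
    rw [Algebra.norm_complex_apply, Complex.normSq_inv, Complex.normSq_eq_norm_sq] at h1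
    exact h1.symm
  have hnn : 0 < ‖n‖ := norm_pos_iff.2 hn
  have hmap := Measure.map_linearMap_addHaar_eq_smul_addHaar (volume : Measure ℂ)
    (f := LinearMap.mulLeft ℝ n⁻¹) (by rw [hdet]; positivity)
  rw [hdet, inv_inv, abs_of_nonneg (by positivity)] at hmap
  rw [← smul_eq_mul, ← lintegral_smul_measure, ← hmap, lintegral_map hF]
  · simp [div_eq_inv_mul]
  · exact (LinearMap.continuous_of_finiteDimensional _).measurable

/-- On the negative real axis the real part is `-‖z‖`, which the sector excludes; moving right by
`δ` cannot reach the cut, except possibly at its end point. -/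
theorem mem_slitPlane_of_sector {z : ℂ} (hz : -(‖z‖ / 4) ≤ z.re) {δ : ℝ} (hδ : 0 ≤ δ)
    (h0 : z + δ ≠ 0) : z + δ ∈ Complex.slitPlane := by
  rw [Complex.mem_slitPlane_iff]
  by_contra! h
  obtain ⟨h1, h2⟩ := h
  simp only [Complex.add_re, Complex.ofReal_re, Complex.add_im, Complex.ofReal_im, add_zero] at h1 h2
  have h3 : ‖z‖ = |z.re| := by
    rw [Complex.norm_def, Complex.normSq_apply, h2, mul_zero, add_zero, Real.sqrt_mul_self_eq_abs]
  rw [h3, abs_of_nonpos (by linarith)] at hz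
  have h4 : z.re = 0 := by linarith
  have h5 : δ = 0 := by linarith
  apply h0
  rw [h5]
  apply Complex.ext <;> simp [h4, h2]

/-- The cross term satisfies `2 δ Re z ≥ -δ ‖z‖ / 2 ≥ -(‖z‖² + δ²) / 4`. -/
theorem le_norm_add_sq_of_sector {z : ℂ} (hz : -(‖z‖ / 4) ≤ z.re) {δ : ℝ} (hδ : 0 ≤ δ) :
    3 / 4 * (‖z‖ ^ 2 + δ ^ 2) ≤ ‖z + δ‖ ^ 2 := by
  rw [norm_add_ofReal_sq]
  nlinarith [mul_le_mul_of_nonneg_left hz hδ, sq_nonneg (‖z‖ - δ)]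

/-- Along the segment from `z` to `z + δ` the argument has derivative `Im (1 / (z + τ))`, and the
sector keeps the segment at distance at least `‖z‖ / 2` from the origin. -/
theorem abs_arg_add_sub_arg_le {z : ℂ} (hz : -(‖z‖ / 4) ≤ z.re) (h0 : z ≠ 0) {δ : ℝ}
    (hδ : 0 ≤ δ) : |(z + δ).arg - z.arg| ≤ 2 / ‖z‖ * δ := by
  have hz0 : 0 < ‖z‖ := norm_pos_iff.2 h0
  have hne : ∀ τ : ℝ, 0 ≤ τ → z + τ ≠ 0 := by
    intro τ hτ h
    have := le_norm_add_sq_of_sector hz hτ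
    rw [h, norm_zero] at this
    nlinarith [sq_nonneg τ]
  have hd : ∀ τ : ℝ, 0 ≤ τ → HasDerivAt (fun τ : ℝ => (z + τ).arg) (1 / (z + τ)).im τ := by
    intro τ hτ
    have h1 : HasDerivAt (fun τ : ℝ => z + (τ : ℂ)) 1 τ := by
      simpa using! (Complex.ofRealCLM.hasDerivAt (x := τ)).const_add z
    have h2 := h1.clog_real (mem_slitPlane_of_sector hz hτ (hne τ hτ))
    have h3 : HasDerivAt (fun τ : ℝ => (Complex.log (z + τ)).im) (1 / (z + τ)).im τ :=
      Complex.imCLM.hasFDerivAt.comp_hasDerivAt τ h2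
    simpa only [Complex.log_im] using h3
  have hb : ∀ τ : ℝ, 0 ≤ τ → ‖(1 / (z + τ)).im‖ ≤ 2 / ‖z‖ := by
    intro τ hτ
    refine (Complex.abs_im_le_norm _).trans ?_
    rw [norm_div, norm_one]
    have h1 := le_norm_add_sq_of_sector hz hτ
    have h2 : ‖z‖ / 2 ≤ ‖z + τ‖ := by
      refine le_of_sq_le_sq ?_ (norm_nonneg _) 
      nlinarith [sq_nonneg τ]
    rw [div_le_div_iff₀ (norm_pos_iff.2 (hne τ hτ)) hz0]
    linarith
  have := (convex_Icc (0 : ℝ) δ).norm_image_sub_le_of_norm_hasDerivWithin_le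
    (f := fun τ : ℝ => (z + τ).arg) (fun τ hτ => (hd τ hτ.1).hasDerivWithinAt)
    (fun τ hτ => hb τ hτ.1) (Set.left_mem_Icc.2 hδ) (Set.right_mem_Icc.2 hδ)
  simpa [abs_of_nonneg hδ] using this

theorem sq_arg_add_sub_arg_le {z : ℂ} (hz : -(‖z‖ / 4) ≤ z.re) {δ : ℝ} (hδ : 0 < δ) :
    ((z + δ).arg - z.arg) ^ 2 ≤ 8 * Real.pi ^ 2 * (δ ^ 2 / (‖z‖ ^ 2 + δ ^ 2)) := by
  have hpi := Real.pi_gt_three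
  -- For `‖z‖ ≤ δ` the trivial bound `2π` suffices, as the quotient is at least `1/2`; for `‖z‖ > δ`
  -- the derivative estimate applies.
  rcases le_or_gt ‖z‖ δ with h | h
  · have h1 : |(z + δ).arg - z.arg| ≤ 2 * Real.pi := by
      have h2 := Complex.abs_arg_le_pi (z + δ)
      have h3 := Complex.abs_arg_le_pi z
      exact (abs_sub _ _).trans (by linarith)
    have h4 : 1 / 2 ≤ δ ^ 2 / (‖z‖ ^ 2 + δ ^ 2) := by
      rw [div_le_div_iff₀ (by norm_num) (by positivity)]
      nlinarith [norm_nonneg z]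
    have h5 := sq_le_sq' (neg_le_of_abs_le h1) (le_of_abs_le h1)
    nlinarith [mul_le_mul_of_nonneg_left h4 (by positivity : 0 ≤ 8 * Real.pi ^ 2)]
  · have hz0 : 0 < ‖z‖ := hδ.trans h
    have h1 := abs_arg_add_sub_arg_le hz (norm_pos_iff.1 hz0) hδ.le
    have h5 := sq_le_sq' (neg_le_of_abs_le h1) (le_of_abs_le h1)
    refine h5.trans ?_
    calc (2 / ‖z‖ * δ) ^ 2 = 8 * (δ ^ 2 / (2 * ‖z‖ ^ 2)) := by field_simp; norm_num
      _ ≤ 8 * (δ ^ 2 / (‖z‖ ^ 2 + δ ^ 2)) := by gcongr; nlinarith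
      _ ≤ 8 * Real.pi ^ 2 * (δ ^ 2 / (‖z‖ ^ 2 + δ ^ 2)) := by
        gcongr
        nlinarith

/-- The argument of `(x - p) / n + δ`, cut off at unit distance `χ.rOut` in the rescaled
variable. -/
noncomputable def cutArg (χ : ContDiffBump (0 : ℂ)) (p n : ℂ) (δ : ℝ) (x : ℂ) : ℝ :=
  χ ((x - p) / n) * ((x - p) / n + δ).arg

section CutArg

variable {χ : ContDiffBump (0 : ℂ)} {p n : ℂ} {δ : ℝ} {x : ℂ}

theorem hasFDerivAt_sub_div (p n x : ℂ) :
    HasFDerivAt (fun y : ℂ => (y - p) / n) (n⁻¹ • ContinuousLinearMap.id ℝ ℂ) x := by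
  have := ((hasFDerivAt_id (𝕜 := ℝ) x).sub_const p).const_mul n⁻¹
  simpa [div_eq_inv_mul] using! this

theorem contDiffAt_cutArg_of_lt (hx : χ.rOut < ‖(x - p) / n‖) (δ : ℝ) :
    cutArg χ p n δ =ᶠ[𝓝 x] fun _ => 0 := by
  have hc : Continuous fun y : ℂ => ‖(y - p) / n‖ := by fun_prop
  filter_upwards [hc.continuousAt.eventually_const_lt hx] with y hy
  rw [cutArg, χ.zero_of_le_dist (by rw [dist_zero_right]; exact hy.le), zero_mul]

theorem contDiffAt_cutArg (hx : (x - p) / n + δ ∈ Complex.slitPlane) :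
    ContDiffAt ℝ 1 (cutArg χ p n δ) x := by
  have h1 : ContDiff ℝ 1 fun y : ℂ => (y - p) / n := by fun_prop
  have h2 : ContDiffAt ℝ 1 (fun y : ℂ => Complex.log ((y - p) / n + δ)) x :=
    ContDiffAt.comp (f := fun y : ℂ => (y - p) / n + δ) x
      ((Complex.contDiffAt_log hx).restrict_scalars ℝ) (h1.add contDiff_const).contDiffAt
  have h3 : ContDiffAt ℝ 1 (fun y : ℂ => ((y - p) / n + δ).arg) x := by
    have h4 : ContDiffAt ℝ 1 (fun y : ℂ => (Complex.log ((y - p) / n + δ)).im) x :=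
      Complex.imCLM.contDiff.contDiffAt.comp x h2
    simpa only [Complex.log_im] using h4
  exact (χ.contDiff.comp h1).contDiffAt.mul h3

theorem fderiv_cutArg (hx : (x - p) / n + δ ∈ Complex.slitPlane) (v : ℂ) :
    fderiv ℝ (cutArg χ p n δ) x v = χ ((x - p) / n) * (v / (n * ((x - p) / n + δ))).im +
      ((x - p) / n + δ).arg * fderiv ℝ χ ((x - p) / n) (v / n) := by
  have h1 := hasFDerivAt_sub_div p n x
  have h2 : HasFDerivAt (fun y : ℂ => Complex.log ((y - p) / n + δ)) _ x :=
    HasFDerivAt.comp (f := fun y : ℂ => (y - p) / n + δ) x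
      ((Complex.hasStrictDerivAt_log hx).hasDerivAt.hasFDerivAt.restrictScalars ℝ)
      (h1.add_const (δ : ℂ))
  have h6 : HasFDerivAt (fun y : ℂ => (Complex.log ((y - p) / n + δ)).im) _ x :=
    Complex.imCLM.hasFDerivAt.comp x h2
  have h3 := h6
  simp only [Complex.log_im] at h3
  have h4 : HasFDerivAt (fun y : ℂ => χ ((y - p) / n)) _ x :=
    HasFDerivAt.comp (g := (χ : ℂ → ℝ)) (f := fun y : ℂ => (y - p) / n) x
      ((χ.contDiff (n := 1)).differentiable (by simp) ((x - p) / n)).hasFDerivAt h1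
  have h5 : HasFDerivAt (cutArg χ p n δ) _ x := h4.mul h3
  rw [h5.fderiv]
  simp [div_eq_mul_inv, mul_comm, mul_assoc]

end CutArg

theorem norm_exp_mul_I_sub_le (x y : ℝ) :
    ‖Complex.exp (x * Complex.I) - Complex.exp (y * Complex.I)‖ ≤ |x - y| := by
  have h1 : Complex.exp (x * Complex.I) - Complex.exp (y * Complex.I) =
      Complex.exp (y * Complex.I) * (Complex.exp (Complex.I * (x - y : ℝ)) - 1) := by
    rw [mul_sub, ← Complex.exp_add, mul_one]
    congr 2
    push_cast; ring
  rw [h1, norm_mul, Complex.norm_exp_ofReal_mul_I, one_mul]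
  exact Real.norm_exp_I_mul_ofReal_sub_one_le

theorem norm_fderiv_exp_mul_I {f : ℂ → ℝ} {x : ℂ} (hf : DifferentiableAt ℝ f x) (v : ℂ) :
    ‖fderiv ℝ (fun y => Complex.exp (f y * Complex.I)) x v‖ = |fderiv ℝ f x v| := by
  have h2 : HasFDerivAt (fun y => (f y : ℂ)) (Complex.ofRealCLM.comp (fderiv ℝ f x)) x :=
    Complex.ofRealCLM.hasFDerivAt.comp x hf.hasFDerivAt
  rw [((h2.mul_const Complex.I).cexp).fderiv]
  simp [Complex.norm_exp_ofReal_mul_I]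

theorem neg_le_re_of_parabola {K R : ℝ} (hK : 0 ≤ K) (hKR : K * R ≤ 1 / 8) {z : ℂ}
    (hz : ‖z‖ < 2 * R) (h : -(K * ‖z‖ ^ 2) ≤ z.re) : -(‖z‖ / 4) ≤ z.re := by
  refine le_trans ?_ h
  have : K * ‖z‖ ≤ 1 / 4 := (mul_le_mul_of_nonneg_left hz.le hK).trans (by linarith)
  nlinarith [norm_nonneg z]

/-- Boundary vortices: `exp (i a θ)`, where `θ` is the argument about a point at distance of order
`ε ^ s` outside of the domain. -/
theorem IsPositiveParam.exists_vortexFactor_boundary (hc : IsPositiveParam Ω c)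
    (ho : IsOpen Ω) {t₀ : ℝ} {K R : ℝ} (hK : 0 ≤ K) (hR : 0 < R) (hKR : K * R ≤ 1 / 8)
    (hpar : ∀ x ∈ closure Ω, ‖(x - c t₀) / (Complex.I * deriv c t₀)‖ < 2 * R →
      -(K * ‖(x - c t₀) / (Complex.I * deriv c t₀)‖ ^ 2) ≤
        ((x - c t₀) / (Complex.I * deriv c t₀)).re)
    {χ : ContDiffBump (0 : ℂ)} (hχ : χ.rOut = R) {a : ℝ} (ha : 0 ≤ a) :
    ∃ M C : ℝ, 0 ≤ M ∧ 0 ≤ C ∧ ∀ s ε : ℝ, 0 < s → 0 < ε → ε < 1 →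
      VortexFactor Ω (c t₀) M (a ^ 2 * (Real.pi * (s * |Real.log ε|) + C)) s ε
        (fun x => Complex.exp ((a * cutArg χ (c t₀) (Complex.I * deriv c t₀) (ε ^ s) x : ℝ) *
          Complex.I))
        (fun x => Complex.exp ((a * cutArg χ (c t₀) (Complex.I * deriv c t₀) 0 x : ℝ) *
          Complex.I)) := by
  set p := c t₀ with hp
  set n := Complex.I * deriv c t₀ with hn
  have hn0 : n ≠ 0 := mul_ne_zero Complex.I_ne_zero (hc.deriv_ne_zero t₀)
  have hnn : 0 < ‖n‖ := norm_pos_iff.2 hn0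
  obtain ⟨B, hB⟩ := (χ.hasCompactSupport.fderiv (𝕜 := ℝ)).exists_bound_of_continuous
    ((χ.contDiff (n := 1)).continuous_fderiv (by simp))
  have hB0 : 0 ≤ B := (norm_nonneg _).trans (hB 0)
  obtain ⟨k, hk, hchord⟩ := hc.exists_chordArc t₀
  obtain ⟨Ka, hKa⟩ := hc.exists_lintegral_arcOn_le
  have hpi := Real.pi_pos
  -- The summands bound the gradient of the cutoff times the argument, the pole `2 a / ‖x - p‖` of
  -- the remaining gradient, and the boundary error divided by `δ`.
  set M : ℝ := a * (Real.pi * (B / ‖n‖)) + 2 * a +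
    Ka * (a ^ 2 * (8 * Real.pi ^ 2) * (Real.pi / (k / ‖n‖))) with hM
  have hlog : 0 ≤ Real.log (R ^ 2 + 1) := Real.log_nonneg (by nlinarith)
  refine ⟨M, Real.pi / 2 * Real.log (R ^ 2 + 1) + 8 * K * R, by positivity, by positivity, ?_⟩
  intro s ε hs hε hε1
  set δ : ℝ := ε ^ s with hδ
  have hδ0 : 0 < δ := Real.rpow_pos_of_pos hε s
  have hδ1 : δ ≤ 1 := Real.rpow_le_one hε.le hε1.le hs.le
  have hM1 : a * (Real.pi * (B / ‖n‖)) ≤ M := by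
    have : 0 ≤ 2 * a + Ka * (a ^ 2 * (8 * Real.pi ^ 2) * (Real.pi / (k / ‖n‖))) := by positivity
    linarith
  have hM2 : 2 * a ≤ M := by
    have h1 : 0 ≤ a * (Real.pi * (B / ‖n‖)) := by positivity
    have h2 : 0 ≤ Ka * (a ^ 2 * (8 * Real.pi ^ 2) * (Real.pi / (k / ‖n‖))) := by positivity
    linarith
  have hM3 : Ka * (a ^ 2 * (8 * Real.pi ^ 2) * (Real.pi / (k / ‖n‖))) ≤ M := by
    have h1 : 0 ≤ a * (Real.pi * (B / ‖n‖)) := by positivity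
    linarith
  have hM0 : 0 ≤ M := by positivity
  have hsec : ∀ x ∈ closure Ω, ‖(x - p) / n‖ < 2 * R → -(‖(x - p) / n‖ / 4) ≤ ((x - p) / n).re :=
    fun x hx hxR => neg_le_re_of_parabola hK hKR hxR (hpar x hx hxR)
  have hslit : ∀ x ∈ closure Ω, ‖(x - p) / n‖ < 2 * R → (x - p) / n + δ ∈ Complex.slitPlane := by
    intro x hx hxR
    refine mem_slitPlane_of_sector (hsec x hx hxR) hδ0.le fun h => ?_
    have h1 := le_norm_add_sq_of_sector (hsec x hx hxR) hδ0.le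
    rw [h, norm_zero] at h1
    nlinarith [sq_nonneg ‖(x - p) / n‖]
  have hcd : ∀ x ∈ closure Ω, ContDiffAt ℝ 1 (cutArg χ p n δ) x := by
    intro x hx
    rcases lt_or_ge ‖(x - p) / n‖ (2 * R) with h | h
    · exact contDiffAt_cutArg (hslit x hx h)
    · exact contDiffAt_const.congr_of_eventuallyEq
        (contDiffAt_cutArg_of_lt (by rw [hχ]; linarith) δ)
  have hnorm : ∀ x (δ : ℝ), ‖Complex.exp ((a * cutArg χ p n δ x : ℝ) * Complex.I)‖ = 1 :=
    fun x δ => Complex.norm_exp_ofReal_mul_I _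
  have hms : MeasurableSet {x : ℂ | ‖(x - p) / n‖ < R} :=
    measurableSet_lt (by fun_prop) measurable_const
  refine ⟨fun x hx => ?_, fun x _ => (hnorm x δ).le, fun x _ => hnorm x 0, ?_, ?_, ?_⟩
  · exact ((Complex.ofRealCLM.contDiff.contDiffAt.comp x (contDiffAt_const.mul (hcd x hx))).mul
      contDiffAt_const).cexp
  -- The singular part of the gradient is that of the argument alone, with the cutoff replaced by
  -- the indicator of the disc of radius `R`; the derivative of the cutoff is bounded and goes into
  -- `M`.
  · set b : ℂ → ℂ → ℝ := fun v => {x : ℂ | ‖(x - p) / n‖ < R}.indicator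
      fun x => a * |(v / (n * ((x - p) / n + δ))).im| with hb
    refine ⟨b, fun v => ?_, fun v x => ?_, fun v hv x hx hxp => ?_, ?_⟩
    · refine Measurable.indicator (measurable_const.mul ?_) hms
      exact (Complex.measurable_im.comp (by fun_prop)).abs
    · exact Set.indicator_nonneg (fun x _ => by positivity) x
    · have hxc := subset_closure hx
      have hfd : fderiv ℝ (fun x => a * cutArg χ p n δ x) x v =
          a * fderiv ℝ (cutArg χ p n δ) x v := by
        rw [fderiv_const_mul ((hcd x hxc).differentiableAt (by simp))]; rfl
      rw [norm_fderiv_exp_mul_I (((hcd x hxc).differentiableAt (by simp)).const_mul a), hfd,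
        abs_mul, abs_of_nonneg ha]
      have hxp' : 0 < ‖x - p‖ := norm_pos_iff.2 (sub_ne_zero.2 hxp)
      rcases lt_or_ge ‖(x - p) / n‖ (2 * R) with h | h
      · have hz := hslit x hxc h
        rw [fderiv_cutArg hz]
        have h1 : |((x - p) / n + δ).arg * fderiv ℝ χ ((x - p) / n) (v / n)| ≤
            Real.pi * (B / ‖n‖) := by
          rw [abs_mul]
          refine mul_le_mul (Complex.abs_arg_le_pi _) ?_ (abs_nonneg _) hpi.le
          have h2 := (fderiv ℝ χ ((x - p) / n)).le_opNorm (v / n)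
          rw [norm_div, hv] at h2
          refine h2.trans ?_
          rw [mul_one_div]
          gcongr
          exact hB _
        by_cases hR' : ‖(x - p) / n‖ < R
        · have hbx : b v x = a * |(v / (n * ((x - p) / n + δ))).im| :=
            Set.indicator_of_mem (s := {x : ℂ | ‖(x - p) / n‖ < R}) hR' _
          rw [hbx]
          constructor
          · have h3 : |χ ((x - p) / n) * (v / (n * ((x - p) / n + δ))).im| ≤
                |(v / (n * ((x - p) / n + δ))).im| := by
              rw [abs_mul, abs_of_nonneg χ.nonneg]
              exact mul_le_of_le_one_left (abs_nonneg _) χ.le_one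
            calc _ ≤ a * (|(v / (n * ((x - p) / n + δ))).im| + Real.pi * (B / ‖n‖)) := by
                  gcongr
                  exact (abs_add_le _ _).trans (add_le_add h3 h1)
              _ ≤ _ := by linarith
          · have h4 := le_norm_add_sq_of_sector (hsec x hxc h) hδ0.le
            have h5 : ‖(x - p) / n‖ / 2 ≤ ‖(x - p) / n + δ‖ :=
              le_of_sq_le_sq (by nlinarith [sq_nonneg δ, sq_nonneg ‖(x - p) / n‖]) (norm_nonneg _)
            have h6 : ‖x - p‖ / 2 ≤ ‖n‖ * ‖(x - p) / n + δ‖ := by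
              rw [norm_div, div_right_comm, div_le_iff₀ hnn] at h5
              linarith
            calc a * |(v / (n * ((x - p) / n + δ))).im| ≤ a * (1 / (‖n‖ * ‖(x - p) / n + δ‖)) := by
                  gcongr
                  refine (Complex.abs_im_le_norm _).trans ?_
                  rw [norm_div, hv, norm_mul]
              _ ≤ a * (1 / (‖x - p‖ / 2)) := by gcongr
              _ = 2 * a * (1 / ‖x - p‖) := by field_simp
              _ ≤ M * (1 / ‖x - p‖) := by gcongr
        · have hbx : b v x = 0 :=
            Set.indicator_of_notMem (s := {x : ℂ | ‖(x - p) / n‖ < R}) hR' _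
          rw [hbx, χ.zero_of_le_dist (by rw [dist_zero_right, hχ]; exact not_lt.1 hR'), zero_mul,
            zero_add, zero_add]
          exact ⟨(mul_le_mul_of_nonneg_left h1 ha).trans hM1, by positivity⟩
      · have hbx : b v x = 0 := Set.indicator_of_notMem (s := {x : ℂ | ‖(x - p) / n‖ < R})
          (fun h' : ‖(x - p) / n‖ < R => by linarith) _
        rw [hbx, (contDiffAt_cutArg_of_lt (by rw [hχ]; linarith) δ).fderiv_eq]
        simp only [fderiv_fun_const, Pi.zero_apply, _root_.zero_apply, abs_zero, mul_zero,
          zero_add]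
        exact ⟨hM0, by positivity⟩
    · set F : ℂ → ℝ≥0∞ := {z : ℂ | ‖z‖ < R ∧ -(K * ‖z‖ ^ 2) ≤ z.re}.indicator
        fun z => ENNReal.ofReal (1 / ‖z + δ‖ ^ 2) with hF
      have hmS : MeasurableSet {z : ℂ | ‖z‖ < R ∧ -(K * ‖z‖ ^ 2) ≤ z.re} := by
        have h1 : MeasurableSet {z : ℂ | ‖z‖ < R} := measurableSet_lt (by fun_prop) measurable_const
        have h2 : MeasurableSet {z : ℂ | -(K * ‖z‖ ^ 2) ≤ z.re} :=
          measurableSet_le (by fun_prop) Complex.measurable_re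
        exact h1.inter h2
      have hFm : Measurable F := Measurable.indicator (by fun_prop) hmS
      have hpt : ∀ x ∈ Ω, ENNReal.ofReal (b 1 x ^ 2 + b Complex.I x ^ 2) ≤
          ENNReal.ofReal (a ^ 2 / ‖n‖ ^ 2) * F ((x - p) / n) := by
        intro x hx
        by_cases hR' : ‖(x - p) / n‖ < R
        · have hbx : ∀ v, b v x = a * |(v / (n * ((x - p) / n + δ))).im| := fun v =>
            Set.indicator_of_mem (s := {x : ℂ | ‖(x - p) / n‖ < R}) hR' _
          have hFx : F ((x - p) / n) = ENNReal.ofReal (1 / ‖(x - p) / n + δ‖ ^ 2) :=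
            Set.indicator_of_mem (show (x - p) / n ∈ {z : ℂ | ‖z‖ < R ∧ -(K * ‖z‖ ^ 2) ≤ z.re} from
              ⟨hR', hpar x (subset_closure hx) (by linarith)⟩) _
          rw [hbx, hbx, hFx, ← ENNReal.ofReal_mul (by positivity)]
          refine ENNReal.ofReal_le_ofReal (le_of_eq ?_)
          rw [mul_pow, mul_pow, sq_abs, sq_abs]
          -- Two orthogonal directions pick out the imaginary and the real part of `1 / w`, so the
          -- squared gradient of the argument is `1 / |w|²`.
          have h1 : ∀ w : ℂ, ((1 / w).im) ^ 2 + ((Complex.I / w).im) ^ 2 = 1 / ‖w‖ ^ 2 := by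
            intro w
            have h2 : Complex.I / w = Complex.I * (1 / w) := by ring
            have h3 : Complex.normSq (1 / w) = 1 / ‖w‖ ^ 2 := by
              rw [Complex.normSq_eq_norm_sq, norm_div, norm_one, div_pow, one_pow]
            rw [h2, Complex.I_mul_im, ← h3, Complex.normSq_apply]
            ring
          rw [← mul_add, h1, norm_mul, mul_pow]
          field_simp
        · have hbx : ∀ v, b v x = 0 := fun v =>
            Set.indicator_of_notMem (s := {x : ℂ | ‖(x - p) / n‖ < R}) hR' _
          rw [hbx, hbx]
          simp
      calc _ ≤ ∫⁻ x in Ω, ENNReal.ofReal (a ^ 2 / ‖n‖ ^ 2) * F ((x - p) / n) :=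
            setLIntegral_mono' ho.measurableSet hpt
        _ ≤ ∫⁻ x, ENNReal.ofReal (a ^ 2 / ‖n‖ ^ 2) * F ((x - p) / n) :=
            setLIntegral_le_lintegral _ _
        _ = ENNReal.ofReal (a ^ 2 / ‖n‖ ^ 2) * (ENNReal.ofReal (‖n‖ ^ 2) * ∫⁻ z, F z) := by
            rw [lintegral_const_mul _ (by fun_prop), lintegral_comp_sub_div hn0 p hFm]
        _ = ENNReal.ofReal (a ^ 2) * ∫⁻ z, F z := by
            rw [← mul_assoc, ← ENNReal.ofReal_mul (by positivity), div_mul_cancel₀ _ (by positivity)]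
        _ ≤ _ := by
            have hls : |Real.log δ| = s * |Real.log ε| := by
              rw [hδ, Real.log_rpow hε, abs_mul, abs_of_pos hs]
            rw [ENNReal.ofReal_mul (sq_nonneg a), hF, lintegral_indicator hmS, ← hls]
            gcongr
            exact lintegral_half_disc_le hK hR hKR hδ0 hδ1
  -- The factor is unimodular, so its potential vanishes.
  · refine ⟨fun _ => 0, measurable_const, fun x _ => ?_, by simp⟩
    rw [hnorm]
    simp
  · refine ⟨fun x => a ^ 2 * (8 * Real.pi ^ 2) * (δ ^ 2 / (‖(x - p) / n‖ ^ 2 + δ ^ 2)),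
      by fun_prop, fun x hx => ?_, ?_⟩
    · have h1 := norm_exp_mul_I_sub_le (a * cutArg χ p n δ x) (a * cutArg χ p n 0 x)
      rw [← mul_sub, abs_mul, abs_of_nonneg ha] at h1
      refine (pow_le_pow_left₀ (norm_nonneg _) h1 2).trans ?_
      rw [mul_pow, sq_abs]
      simp only [mul_assoc (a ^ 2)]
      gcongr
      rcases lt_or_ge ‖(x - p) / n‖ (2 * R) with h | h
      · have h2 := sq_arg_add_sub_arg_le (hsec x (frontier_subset_closure hx) h) hδ0
        rw [cutArg, cutArg, Complex.ofReal_zero, add_zero, ← mul_sub, mul_pow]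
        exact (mul_le_of_le_one_left (sq_nonneg _) (pow_le_one₀ χ.nonneg χ.le_one)).trans h2
      · rw [(contDiffAt_cutArg_of_lt (by rw [hχ]; linarith) δ).eq_of_nhds,
          (contDiffAt_cutArg_of_lt (by rw [hχ]; linarith) 0).eq_of_nhds]
        rw [sub_self, zero_pow two_ne_zero]
        positivity
    -- On the period centred at `t₀` the chord-arc bound replaces distance by parameter difference.
    -- The resulting Lorentzian has integral proportional to `δ = ε ^ s`.
    · refine (hKa (t₀ - Real.pi) _ (by fun_prop)).trans ?_
      have hA0 : 0 ≤ a ^ 2 * (8 * Real.pi ^ 2) := by positivity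
      have h1 : ∀ t ∈ Set.Ioc (t₀ - Real.pi) (t₀ - Real.pi + 2 * Real.pi),
          ENNReal.ofReal (a ^ 2 * (8 * Real.pi ^ 2) *
            (δ ^ 2 / (‖(c t - p) / n‖ ^ 2 + δ ^ 2))) ≤ ENNReal.ofReal (a ^ 2 * (8 * Real.pi ^ 2)) *
          ENNReal.ofReal (δ ^ 2 / ((k / ‖n‖ * |t - t₀|) ^ 2 + δ ^ 2)) := by
        intro t ht
        rw [← ENNReal.ofReal_mul hA0]
        refine ENNReal.ofReal_le_ofReal ?_
        gcongr
        rw [norm_div, div_mul_eq_mul_div]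
        gcongr
        exact hchord t ⟨ht.1.le, by linarith [ht.2]⟩
      calc _ ≤ (Ka : ℝ≥0∞) * ∫⁻ t in Set.Ioc (t₀ - Real.pi) (t₀ - Real.pi + 2 * Real.pi),
            ENNReal.ofReal (a ^ 2 * (8 * Real.pi ^ 2)) *
              ENNReal.ofReal (δ ^ 2 / ((k / ‖n‖ * |t - t₀|) ^ 2 + δ ^ 2)) := by
            exact mul_le_mul' le_rfl (setLIntegral_mono' measurableSet_Ioc h1)
        _ ≤ (Ka : ℝ≥0∞) * (ENNReal.ofReal (a ^ 2 * (8 * Real.pi ^ 2)) *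
            ENNReal.ofReal (Real.pi / (k / ‖n‖) * δ)) := by
            rw [lintegral_const_mul _ (by fun_prop)]
            gcongr
            exact lintegral_lorentzian_le (by positivity) hδ0 t₀ _
        _ = ENNReal.ofReal (Ka * (a ^ 2 * (8 * Real.pi ^ 2) * (Real.pi / (k / ‖n‖))) * δ) := by
            rw [← ENNReal.ofReal_coe_nnreal, ← ENNReal.ofReal_mul hA0,
              ← ENNReal.ofReal_mul (by positivity)]
            congr 1
            ring
        _ ≤ _ := ENNReal.ofReal_le_ofReal (by gcongr)

/-! ### Jumps of the phase and the competitor with boundary vortices -/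

/-- The number of times that the point `t₀` (modulo `2π`) has been passed at the time `t`; at the
passages themselves the mean value is taken. -/
noncomputable def jumpCount (t₀ t : ℝ) : ℝ :=
  (⌈(t - t₀) / (2 * Real.pi)⌉ + ⌊(t - t₀) / (2 * Real.pi)⌋ + 1) / 2

theorem jumpCount_add_period (t₀ t : ℝ) :
    jumpCount t₀ (t + 2 * Real.pi) = jumpCount t₀ t + 1 := by
  have : (t + 2 * Real.pi - t₀) / (2 * Real.pi) = (t - t₀) / (2 * Real.pi) + 1 := by
    have := Real.pi_ne_zero
    field_simp
    ring
  rw [jumpCount, jumpCount, this, Int.ceil_add_one, Int.floor_add_one]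
  push_cast
  ring

theorem jumpCount_self (t₀ : ℝ) : jumpCount t₀ t₀ = 1 / 2 := by
  simp [jumpCount]

theorem jumpCount_of_lt {t₀ t : ℝ} (h : t < t₀) (h' : t₀ - t < 2 * Real.pi) :
    jumpCount t₀ t = 0 := by
  have h1 : (t - t₀) / (2 * Real.pi) < 0 := div_neg_of_neg_of_pos (by linarith) Real.two_pi_pos
  have h2 : -1 < (t - t₀) / (2 * Real.pi) := by rw [lt_div_iff₀ Real.two_pi_pos]; linarith
  have h3 : ⌈(t - t₀) / (2 * Real.pi)⌉ = 0 := Int.ceil_eq_zero_iff.2 ⟨h2, h1.le⟩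
  have h4 : ⌊(t - t₀) / (2 * Real.pi)⌋ = -1 := by
    rw [Int.floor_eq_iff]; push_cast; constructor <;> linarith
  rw [jumpCount, h3, h4]
  norm_num

theorem jumpCount_of_gt {t₀ t : ℝ} (h : t₀ < t) (h' : t - t₀ < 2 * Real.pi) :
    jumpCount t₀ t = 1 := by
  have h1 : 0 < (t - t₀) / (2 * Real.pi) := div_pos (by linarith) Real.two_pi_pos
  have h2 : (t - t₀) / (2 * Real.pi) < 1 := by rw [div_lt_one Real.two_pi_pos]; linarith
  have h3 : ⌈(t - t₀) / (2 * Real.pi)⌉ = 1 := by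
    rw [Int.ceil_eq_iff]; push_cast; constructor <;> linarith
  have h4 : ⌊(t - t₀) / (2 * Real.pi)⌋ = 0 := Int.floor_eq_zero_iff.2 ⟨h1.le, h2⟩
  rw [jumpCount, h3, h4]
  norm_num

theorem eventually_jumpCount_eq {t₀ t : ℝ} (h : ∀ k : ℤ, (t - t₀) / (2 * Real.pi) ≠ k) :
    ∀ᶠ x in 𝓝 t, jumpCount t₀ x = jumpCount t₀ t := by
  have h4 : Tendsto (fun x => (x - t₀) / (2 * Real.pi)) (𝓝 t) (𝓝 ((t - t₀) / (2 * Real.pi))) :=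
    Continuous.tendsto (by fun_prop) t
  filter_upwards [h4.eventually (ceil_eventually_eq_of_notMem_int h)] with x hx
  rw [jumpCount, jumpCount, hx.1, hx.2]

theorem arg_neg_I_mul {w : ℂ} (hw : 0 < w.re) : (-Complex.I * w).arg = w.arg - Real.pi / 2 := by
  have hw0 : w ≠ 0 := by rintro rfl; simp at hw
  have h := Complex.abs_arg_lt_pi_div_two_iff.2 (Or.inl hw)
  rw [abs_lt] at h
  rw [Complex.arg_mul (by simp) hw0, Complex.arg_neg_I]
  · ring
  · rw [Complex.arg_neg_I]; constructor <;> linarith [Real.pi_pos]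

theorem arg_I_mul {w : ℂ} (hw : 0 < w.re) : (Complex.I * w).arg = w.arg + Real.pi / 2 := by
  have hw0 : w ≠ 0 := by rintro rfl; simp at hw
  have h := Complex.abs_arg_lt_pi_div_two_iff.2 (Or.inl hw)
  rw [abs_lt] at h
  rw [Complex.arg_mul (by simp) hw0, Complex.arg_I]
  · ring
  · rw [Complex.arg_I]; constructor <;> linarith [Real.pi_pos]

/-- Along the boundary, the argument about a boundary point is of class `C¹` after removing its
jump of `-π`. -/
theorem IsPositiveParam.contDiff_cutArg_add_jumpCount (hc : IsPositiveParam Ω c) {t₀ R : ℝ}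
    (hsec : ∀ x ∈ closure Ω, ‖(x - c t₀) / (Complex.I * deriv c t₀)‖ < 2 * R →
      -(‖(x - c t₀) / (Complex.I * deriv c t₀)‖ / 4) ≤
        ((x - c t₀) / (Complex.I * deriv c t₀)).re) (hR : 0 < R)
    {χ : ContDiffBump (0 : ℂ)} (hχ : χ.rOut = R) :
    ContDiff ℝ 1 (fun t => cutArg χ (c t₀) (Complex.I * deriv c t₀) 0 (c t) +
      Real.pi * jumpCount t₀ t) := by
  set p := c t₀ with hp
  set n := Complex.I * deriv c t₀ with hn
  have hc0 := hc.deriv_ne_zero t₀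
  have hn0 : n ≠ 0 := mul_ne_zero Complex.I_ne_zero hc0
  set f : ℝ → ℝ := fun t => cutArg χ p n 0 (c t) + Real.pi * jumpCount t₀ t with hf
  have hc1 : ContDiff ℝ 1 c := hc.contDiff.of_le (by norm_num)
  have hper : ∀ t, f (t + 2 * Real.pi) = f t + Real.pi := by
    intro t
    simp only [hf, hc.periodic t, jumpCount_add_period]
    ring
  have h0 : ContDiffAt ℝ 1 f t₀ := by
    -- The coordinate of `c t` is `(t - t₀) (-i μ t)` with `μ` of class `C¹` and `μ t₀ = 1`. Its
    -- argument is `arg μ + π/2` before `t₀` and `arg μ - π/2` after, so adding the jump gives `arg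
    -- μ + π/2` on both sides.
    set μ : ℝ → ℂ := fun t => dslope c t₀ t / deriv c t₀ with hμ
    have hμs : ContDiff ℝ 1 μ := (contDiff_one_dslope hc.contDiff t₀).div_const _
    have hμ0 : μ t₀ = 1 := by rw [hμ]; simp only [dslope_same]; exact div_self hc0
    have h1 : ContDiffAt ℝ 1 (fun t => (Complex.log (μ t)).im + Real.pi / 2) t₀ := by
      have h2 : ContDiffAt ℝ 1 (fun t => Complex.log (μ t)) t₀ :=
        ContDiffAt.comp (f := μ) t₀ ((Complex.contDiffAt_log
          (by rw [hμ0]; exact Complex.one_mem_slitPlane)).restrict_scalars ℝ) hμs.contDiffAt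
      exact ContDiffAt.add (Complex.imCLM.contDiff.contDiffAt.comp t₀ h2) contDiffAt_const
    refine h1.congr_of_eventuallyEq ?_
    have hre : ∀ᶠ t in 𝓝 t₀, 0 < (μ t).re := by
      have : ContinuousAt (fun t => (μ t).re) t₀ :=
        (Complex.continuous_re.comp hμs.continuous).continuousAt
      refine this.eventually_const_lt ?_
      show 0 < (μ t₀).re
      rw [hμ0]; simp
    have hnear : ∀ᶠ t in 𝓝 t₀, |t - t₀| < 2 * Real.pi := by
      filter_upwards [Metric.ball_mem_nhds t₀ Real.two_pi_pos] with t ht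
      rwa [Metric.mem_ball, Real.dist_eq] at ht
    have hsmall : ∀ᶠ t in 𝓝 t₀, ‖(c t - p) / n‖ < χ.rIn := by
      have : Continuous fun t => ‖(c t - p) / n‖ := by
        have := hc1.continuous; fun_prop
      refine this.continuousAt.eventually_lt_const ?_
      simp [hp, χ.rIn_pos]
    filter_upwards [hre, hnear, hsmall] with t ht1 ht2 ht3
    have hz : (c t - p) / n = ((t - t₀ : ℝ) : ℂ) * (-Complex.I * μ t) := by
      rw [hp, ← sub_smul_dslope c t₀ t, Complex.real_smul, hn, hμ]
      field_simp
      rw [Complex.I_sq]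
      ring
    have hχ1 : χ ((c t - p) / n) = 1 :=
      χ.one_of_mem_closedBall (by rw [Metric.mem_closedBall, dist_zero_right]; exact ht3.le)
    rw [abs_lt] at ht2
    simp only [hf, cutArg, hχ1, one_mul, Complex.ofReal_zero, add_zero, Complex.log_im]
    rw [hz]
    rcases lt_trichotomy t t₀ with h | h | h
    · have h2 : ((t - t₀ : ℝ) : ℂ) * (-Complex.I * μ t) =
          ((t₀ - t : ℝ) : ℂ) * (Complex.I * μ t) := by push_cast; ring
      rw [h2, Complex.arg_real_mul _ (by linarith), arg_I_mul ht1,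
        jumpCount_of_lt h (by linarith)]
      ring
    -- At the vortex itself `arg 0 = 0` is the mean of the two one-sided values `±π/2`; the value
    -- `1/2` of the jump count matches it.
    · subst h
      rw [jumpCount_self, hμ0]
      simp
      ring
    · rw [Complex.arg_real_mul _ (by linarith), arg_neg_I_mul ht1,
        jumpCount_of_gt h (by linarith)]
      ring
  rw [contDiff_iff_contDiffAt]
  intro t
  by_cases hct : c t = c t₀
  · obtain ⟨k, hk⟩ := hc.exists_eq_add_int_mul hct
    rw [hk] at h0
    have h2 : ContDiff ℝ 1 fun x : ℝ => x + k * (2 * Real.pi) := by fun_prop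
    have h1 : ContDiffAt ℝ 1 (fun x => f (x + k * (2 * Real.pi)) - k * Real.pi) t :=
      (ContDiffAt.comp (f := fun x : ℝ => x + k * (2 * Real.pi)) t h0 h2.contDiffAt).sub
        contDiffAt_const
    refine h1.congr_of_eventuallyEq (Eventually.of_forall fun x => ?_)
    simp only [map_add_int_mul_period hper, add_sub_cancel_right]
  · have h2 : ∀ k : ℤ, (t - t₀) / (2 * Real.pi) ≠ k := by
      intro k hk
      apply hct
      have : t = t₀ + k * (2 * Real.pi) := by
        rw [div_eq_iff Real.two_pi_pos.ne'] at hk; linarith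
      rw [this, hc.add_int_mul]
    have h3 : ContDiffAt ℝ 1 (cutArg χ p n 0) (c t) := by
      have hcl : c t ∈ closure Ω := frontier_subset_closure (hc.mem_frontier t)
      rcases lt_or_ge ‖(c t - p) / n‖ (2 * R) with h | h
      · refine contDiffAt_cutArg (mem_slitPlane_of_sector (hsec _ hcl h) le_rfl ?_)
        rw [Complex.ofReal_zero, add_zero]
        exact div_ne_zero (sub_ne_zero.2 hct) hn0
      · exact contDiffAt_const.congr_of_eventuallyEq
          (contDiffAt_cutArg_of_lt (by rw [hχ]; linarith) 0)
    have h4 : ContDiffAt ℝ 1 (fun x => cutArg χ p n 0 (c x) + Real.pi * jumpCount t₀ t) t :=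
      (h3.comp t hc1.contDiffAt).add contDiffAt_const
    refine h4.congr_of_eventuallyEq ?_
    filter_upwards [eventually_jumpCount_eq h2] with x hx
    simp only [hf, hx]

/-- The parameters of the boundary vortices. -/
noncomputable def vortexTime (n : ℕ) (i : Fin n × Fin 2) : ℝ :=
  Real.pi / n * (2 * i.1 + i.2)

theorem vortexTime_mem {n : ℕ} (i : Fin n × Fin 2) :
    vortexTime n i ∈ Set.Ico 0 (2 * Real.pi) := by
  have hn : 0 < (n : ℝ) := by exact_mod_cast (Nat.zero_lt_of_lt i.1.2)
  have h1 : (2 * i.1 + i.2 : ℝ) < 2 * n := by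
    have h2 := i.1.2
    have h3 := i.2.2
    exact_mod_cast (by omega : 2 * (i.1 : ℕ) + i.2 < 2 * n)
  refine ⟨by unfold vortexTime; positivity, ?_⟩
  rw [vortexTime, div_mul_eq_mul_div, div_lt_iff₀ hn]
  nlinarith [Real.pi_pos]

theorem vortexTime_injective (n : ℕ) : Function.Injective (vortexTime n) := by
  rintro i j hij
  have hn : 0 < (n : ℝ) := by exact_mod_cast (Nat.zero_lt_of_lt i.1.2)
  have h1 := mul_left_cancel₀ (div_pos Real.pi_pos hn).ne' hij
  have h2 : 2 * (i.1 : ℕ) + i.2 = 2 * (j.1 : ℕ) + j.2 := by exact_mod_cast h1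
  have h3 := i.2.2
  have h4 := j.2.2
  exact Prod.ext (Fin.ext (by omega)) (Fin.ext (by omega))

/-- The strengths of the boundary vortices: the phase drops by `2α` and `2π - 2α` in turn. -/
noncomputable def vortexWeight (α : ℝ) (i : Fin 2) : ℝ :=
  if i = 0 then 2 * α / Real.pi else 2 - 2 * α / Real.pi

theorem sum_sq_vortexWeight (α : ℝ) : ∑ i, vortexWeight α i ^ 2 = 4 * Cα α := by
  simp only [Fin.sum_univ_two, vortexWeight, if_true, Cα, one_ne_zero, if_false]
  ring

/-- A pair of vortices passed completely drops the phase by `2π` and is invisible. In the current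
pair the phase is `α - 2α = -α` after the first vortex and `α - 2π` after the second; the cosine is
the same. -/
theorem cos_sub_sum_jumps {n : ℕ} (hn : 0 < n) (α : ℝ) {t : ℝ} (ht : t ∈ Set.Ico 0 (2 * Real.pi))
    (hne : ∀ i, t ≠ vortexTime n i) :
    Real.cos (α - ∑ i : Fin n × Fin 2,
      vortexWeight α i.2 * (Real.pi * jumpCount (vortexTime n i) t)) = Real.cos α := by
  have hpi := Real.pi_pos
  have hn' : 0 < (n : ℝ) := by exact_mod_cast hn
  have hlt : ∀ i, t < vortexTime n i → jumpCount (vortexTime n i) t = 0 := fun i h =>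
    jumpCount_of_lt h (by linarith [(vortexTime_mem i).2, ht.1])
  have hgt : ∀ i, vortexTime n i < t → jumpCount (vortexTime n i) t = 1 := fun i h =>
    jumpCount_of_gt h (by linarith [(vortexTime_mem i).1, ht.2])
  -- The index of the current pair: its first vortex has time `2π k / n`, and the next pair starts
  -- at `2π (k + 1) / n`.
  set k : ℕ := ⌊t * n / (2 * Real.pi)⌋₊ with hk
  have hx0 : 0 ≤ t * n / (2 * Real.pi) := div_nonneg (mul_nonneg ht.1 hn'.le) (by positivity)
  have hk1 : (k : ℝ) ≤ t * n / (2 * Real.pi) := Nat.floor_le hx0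
  have hk2 : t * n / (2 * Real.pi) < k + 1 := Nat.lt_floor_add_one _
  rw [le_div_iff₀ (by positivity)] at hk1
  rw [div_lt_iff₀ (by positivity)] at hk2
  have hkn : k < n := by
    have : (k : ℝ) < n := by nlinarith [ht.2]
    exact_mod_cast this
  set S : Fin n → ℝ := fun j => ∑ b : Fin 2,
    vortexWeight α b * (Real.pi * jumpCount (vortexTime n (j, b)) t) with hS
  have hS2 : ∀ j, S j = 2 * α * jumpCount (vortexTime n (j, 0)) t +
      (2 * Real.pi - 2 * α) * jumpCount (vortexTime n (j, 1)) t := by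
    intro j
    simp only [hS, Fin.sum_univ_two, vortexWeight, if_true, one_ne_zero, if_false]
    field_simp
  have htime : ∀ j : Fin n, ∀ b : Fin 2, vortexTime n (j, b) * n = Real.pi * (2 * j + b) := by
    intro j b
    simp only [vortexTime]
    field_simp
  have hother : ∀ j : Fin n, j ≠ ⟨k, hkn⟩ → Complex.exp (S j * Complex.I) = 1 := by
    intro j hj
    rcases lt_or_gt_of_ne (fun h => hj (Fin.ext h) : (j : ℕ) ≠ k) with h | h
    · have h1 : (j : ℝ) + 1 ≤ k := by exact_mod_cast h
      have h2 : ∀ b : Fin 2, vortexTime n (j, b) < t := by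
        intro b
        have hb : (b : ℝ) ≤ 1 := by exact_mod_cast Nat.le_of_lt_succ b.2
        have := htime j b
        by_contra! hcon
        nlinarith [mul_le_mul_of_nonneg_right hcon hn'.le]
      rw [hS2, hgt _ (h2 0), hgt _ (h2 1)]
      rw [show ((2 * α * 1 + (2 * Real.pi - 2 * α) * 1 : ℝ) : ℂ) * Complex.I =
        2 * Real.pi * Complex.I by push_cast; ring]
      exact Complex.exp_two_pi_mul_I
    · have h1 : (k : ℝ) + 1 ≤ j := by exact_mod_cast h
      have h2 : ∀ b : Fin 2, t < vortexTime n (j, b) := by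
        intro b
        have hb : (0 : ℝ) ≤ b := by positivity
        have := htime j b
        by_contra! hcon
        nlinarith [mul_le_mul_of_nonneg_right hcon hn'.le]
      rw [hS2, hlt _ (h2 0), hlt _ (h2 1)]
      simp
  have hexp : Complex.exp ((∑ j, S j : ℝ) * Complex.I) =
      Complex.exp (S ⟨k, hkn⟩ * Complex.I) := by
    rw [Complex.ofReal_sum, Finset.sum_mul, Complex.exp_sum]
    exact Fintype.prod_eq_single _ hother
  have hcos : Real.cos (α - ∑ j, S j) = Real.cos (α - S ⟨k, hkn⟩) := by
    have h1 : ∀ x : ℝ, Real.cos (α - x) =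
        (Complex.exp (α * Complex.I) / Complex.exp (x * Complex.I)).re := by
      intro x
      rw [← Complex.exp_sub, ← sub_mul, ← Complex.ofReal_sub, Complex.exp_ofReal_mul_I_re]
    rw [h1, h1, hexp]
  rw [Fintype.sum_prod_type, hcos, hS2]
  have h0 : vortexTime n (⟨k, hkn⟩, 0) < t := by
    refine lt_of_le_of_ne ?_ (hne _).symm
    have := htime ⟨k, hkn⟩ 0
    simp only [Fin.val_zero, Nat.cast_zero, add_zero] at this
    refine le_of_mul_le_mul_right ?_ hn'
    rw [this]; linarith
  rw [hgt _ h0]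
  rcases lt_or_gt_of_ne (hne (⟨k, hkn⟩, 1)) with h | h
  · rw [hlt _ h, mul_zero, add_zero, mul_one, ← Real.cos_neg α]
    congr 1; ring
  · rw [hgt _ h, mul_one, mul_one, ← Real.cos_sub_two_pi α]
    congr 1; ring

/-- Places `n` pairs of boundary vortices with the two alternating strengths. Half the sum of the
squared strengths is `2 n C_α`, and each unit of squared strength costs `π s |ln ε|`. -/
theorem exists_minEnergy_le_boundary (ho : IsOpen Ω) (hb : Bornology.IsBounded Ω)
    (hΩ : HasC2Boundary Ω) (hc : IsPositiveParam Ω c) {g : ℂ → ℂ}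
    (hg1 : ∀ x ∈ frontier Ω, ‖g x‖ = 1) {α : ℝ} (hα : α ∈ Set.Ioo 0 (Real.pi / 2))
    {n : ℕ} (hn : 0 < n) {φ : ℝ → ℝ} (hφ : ContDiff ℝ 1 φ)
    (hφp : ∀ t, φ (t + 2 * Real.pi) = φ t + 2 * Real.pi * n)
    (h : ∀ t, g (c t) = Complex.exp ((φ t : ℂ) * Complex.I)) :
    ∃ C : ℝ, ∀ s ε : ℝ, 0 < s → 0 < ε → ε < 1 →
      minEnergy Ω g α s ε ≤
        ENNReal.ofReal (2 * Real.pi * n * s * Cα α * |Real.log ε| + C) := by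
  have hpi := Real.pi_pos
  have hf := hc.isFiniteMeasure_arcOn
  choose K hK R hR hKR hpar using fun t => hc.exists_parabola ho hΩ t
  set χ : ℝ → ContDiffBump (0 : ℂ) := fun t =>
    ⟨R t / 2, R t, half_pos (hR t), half_lt_self (hR t)⟩ with hχ
  have ha : ∀ i : Fin 2, 0 ≤ vortexWeight α i := by
    intro i
    have h1 : 2 * α / Real.pi ≤ 2 := by
      rw [div_le_iff₀ hpi]; linarith [hα.2]
    unfold vortexWeight
    split_ifs
    · exact div_nonneg (by linarith [hα.1]) hpi.le
    · linarith
  have haα : ∀ j : Fin n, ∑ b : Fin 2, vortexWeight α b * Real.pi = 2 * Real.pi := by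
    intro j
    simp only [Fin.sum_univ_two, vortexWeight, if_true, one_ne_zero, if_false]
    ring
  set ι := Fin n × Fin 2
  set p : ι → ℂ := fun i => c (vortexTime n i) with hp
  have hpinj : Function.Injective p := fun i j hij =>
    vortexTime_injective n (hc.injOn (vortexTime_mem i) (vortexTime_mem j) hij)
  set A : ι → ℂ → ℝ := fun i => cutArg (χ (vortexTime n i)) (p i)
    (Complex.I * deriv c (vortexTime n i)) 0 with hA
  have hB : ∀ i : ι, ContDiff ℝ 1 fun t => A i (c t) + Real.pi * jumpCount (vortexTime n i) t :=
    fun i => hc.contDiff_cutArg_add_jumpCount (R := R (vortexTime n i)) (fun x hx hxR =>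
      neg_le_re_of_parabola (hK _) (hKR _) hxR (hpar _ x hx hxR)) (hR _) rfl
  -- The continuous parts of the vortex phases are subtracted from `φ + α`, leaving only the jumps
  -- in the product. Their total drop over a period is `2π n`, so the function is periodic.
  obtain ⟨H, hH, hHc⟩ := hc.exists_contDiff_comp_eq
    (f := fun t => φ t + α - ∑ i : ι, vortexWeight α i.2 *
      (A i (c t) + Real.pi * jumpCount (vortexTime n i) t))
    ((hφ.add contDiff_const).sub (ContDiff.sum fun i _ => contDiff_const.mul (hB i))) (fun t => by
      have h1 : ∑ i : ι, vortexWeight α i.2 * Real.pi = 2 * Real.pi * n := by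
        rw [Fintype.sum_prod_type, Finset.sum_congr rfl fun j _ => haα j, Finset.sum_const,
          Finset.card_univ, Fintype.card_fin, nsmul_eq_mul, mul_comm]
      have h2 : ∀ i : ι, vortexWeight α i.2 *
          (A i (c t) + Real.pi * (jumpCount (vortexTime n i) t + 1)) =
          vortexWeight α i.2 * (A i (c t) + Real.pi * jumpCount (vortexTime n i) t) +
          vortexWeight α i.2 * Real.pi := fun i => by ring
      simp only [hφp, hc.periodic t, jumpCount_add_period, h2, Finset.sum_add_distrib, h1]
      ring)
  choose M C hM hC hV using fun i : ι => hc.exists_vortexFactor_boundary ho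
    (hK (vortexTime n i)) (hR _) (hKR _) (hpar _) (χ := χ (vortexTime n i)) rfl (ha i.2)
  obtain ⟨C', hC'⟩ := exists_minEnergy_le_of_vortexFactor ho hb hf hg1 α hpinj hH
    (M := ∑ i, M i) (Finset.sum_nonneg fun i _ => hM i)
  refine ⟨1 / 2 * ∑ i : ι, vortexWeight α i.2 ^ 2 * C i + C', fun s ε hs hε hε1 => ?_⟩
  refine (hC' s ε hε (fun i => vortexWeight α i.2 ^ 2 * (Real.pi * (s * |Real.log ε|) + C i)) _ _
    (fun i => mul_nonneg (sq_nonneg _) (add_nonneg (by positivity) (hC i)))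
    (fun i => (hV i s ε hs hε hε1).mono
      (Finset.single_le_sum (fun i _ => hM i) (Finset.mem_univ i)) hε) ?_).trans_eq ?_
  -- At a vortex the limiting phase takes the mean value of its jump, where the anchoring condition
  -- may fail; these points form a null set.
  · have hae : ∀ᵐ x ∂(arcOn Ω), ∀ i, x ≠ p i := by
      rw [ae_all_iff]
      intro i
      simp [ae_iff]
    filter_upwards [hae, show ∀ᵐ x ∂(arcOn Ω), x ∈ frontier Ω from
      ae_restrict_mem isClosed_frontier.measurableSet] with x hx hxf
    rw [← hc.range_eq] at hxf
    obtain ⟨t', rfl⟩ := hxf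
    obtain ⟨m, hm⟩ := exists_add_int_mul_mem_Ico 0 t'
    rw [zero_add] at hm
    rw [← hc.add_int_mul t' m] at hx ⊢
    set t := t' + m * (2 * Real.pi)
    have h1 : Complex.exp (H (c t) * Complex.I) *
        ∏ i : ι, Complex.exp ((vortexWeight α i.2 * A i (c t) : ℝ) * Complex.I) =
        g (c t) * Complex.exp ((α - ∑ i : ι, vortexWeight α i.2 *
          (Real.pi * jumpCount (vortexTime n i) t) : ℝ) * Complex.I) := by
      rw [← Complex.exp_sum, ← Complex.exp_add, hHc, h, ← Complex.exp_add, ← Finset.sum_mul]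
      congr 1
      simp only [mul_add, Finset.sum_add_distrib]
      push_cast
      ring
    have h2 := cos_sub_sum_jumps hn α hm (fun i hi => hx i (by rw [hi]))
    rw [h1, mul_right_comm, Complex.mul_conj, Complex.normSq_eq_norm_sq,
      hg1 _ (hc.mem_frontier t), one_pow, Complex.ofReal_one, one_mul,
      Complex.exp_ofReal_mul_I_re]
    exact h2
  · congr 1
    have h1 : ∑ i : ι, vortexWeight α i.2 ^ 2 = n * (4 * Cα α) := by
      rw [Fintype.sum_prod_type, Finset.sum_congr rfl fun j _ => sum_sq_vortexWeight α,
        Finset.sum_const, Finset.card_univ, Fintype.card_fin, nsmul_eq_mul]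
    simp only [mul_add, Finset.sum_add_distrib, ← Finset.sum_mul, h1]
    ring

/-! ### Large `ε` and conclusion -/

/-- For `ε ≥ 1` the zero map has bounded energy. -/
theorem exists_minEnergy_le_of_one_le (ho : IsOpen Ω) (hb : Bornology.IsBounded Ω)
    (hf : IsFiniteMeasure (arcOn Ω)) (g : ℂ → ℂ) (α : ℝ) :
    ∃ C : ℝ, ∀ s ε : ℝ, 0 < s → 1 ≤ ε → minEnergy Ω g α s ε ≤ ENNReal.ofReal C := by
  have hA : areaOn Ω Set.univ ≠ ⊤ := by
    simpa [areaOn] using hb.measure_lt_top.ne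
  have hB : arcOn Ω Set.univ ≠ ⊤ := measure_ne_top _ _
  refine ⟨(areaOn Ω Set.univ + arcOn Ω Set.univ).toReal, fun s ε hs hε => ?_⟩
  rw [ENNReal.ofReal_toReal (ENNReal.add_ne_top.2 ⟨hA, hB⟩)]
  refine (minEnergy_le_energy ho hb hf g α s ε (u := fun _ => 0)
    fun _ _ => contDiffAt_const).trans (add_le_add ?_ ?_)
  · refine (lintegral_mono (g := fun _ => 1) fun x => ?_).trans (by simp)
    rw [← ENNReal.ofReal_one]
    refine ENNReal.ofReal_le_ofReal ?_
    have h1 : 1 / (2 * ε ^ 2) ≤ 1 := by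
      rw [div_le_one (by positivity)]; nlinarith
    simp only [fderiv_fun_const, Pi.zero_apply, zero_apply, norm_zero]
    linarith
  · refine (lintegral_mono (g := fun _ => 1) fun x => ?_).trans (by simp)
    rw [← ENNReal.ofReal_one]
    refine ENNReal.ofReal_le_ofReal ?_
    have h1 : ε ^ (-s) ≤ 1 := Real.rpow_le_one_of_one_le_of_nonpos hε (by linarith)
    have h0 : 0 ≤ ε ^ (-s) := Real.rpow_nonneg (by linarith) _
    have h2 : anchoring α 0 (g x) ≤ 2 := by
      have := Real.cos_sq_le_one α
      simp only [anchoring, norm_zero, zero_mul, Complex.zero_re]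
      nlinarith
    nlinarith

end Boojum

theorem lemma3p1 (Ω : Set ℂ) (hΩ : Boojum.IsC2Domain Ω)
    (g : ℂ → ℂ) (hg : ContDiffOn ℝ 1 g (frontier Ω)) (hg1 : ∀ x ∈ frontier Ω, ‖g x‖ = 1)
    (D : ℤ) (hdeg : Boojum.HasBoundaryDegree Ω g D) (hD : 0 < D)
    (α : ℝ) (hα : α ∈ Set.Ioo 0 (Real.pi / 2)) :
    ∃ C₁ : ℝ, ∀ s ∈ Set.Ioc (0 : ℝ) 1, ∀ ε : ℝ, 0 < ε →
      (1 / 2 ≤ s * Boojum.Cα α →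
        Boojum.minEnergy Ω g α s ε
          ≤ ENNReal.ofReal (Real.pi * (D : ℝ) * |Real.log ε| + C₁)) ∧
      (s * Boojum.Cα α < 1 / 2 →
        Boojum.minEnergy Ω g α s ε
          ≤ ENNReal.ofReal (2 * Real.pi * (D : ℝ) * s * Boojum.Cα α * |Real.log ε| + C₁)) := by
  obtain ⟨c, hc, φ, hφc, hφe, hφD⟩ := hdeg
  lift D to ℕ using hD.le with n
  have hn : 0 < n := by exact_mod_cast hD
  simp only [Int.cast_natCast] at hφD ⊢
  obtain ⟨hφ, hφp⟩ := hc.exists_phase hg hφc hφe hφD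
  obtain ⟨A, hA⟩ := Boojum.exists_minEnergy_le_interior hΩ.isOpen hΩ.isBounded hc hg1 α hφ hφp hφe
  obtain ⟨B, hB⟩ :=
    Boojum.exists_minEnergy_le_boundary hΩ.isOpen hΩ.isBounded hΩ.boundary hc hg1 hα hn hφ hφp hφe
  obtain ⟨C, hC⟩ := Boojum.exists_minEnergy_le_of_one_le hΩ.isOpen hΩ.isBounded
    hc.isFiniteMeasure_arcOn g α
  have hCα : 0 ≤ Boojum.Cα α := by unfold Boojum.Cα; positivity
  -- Absolute values make one constant dominate each of the three; for `ε ≥ 1` the nonnegative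
  -- logarithmic term is simply added.
  refine ⟨|A| + |B| + |C|, fun s hs ε hε => ?_⟩
  have hs0 := hs.1
  have h1 : 0 ≤ Real.pi * (n : ℝ) * |Real.log ε| := by positivity
  have h2 : 0 ≤ 2 * Real.pi * (n : ℝ) * s * Boojum.Cα α * |Real.log ε| := by positivity
  have hA' := le_abs_self A
  have hB' := le_abs_self B
  have hC' := le_abs_self C
  have hA0 := abs_nonneg A
  have hB0 := abs_nonneg B
  have hC0 := abs_nonneg C
  rcases lt_or_ge ε 1 with h | h
  · exact ⟨fun _ => (hA s ε hs.1 hs.2 hε h).trans (ENNReal.ofReal_le_ofReal (by linarith)),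
      fun _ => (hB s ε hs.1 hε h).trans (ENNReal.ofReal_le_ofReal (by linarith))⟩
  · exact ⟨fun _ => (hC s ε hs.1 h).trans (ENNReal.ofReal_le_ofReal (by linarith)),
      fun _ => (hC s ε hs.1 h).trans (ENNReal.ofReal_le_ofReal (by linarith))⟩
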